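/- **Setting.** Let $n\ge 1$ and let $D\subset\mathbb C^n$ be a bounded open set with a defining function $r$: $r$ is real and $C^\infty$ on a neighbourhood $W$ of $\overline D$, $D=\{\zeta\in W: r(\zeta)<0\}$, $\partial D=\{\zeta\in W: r(\zeta)=0\}$, and on a neighbourhood of $\partial D$ the function $r$ is strictly plurisubharmonic and all its critical points are non-degenerate and lie on $\partial D$ (so $dr$ may vanish on $\partial D$). Let $g=\sum g_{jk}\,d\zeta_j d\bar\zeta_k$ be a smooth Hermitian metric on $\mathbb C^n$ with $g_{jk}=\partial^2 r/\partial\zeta_j\partial\bar\zeta_k$ near $\partial D$, and let $\gamma=|\partial r|_g$ (normalised so that $|d\zeta_j|^2=2$ for the Euclidean metric $\sum d\zeta_j d\bar\zeta_j$). Let $\rho(\zeta,z)$ be symmetric, positive off the diagonal, equal to the geodesic distance of $g$ near the diagonal, with $\rho^2$ smooth. Fix $\kappa>0$ and a smooth function $\chi(\zeta,z)$ with $\chi=1$ where $\rho^2\le\kappa/2$ and $\chi=0$ where $\rho^2\ge \frac34\kappa$. For $\epsilon>0$ put $r_\epsilon=r+\epsilon$, $D_\epsilon=\{\zeta\in D:r_\epsilon(\zeta)<0\}$,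 $$F(\zeta,z)=\sum_j\frac{\partial r}{\partial\zeta_j}(\zeta)(\zeta_j-z_j)-\frac12\sum_{j,k}\frac{\partial^2 r}{\partial\zeta_j\partial\zeta_k}(\zeta)(\zeta_j-z_j)(\zeta_k-z_k),$$ $$\phi_\epsilon=\chi\,(F-r_\epsilon(\zeta))+(1-\chi)\rho^2,\qquad P_\epsilon=\rho^2+2\,\frac{r_\epsilon(\zeta)}{\gamma(\zeta)}\frac{r_\epsilon(z)}{\gamma(z)},$$ where $1/P_\epsilon$ is read as $0$ if $\gamma(\zeta)\gamma(z)=0$. For a function or double form $h$ (a form in $\zeta$ with values in the forms in $z$), $h^*(\zeta,z)=h(z,\zeta)$; a function of one variable is taken at $\zeta$, and with a star at $z$. $|\cdot|$ of a double form is the maximum of the moduli of its coefficients, and $dV$ is Lebesgue measure. **Admissible kernels.** Let $\epsilon_0>0$ and $\tau\in\mathbb Z$. An *admissible family of type $\ge\tau$* consists of double forms $\mathcal A^\epsilon(\zeta,z)$ on $\overline D_\epsilon\times\overline D_\epsilon$, $0<\epsilon<\epsilon_0$, such that * each $\mathcal A^\epsilon$ is smooth off the diagonal, and for each $\eta>0$,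 $|\mathcal A^\epsilon(\zeta,z)|$ is bounded on $\{|\zeta-z|\ge\eta\}$ uniformly in $\epsilon$; * each $\zeta_0\in\overline D$ has an open neighbourhood $U$, independent of $\epsilon$, such that for every $\epsilon$, off the diagonal of $(U\cap\overline D_\epsilon)\times(U\cap\overline D_\epsilon)$, $\mathcal A^\epsilon$ or $\overline{\mathcal A^\epsilon}$ equals $$R_N\,R_M'^{\,*}\;\mathcal E_{j,\alpha}\wedge\mathcal E_{k,\beta}^{*}\;P_\epsilon^{-t_0}\,\phi_\epsilon^{t_1}\,\overline{\phi}_\epsilon^{\,t_2}\,\phi_\epsilon^{*\,t_3}\,\overline{\phi}_\epsilon^{*\,t_4}\;r_\epsilon^{\,l}\,r_\epsilon^{*\,m}$$ with integers independent of $\epsilon$ satisfying $N,M,j,k,t_0,l,m\ge0$, $N+\alpha\ge0$, $M+\beta\ge0$, $t:=-(t_1+t_2+t_3+t_4)\ge0$, and with $$s-\max\{0,\,2-N-M-\alpha-\beta\}\ge\tau,\qquad s=2n+j+\min\{2,t-l-m\}-2(t_0+t-l-m).$$ Here $R_N$, $R'_M$ are linear combinations with constant coefficients, independent of $\epsilon$,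 of $N$-fold, respectively $M$-fold, products of the first derivatives $\partial r/\partial\zeta_i$, $\partial r/\partial\bar\zeta_i$. Further, $\mathcal E_{j,\alpha}$ (which may depend on $\epsilon$) is a double form, smooth on $(U\cap\overline D_\epsilon)\times(U\cap\overline D_\epsilon)$, with $|\mathcal E_{j,\alpha}(\zeta,z)|\le C|\xi_\alpha(\zeta)|\,|\zeta-z|^j$, where $C$ and $\xi_\alpha$ are independent of $\epsilon$ and $\xi_\alpha$ is a smooth function on $D$ such that for each order $q\ge0$ one has $\gamma^{q}|D^q\xi_\alpha|\le C_q\gamma^\alpha$ on $D\cap\{\gamma\ne0\}$; similarly for $\mathcal E_{k,\beta}$. **Proposition.** There is $\epsilon_1>0$ such that for all $0<\epsilon_0\le\epsilon_1$ the following holds. Let $(\mathcal A_j^\epsilon)_{0<\epsilon<\epsilon_0}$ be an admissible family of type $\ge j$, $j\in\mathbb Z$, and let $\lambda\ge1$ satisfy $\lambda(2n+2-j)<2n+2$ (that is, $1\le\lambda<\frac{2n+2}{2n+2-j}$ if $j<2n+2$). Then there is a constant $C<\infty$, independent of $\epsilon$, $z$ and $\zeta$, such that for all $0<\epsilon<\epsilon_0$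 $$\int_{D_\epsilon}|\mathcal A_j^\epsilon(\zeta,z)|^\lambda\,dV(\zeta)<C\quad\text{for all }z\in\overline D_\epsilon,\qquad \int_{D_\epsilon}|\mathcal A_j^\epsilon(\zeta,z)|^\lambda\,dV(z)<C\quad\text{for all }\zeta\in\overline D_\epsilon .$$ -/

import Mathlib

open scoped ComplexOrder ContDiff ComplexConjugate Matrix

noncomputable section

namespace HenkinLeiterer

/-- `ℂⁿ` with its Euclidean norm and Lebesgue measure. -/
abbrev Cn (n : ℕ) : Type := EuclideanSpace ℂ (Fin n)

/-! ### Wirtinger derivatives -/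

/-- `∂f/∂ζ_j`. -/
def dz {n : ℕ} (j : Fin n) (f : Cn n → ℂ) (ζ : Cn n) : ℂ :=
  (fderiv ℝ f ζ (EuclideanSpace.single j 1)
    - Complex.I * fderiv ℝ f ζ (EuclideanSpace.single j Complex.I)) / 2

/-- `∂f/∂ζ̄_j`. -/
def dzbar {n : ℕ} (j : Fin n) (f : Cn n → ℂ) (ζ : Cn n) : ℂ :=
  (fderiv ℝ f ζ (EuclideanSpace.single j 1)
    + Complex.I * fderiv ℝ f ζ (EuclideanSpace.single j Complex.I)) / 2

/-- A real function regarded as a complex one. -/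
def toC {n : ℕ} (r : Cn n → ℝ) : Cn n → ℂ := fun ζ => (r ζ : ℂ)

/-- The Levi matrix `(∂²r/∂ζ_j∂ζ̄_k)(ζ)`. -/
def leviMatrix {n : ℕ} (r : Cn n → ℝ) (ζ : Cn n) : Matrix (Fin n) (Fin n) ℂ :=
  Matrix.of fun j k => dz j (dzbar k (toC r)) ζ

/-! ### The domain -/

/-- `D` is a bounded strictly pseudoconvex Henkin-Leiterer domain in `ℂⁿ` with Morse defining
function `r`: `dr` may vanish on the boundary. The critical points of `r` inside `D` and away from
the boundary (such as its minimum) are not restricted. -/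
structure IsMorseDomain {n : ℕ} (D : Set (Cn n)) (r : Cn n → ℝ) : Prop where
  isOpen : IsOpen D
  isBounded : Bornology.IsBounded D
  /-- `r` is smooth near `D̄`, with `D = {r < 0}` and `∂D = {r = 0}`. -/
  defining : ∃ W : Set (Cn n), IsOpen W ∧ closure D ⊆ W ∧ ContDiffOn ℝ ∞ r W ∧
    D = {ζ | ζ ∈ W ∧ r ζ < 0} ∧ frontier D = {ζ | ζ ∈ W ∧ r ζ = 0}
  /-- Near `∂D` the function `r` is strictly plurisubharmonic, and its critical points there are
  non-degenerate and lie on `∂D`. -/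
  collar : ∃ U : Set (Cn n), IsOpen U ∧ frontier D ⊆ U ∧
    (∀ ζ ∈ U, (leviMatrix r ζ).PosDef) ∧
    (∀ ζ ∈ U, fderiv ℝ r ζ = 0 →
      ζ ∈ frontier D ∧ ∀ v : Cn n, (∀ w : Cn n, fderiv ℝ (fderiv ℝ r) ζ v w = 0) → v = 0)

/-- `r_ε = r + ε`. -/
def rEps {n : ℕ} (r : Cn n → ℝ) (ε : ℝ) (ζ : Cn n) : ℝ := r ζ + ε

/-- `D_ε = {ζ ∈ D : r_ε(ζ) < 0}`. -/
def DEps {n : ℕ} (D : Set (Cn n)) (r : Cn n → ℝ) (ε : ℝ) : Set (Cn n) :=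
  {ζ | ζ ∈ D ∧ rEps r ε ζ < 0}

/-! ### Levi metric, `γ` and `ρ` -/

/-- `g` is a smooth Hermitian metric `∑ g_{jk} dζ_j dζ̄_k` on `ℂⁿ` which coincides with the Levi
form of `r` in a neighbourhood of `∂D`. -/
structure IsLeviMetric {n : ℕ} (D : Set (Cn n)) (r : Cn n → ℝ)
    (g : Cn n → Matrix (Fin n) (Fin n) ℂ) : Prop where
  smooth : ∀ j k, ContDiff ℝ ∞ (fun ζ => g ζ j k)
  posDef : ∀ ζ, (g ζ).PosDef
  levi : ∃ V : Set (Cn n), IsOpen V ∧ frontier D ⊆ V ∧ ∀ ζ ∈ V, g ζ = leviMatrix r ζ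

/-- The length of the tangent vector `v` at `ζ`. -/
def tangentLength {n : ℕ} (g : Cn n → Matrix (Fin n) (Fin n) ℂ) (ζ v : Cn n) : ℝ :=
  Real.sqrt (∑ j, ∑ k, g ζ j k * v j * conj (v k)).re

/-- The geodesic distance: infimum of the lengths of `C¹` curves from `x` to `y`. -/
def geodesicDist {n : ℕ} (g : Cn n → Matrix (Fin n) (Fin n) ℂ) (x y : Cn n) : ℝ :=
  sInf {L : ℝ | ∃ c : ℝ → Cn n, ContDiff ℝ 1 c ∧ c 0 = x ∧ c 1 = y ∧
    L = ∫ s in (0 : ℝ)..1, tangentLength g (c s) (deriv c s)}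

/-- `ρ` is symmetric, positive off the diagonal, coincides with the geodesic distance near the
diagonal, and is smooth in the sense that `ρ²` is smooth. -/
structure IsDistanceFunction {n : ℕ} (g : Cn n → Matrix (Fin n) (Fin n) ℂ)
    (ρ : Cn n → Cn n → ℝ) : Prop where
  symm : ∀ x y, ρ x y = ρ y x
  smooth_sq : ContDiff ℝ ∞ (fun p : Cn n × Cn n => ρ p.1 p.2 ^ 2)
  pos : ∀ x y, x ≠ y → 0 < ρ x y
  geodesic : ∃ O : Set (Cn n × Cn n), IsOpen O ∧ (∀ x, (x, x) ∈ O) ∧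
    ∀ p ∈ O, ρ p.1 p.2 = geodesicDist g p.1 p.2

/-- `γ = |∂r|`, the length of the covector `∂r` in the metric `g`
(normalised as usual so that `|dζ_j|² = 2` for the Euclidean metric `∑ dζ_j dζ̄_j`). -/
def gam {n : ℕ} (r : Cn n → ℝ) (g : Cn n → Matrix (Fin n) (Fin n) ℂ) (ζ : Cn n) : ℝ :=
  Real.sqrt (2 * ∑ j, ∑ k, conj (dz j (toC r) ζ) * (g ζ)⁻¹ j k * dz k (toC r) ζ).re

/-! ### The functions `F`, `φ_ε` and `P_ε` -/

/-- The Levi polynomial. -/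
def leviPoly {n : ℕ} (r : Cn n → ℝ) (ζ z : Cn n) : ℂ :=
  ∑ j, dz j (toC r) ζ * (ζ j - z j)
    - 1 / 2 * ∑ j, ∑ k, dz j (dz k (toC r)) ζ * (ζ j - z j) * (ζ k - z k)

/-- `χ` is a smooth patching function: `1` where `ρ² ≤ κ/2` and `0` where `ρ² ≥ 3κ/4`. -/
structure IsPatching {n : ℕ} (ρ : Cn n → Cn n → ℝ) (κ : ℝ) (χ : Cn n → Cn n → ℝ) : Prop where
  smooth : ContDiff ℝ ∞ (fun p : Cn n × Cn n => χ p.1 p.2)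
  eq_one : ∀ ζ z, ρ ζ z ^ 2 ≤ κ / 2 → χ ζ z = 1
  eq_zero : ∀ ζ z, 3 / 4 * κ ≤ ρ ζ z ^ 2 → χ ζ z = 0

/-- `φ_ε = χ (F - r_ε(ζ)) + (1 - χ) ρ²`. -/
def phi {n : ℕ} (r : Cn n → ℝ) (ρ χ : Cn n → Cn n → ℝ) (ε : ℝ) (ζ z : Cn n) : ℂ :=
  (χ ζ z : ℂ) * (leviPoly r ζ z - (rEps r ε ζ : ℂ))
    + (1 - (χ ζ z : ℂ)) * ((ρ ζ z ^ 2 : ℝ) : ℂ)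

/-- `P_ε = ρ² + 2 (r_ε(ζ)/γ(ζ)) (r_ε(z)/γ(z))`, where `γ(ζ) γ(z) ≠ 0`. -/
def bigP {n : ℕ} (r : Cn n → ℝ) (g : Cn n → Matrix (Fin n) (Fin n) ℂ)
    (ρ : Cn n → Cn n → ℝ) (ε : ℝ) (ζ z : Cn n) : ℝ :=
  ρ ζ z ^ 2 + 2 * (rEps r ε ζ / gam r g ζ) * (rEps r ε z / gam r g z)

/-- `1 / P_ε`, see `invP_eq`. At the critical points of `r` inside `D`, where `P_ε = +∞`,
its value is `0`. -/
def invP {n : ℕ} (r : Cn n → ℝ) (g : Cn n → Matrix (Fin n) (Fin n) ℂ)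
    (ρ : Cn n → Cn n → ℝ) (ε : ℝ) (ζ z : Cn n) : ℝ :=
  gam r g ζ * gam r g z /
    (gam r g ζ * gam r g z * ρ ζ z ^ 2 + 2 * rEps r ε ζ * rEps r ε z)

theorem invP_eq {n : ℕ} (r : Cn n → ℝ) (g : Cn n → Matrix (Fin n) (Fin n) ℂ)
    (ρ : Cn n → Cn n → ℝ) (ε : ℝ) (ζ z : Cn n) (h1 : gam r g ζ ≠ 0) (h2 : gam r g z ≠ 0) :
    invP r g ρ ε ζ z = (bigP r g ρ ε ζ z)⁻¹ := by
  have h : bigP r g ρ ε ζ z =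
      (gam r g ζ * gam r g z * ρ ζ z ^ 2 + 2 * rEps r ε ζ * rEps r ε z) /
        (gam r g ζ * gam r g z) := by
    unfold bigP
    field_simp
  rw [h, inv_div, invP]

/-! ### Double forms -/

/-- The value at `(ζ, z)` of a double form: its coefficient at `(S, T)` belongs to the basis element
`e_S ⊗ f_T`. Here `e_S` is the exterior product, in increasing order, of the `e_i`, `i ∈ S`, with
`e_1, …, e_{2n} = dζ_1, …, dζ_n, dζ̄_1, …, dζ̄_n`, and `f_T` is the same in the variable `z`.
The norm `‖a‖` is the largest modulus of a coefficient. -/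
abbrev DoubleForm (n : ℕ) : Type := Finset (Fin (n + n)) × Finset (Fin (n + n)) → ℂ

/-- The sign in `e_S ∧ e_T = ± e_{S ∪ T}` for disjoint `S`, `T`. -/
def wedgeSign {m : ℕ} (S T : Finset (Fin m)) : ℂ :=
  (-1) ^ ((S ×ˢ T).filter fun p => p.2 < p.1).card

/-- The exterior product of double forms (forms in `ζ` commute with forms in `z`). -/
def wedge {n : ℕ} (a b : DoubleForm n) : DoubleForm n := fun p =>
  ∑ S ∈ p.1.powerset, ∑ T ∈ p.2.powerset,
    wedgeSign S (p.1 \ S) * wedgeSign T (p.2 \ T) * (a (S, T) * b (p.1 \ S, p.2 \ T))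

/-- The involution `dζ_j ↔ dζ̄_j` on index sets. -/
def conjIndex {n : ℕ} (S : Finset (Fin (n + n))) : Finset (Fin (n + n)) :=
  S.map (finAddFlip (m := n) (n := n)).toEmbedding

/-- The sign in `conj e_S = ± e_{conjIndex S}`. -/
def conjSign {n : ℕ} (S : Finset (Fin (n + n))) : ℂ :=
  (-1) ^ ((S.filter fun i => i.val < n).card * (S.filter fun i => n ≤ i.val).card)

/-- Complex conjugation of double forms. -/
def conjForm {n : ℕ} (a : DoubleForm n) : DoubleForm n := fun p =>
  conjSign p.1 * conjSign p.2 * conj (a (conjIndex p.1, conjIndex p.2))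

/-- Exchange of the roles of the two variables of a double form. -/
def swapForm {n : ℕ} (a : DoubleForm n) : DoubleForm n := fun p => a (p.2, p.1)

/-! ### Admissible kernels -/

/-- `R` is a sum of `N`-fold products of first derivatives of `r` (a constant if `N = 0`). -/
def IsDerivProduct {n : ℕ} (r : Cn n → ℝ) (N : ℕ) (R : Cn n → ℂ) : Prop :=
  ∃ Q : MvPolynomial (Fin n ⊕ Fin n) ℂ, Q.IsHomogeneous N ∧
    ∀ ζ, R ζ = MvPolynomial.eval
      (Sum.elim (fun j => dz j (toC r) ζ) (fun j => dzbar j (toC r) ζ)) Q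

/-- `ξ` is smooth on `D` and `γ^m |D^m ξ| ≲ γ^k` for all `m` (where `γ ≠ 0`). -/
def IsXi {n : ℕ} (D : Set (Cn n)) (r : Cn n → ℝ) (g : Cn n → Matrix (Fin n) (Fin n) ℂ)
    (k : ℤ) (ξ : Cn n → ℝ) : Prop :=
  ContDiffOn ℝ ∞ ξ D ∧ ∀ m : ℕ, ∃ C : ℝ, ∀ ζ ∈ D, gam r g ζ ≠ 0 →
    gam r g ζ ^ m * ‖iteratedFDeriv ℝ m ξ ζ‖ ≤ C * gam r g ζ ^ k

/-- `𝓔` is a family of double forms of class `𝓔_{j,k}`: the form with parameter `ε` is smooth on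
`(U ∩ D̄_ε) × (U ∩ D̄_ε)`, and `|𝓔(ζ,z)| ≲ ξ_k(ζ) |ζ - z|^j` with `ξ_k` and the constant independent
of `ε`. The form may, but need not, depend on `ε`. -/
def IsScriptE {n : ℕ} (D : Set (Cn n)) (r : Cn n → ℝ) (g : Cn n → Matrix (Fin n) (Fin n) ℂ)
    (ε₀ : ℝ) (U : Set (Cn n)) (j : ℕ) (k : ℤ) (𝓔 : ℝ → Cn n → Cn n → DoubleForm n) : Prop :=
  (∀ ε ∈ Set.Ioo 0 ε₀, ContDiffOn ℝ ∞ (fun p : Cn n × Cn n => 𝓔 ε p.1 p.2)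
    ((U ∩ closure (DEps D r ε)) ×ˢ (U ∩ closure (DEps D r ε)))) ∧
  ∃ ξ : Cn n → ℝ, IsXi D r g k ξ ∧ ∃ C : ℝ, ∀ ε ∈ Set.Ioo 0 ε₀,
    ∀ ζ ∈ U ∩ closure (DEps D r ε), ∀ z ∈ U ∩ closure (DEps D r ε),
      ‖𝓔 ε ζ z‖ ≤ C * |ξ ζ| * ‖ζ - z‖ ^ j

/-- The integers in a representation
`R_N R_M^* 𝓔_{j,α} 𝓔_{k,β}^* P^{-t₀} φ^{t₁} φ̄^{t₂} (φ^*)^{t₃} (φ̄^*)^{t₄} r_ε^l (r_ε^*)^m`. -/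
structure Exponents where
  (N M j k t0 l m : ℕ)
  (α β t1 t2 t3 t4 : ℤ)

/-- `t = -(t₁ + t₂ + t₃ + t₄)`. -/
def Exponents.t (e : Exponents) : ℤ := -(e.t1 + e.t2 + e.t3 + e.t4)

/-- The restrictions on the exponents (besides the non-negativity of `N, M, j, k, t₀, l, m`). -/
def Exponents.Valid (e : Exponents) : Prop :=
  0 ≤ e.t ∧ 0 ≤ (e.N : ℤ) + e.α ∧ 0 ≤ (e.M : ℤ) + e.β

/-- The smooth type `s`. -/
def Exponents.smoothType (e : Exponents) (n : ℕ) : ℤ :=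
  2 * n + e.j + min 2 (e.t - e.l - e.m) - 2 * (e.t0 + e.t - e.l - e.m)

/-- The type `τ`. -/
def Exponents.type (e : Exponents) (n : ℕ) : ℤ :=
  e.smoothType n - max 0 (2 - e.N - e.M - e.α - e.β)

/-- The double form
`R_N R_M^* 𝓔_{j,α} 𝓔_{k,β}^* P^{-t₀} φ^{t₁} φ̄^{t₂} (φ^*)^{t₃} (φ̄^*)^{t₄} r_ε^l (r_ε^*)^m`
at `(ζ, z)`, where `^*` exchanges `ζ` and `z`, unstarred functions of one variable are taken
at `ζ`, and `a`, `b` are the forms of class `𝓔_{j,α}`, `𝓔_{k,β}`. -/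
def kernelTerm {n : ℕ} (r : Cn n → ℝ) (g : Cn n → Matrix (Fin n) (Fin n) ℂ)
    (ρ χ : Cn n → Cn n → ℝ) (e : Exponents) (R R' : Cn n → ℂ)
    (a b : Cn n → Cn n → DoubleForm n) (ε : ℝ) (ζ z : Cn n) : DoubleForm n :=
  (R ζ * R' z * (invP r g ρ ε ζ z : ℂ) ^ e.t0
    * phi r ρ χ ε ζ z ^ e.t1 * conj (phi r ρ χ ε ζ z) ^ e.t2
    * phi r ρ χ ε z ζ ^ e.t3 * conj (phi r ρ χ ε z ζ) ^ e.t4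
    * (rEps r ε ζ : ℂ) ^ e.l * (rEps r ε z : ℂ) ^ e.m) •
  wedge (a ζ z) (swapForm (b z ζ))

/-- `(𝓐^ε)_{0 < ε < ε₀}` is a family of admissible kernels of type (at least) `τ`:

* each `𝓐^ε` is a double form on `D̄_ε × D̄_ε`, smooth off the diagonal, and, uniformly in `ε`,
  bounded away from the diagonal;
* near each point of the diagonal of `D̄ × D̄`, `𝓐^ε` or its conjugate has a representation of type
  `≥ τ`, in which the neighbourhood, the exponents, the functions `R`, and the constants in the
  estimates do not depend on `ε`. -/
structure IsAdmissibleFamily {n : ℕ} (D : Set (Cn n)) (r : Cn n → ℝ)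
    (g : Cn n → Matrix (Fin n) (Fin n) ℂ) (ρ χ : Cn n → Cn n → ℝ) (ε₀ : ℝ) (τ : ℤ)
    (𝓐 : ℝ → Cn n → Cn n → DoubleForm n) : Prop where
  smooth : ∀ ε ∈ Set.Ioo 0 ε₀, ContDiffOn ℝ ∞ (fun p : Cn n × Cn n => 𝓐 ε p.1 p.2)
    ((closure (DEps D r ε) ×ˢ closure (DEps D r ε)) \ Set.diagonal (Cn n))
  offDiagonal : ∀ η : ℝ, 0 < η → ∃ C : ℝ, ∀ ε ∈ Set.Ioo 0 ε₀,
    ∀ ζ ∈ closure (DEps D r ε), ∀ z ∈ closure (DEps D r ε), η ≤ ‖ζ - z‖ → ‖𝓐 ε ζ z‖ ≤ C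
  representation : ∀ ζ₀ ∈ closure D, ∃ U : Set (Cn n), IsOpen U ∧ ζ₀ ∈ U ∧
    ∃ e : Exponents, e.Valid ∧ τ ≤ e.type n ∧
    ∃ R R' : Cn n → ℂ, IsDerivProduct r e.N R ∧ IsDerivProduct r e.M R' ∧
    ∃ a b : ℝ → Cn n → Cn n → DoubleForm n,
      IsScriptE D r g ε₀ U e.j e.α a ∧ IsScriptE D r g ε₀ U e.k e.β b ∧
      ∀ ε ∈ Set.Ioo 0 ε₀,
        (∀ ζ ∈ U ∩ closure (DEps D r ε), ∀ z ∈ U ∩ closure (DEps D r ε), ζ ≠ z →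
          𝓐 ε ζ z = kernelTerm r g ρ χ e R R' (a ε) (b ε) ε ζ z) ∨
        (∀ ζ ∈ U ∩ closure (DEps D r ε), ∀ z ∈ U ∩ closure (DEps D r ε), ζ ≠ z →
          conjForm (𝓐 ε ζ z) = kernelTerm r g ρ χ e R R' (a ε) (b ε) ε ζ z)

end HenkinLeiterer

end

open scoped ComplexOrder ContDiff ComplexConjugate Matrix

noncomputable section

namespace HenkinLeiterer

open MeasureTheory Metric Set

/-! ### A singular integral -/

/-! Near the diagonal only a few sizes matter: d = |ζ - z|, the weight w = |∂r| + |r_ε| at either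
point, and Q = |r_ε(ζ)| + |r_ε(z)| + |∂r(z)(ζ - z)| + d². Taylor expansion gives 2 Re F = r(ζ) -
r(z) + (Levi form) + O(d³), so Re φ_ε dominates |r_ε(ζ)| + |r_ε(z)| + d². Since also F = ∂r(z)(ζ -
z) + O(d²), both |φ_ε| and |φ_ε^*| are comparable with Q (`exists_geometricBounds`). Moreover 1/P_ε
is O((|r_ε(ζ)| + |r_ε(z)| + d)⁻²) (`GeometricBounds.invP_bounds`), and a product R_N ξ_α is
O(w^(N+α)) (`exists_derivProduct_mul_xi_le`). With a = N + α and b = M + β the kernel is therefore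
O(w(ζ)^a w(z)^b P^(-t₀) d^j Q^(l+m-t)) (`exists_kernelTerm_le`).

If l + m - t ≥ 0, this is at most a power of d. Otherwise put T = t - l - m; the difficulty is that
∂r(z) may be small. Write |∂r(z)(ζ - z)| = |∂r(z)| x, where x is the modulus of the coordinate of ζ
- z in a unit complex direction, and let H = w(z) + d. Then H x + d² is O(Q), and the weights
contribute O(H^(a+b)), which is O(H² d^(-max(0, 2-a-b))); this is the correction term in the type.
Splitting (H x + d²)^(-λT) ≤ (H x)^(-β) d^(-2(λT-β)) with β ≤ 2λ leaves a bounded factor H^(2λ-β)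
and the majorant x^(-β) d^(-c), in which no trace of the critical points remains
(`rpow_bound_of_neg_exponent`). The condition on λ allows β < 2 and β + c < 2n
(`Exponents.exists_subcritical_of_neg`).

Such majorants have integrals over unit balls that are bounded uniformly in the centre and the
direction (`exists_lintegral_inner_rpow_le`). Away from the diagonal the kernel is bounded by
hypothesis, and compactness of the closure of D turns the local bounds into one constant. -/

theorem lintegral_pi_norm_rpow_lt_top {n : ℕ} {e : ℝ} (he : e < 2) :
    ∫⁻ w : Fin n → ℂ, ∏ i, (ball (0 : ℂ) 1).indicator (fun x => ENNReal.ofReal (‖x‖ ^ (-e))) (w i)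
      < ⊤ := by
  have h1 : IntegrableOn (fun x : ℂ => ‖x‖ ^ (-e)) (ball 0 1) volume := by
    apply integrableOn_ball_of_norm_le_rpow (μ := (volume : Measure ℂ)) (C := 1) (α := e)
    · rw [Complex.finrank_real_complex]; exact_mod_cast he
    · refine Filter.Eventually.of_forall fun x => ?_
      rw [Real.norm_of_nonneg (by positivity), one_mul]
    · exact (measurable_norm.pow_const _).aestronglyMeasurable
    · rw [Complex.finrank_real_complex]; norm_num
  have h2 : Integrable ((ball (0 : ℂ) 1).indicator fun x : ℂ => ‖x‖ ^ (-e)) volume :=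
    (integrable_indicator_iff measurableSet_ball).2 h1
  have h3 := Integrable.fintype_prod (ι := Fin n) (μ := fun _ => (volume : Measure ℂ))
    (f := fun _ => (ball (0 : ℂ) 1).indicator fun x : ℂ => ‖x‖ ^ (-e)) (fun _ => h2)
  have h4 := h3.lintegral_lt_top
  refine lt_of_eq_of_lt ?_ h4
  refine lintegral_congr fun w => ?_
  rw [ENNReal.ofReal_prod_of_nonneg]
  · refine Finset.prod_congr rfl fun i _ => ?_
    by_cases h : w i ∈ ball (0 : ℂ) 1 <;> simp [Set.indicator, h]
  · intro i _
    exact Set.indicator_nonneg (fun x _ => by positivity) _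

theorem lintegral_prod_norm_rpow_lt_top {n : ℕ} {e : ℝ} (he : e < 2) :
    ∫⁻ w : Cn n, ∏ i, (ball (0 : ℂ) 1).indicator (fun x => ENNReal.ofReal (‖x‖ ^ (-e))) (w i)
      < ⊤ := by
  let T : Cn n ≃L[ℝ] (Fin n → ℂ) :=
    PiLp.continuousLinearEquiv 2 ℝ (fun _ : Fin n => ℂ)
  have hT : ∀ w i, T w i = w i := fun w i => rfl
  have : (Measure.map T (volume : Measure (Cn n))).IsAddHaarMeasure :=
    T.isAddHaarMeasure_map volume
  have hm : Measurable fun w : Fin n → ℂ =>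
      ∏ i, (ball (0 : ℂ) 1).indicator (fun x => ENNReal.ofReal (‖x‖ ^ (-e))) (w i) := by
    refine Finset.measurable_prod _ fun i _ => ?_
    refine Measurable.comp (Measurable.indicator ?_ measurableSet_ball) (measurable_pi_apply i)
    exact (measurable_norm.pow_const _).ennreal_ofReal
  have h := lintegral_map (μ := (volume : Measure (Cn n))) hm T.continuous.measurable
  simp only [hT] at h
  -- The transported measure is a Haar measure, hence a finite multiple of Lebesgue measure; the
  -- value of the factor is irrelevant for finiteness.
  rw [← h, Measure.isAddLeftInvariant_eq_smul (Measure.map T volume) volume, lintegral_smul_measure]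
  exact ENNReal.mul_lt_top (ENNReal.coe_lt_top) (lintegral_pi_norm_rpow_lt_top he)

/-- Every |w_i| is at most |w| < 1, so a negative power of |w| may be distributed over the
coordinates. This reduces the singularity to a product of one-variable singularities with exponent
e. -/
theorem prod_rpow_bound {n : ℕ} (i₀ : Fin n) {b c e : ℝ} (hbe : b ≤ e) (he0 : 0 ≤ e)
    (hce : b + c ≤ n * e) (w : Cn n) (hw : ‖w‖ < 1) (hne : ∀ i, w i ≠ 0) :
    ‖w i₀‖ ^ (-b) * ‖w‖ ^ (-c) ≤ ∏ i, ‖w i‖ ^ (-e) := by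
  have hpos : ∀ i, 0 < ‖w i‖ := fun i => norm_pos_iff.2 (hne i)
  have hle : ∀ i, ‖w i‖ ≤ ‖w‖ := fun i => PiLp.norm_apply_le w i
  have hw0 : 0 < ‖w‖ := (hpos i₀).trans_le (hle i₀)
  rw [← Finset.mul_prod_erase _ _ (Finset.mem_univ i₀)]
  have h1 : ‖w‖ ^ (-c) ≤ ‖w‖ ^ (-(n * e - b)) :=
    Real.rpow_le_rpow_of_exponent_ge hw0 hw.le (by linarith)
  have h2 : ‖w‖ ^ (-(n * e - b)) = ‖w‖ ^ (-(e - b)) * ∏ _i ∈ Finset.univ.erase i₀, ‖w‖ ^ (-e) := by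
    rw [Finset.prod_const, ← Real.rpow_natCast, ← Real.rpow_mul hw0.le, ← Real.rpow_add hw0,
      Finset.card_erase_of_mem (Finset.mem_univ _), Finset.card_univ, Fintype.card_fin,
      Nat.cast_sub (by have := i₀.pos; omega)]
    congr 1
    push_cast
    ring
  have h3 : ‖w‖ ^ (-(e - b)) ≤ ‖w i₀‖ ^ (-(e - b)) :=
    Real.rpow_le_rpow_of_nonpos (hpos i₀) (hle i₀) (by linarith)
  have h4 : ∏ _i ∈ Finset.univ.erase i₀, ‖w‖ ^ (-e) ≤ ∏ i ∈ Finset.univ.erase i₀, ‖w i‖ ^ (-e) :=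
    Finset.prod_le_prod (fun i _ => by positivity) fun i _ =>
      Real.rpow_le_rpow_of_nonpos (hpos i) (hle i) (by linarith)
  calc ‖w i₀‖ ^ (-b) * ‖w‖ ^ (-c)
      ≤ ‖w i₀‖ ^ (-b) * (‖w i₀‖ ^ (-(e - b)) * ∏ i ∈ Finset.univ.erase i₀, ‖w i‖ ^ (-e)) := by
        gcongr
        refine h1.trans (h2.le.trans ?_)
        gcongr
    _ = _ := by
        rw [← mul_assoc, ← Real.rpow_add (hpos i₀)]
        congr 2
        ring

theorem ae_coord_ne_zero (n : ℕ) : ∀ᵐ w : Cn n, ∀ i, w i ≠ 0 := by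
  rw [ae_all_iff]
  intro i
  let p : Submodule ℝ (Cn n) :=
    LinearMap.ker ((EuclideanSpace.proj i : Cn n →L[ℂ] ℂ).restrictScalars ℝ).toLinearMap
  have hp : p ≠ ⊤ := by
    intro h
    have h1 : EuclideanSpace.single i (1 : ℂ) ∈ p := h ▸ Submodule.mem_top
    simp [p] at h1
  have := Measure.addHaar_submodule (volume : Measure (Cn n)) p hp
  refine measure_mono_null ?_ this
  intro w hw
  simpa [p] using hw

/-- The integrals over unit balls of a product of powers of a linear coordinate and of the
distance to the centre are uniformly bounded in the subcritical range. -/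
theorem exists_lintegral_inner_rpow_le {n : ℕ} (hn : 1 ≤ n) {b c : ℝ} (hb2 : b < 2)
    (hbc : b + c < 2 * n) :
    ∃ C : NNReal, ∀ v : Cn n, ‖v‖ = 1 → ∀ z : Cn n,
      ∫⁻ ζ in ball z 1, ENNReal.ofReal (‖inner ℂ v (ζ - z)‖ ^ (-b) * ‖ζ - z‖ ^ (-c)) ≤ C := by
  have hn0 : (0 : ℝ) < n := by exact_mod_cast hn
  -- The least exponent that `prod_rpow_bound` accepts; both hypotheses on b and c together say that
  -- it is below 2, the integrability threshold in ℂ.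
  let e : ℝ := max 0 (max b ((b + c) / n))
  have he : e < 2 := by
    refine max_lt two_pos (max_lt hb2 ?_)
    rw [div_lt_iff₀ hn0]; exact hbc
  have he0 : 0 ≤ e := le_max_left _ _
  have hbe : b ≤ e := (le_max_left _ _).trans (le_max_right _ _)
  have hce : b + c ≤ n * e := by
    have : (b + c) / n ≤ e := (le_max_right _ _).trans (le_max_right _ _)
    rw [div_le_iff₀ hn0] at this
    linarith
  have hfin := lintegral_prod_norm_rpow_lt_top (n := n) he
  refine ⟨(∫⁻ w : Cn n, ∏ i, (ball (0 : ℂ) 1).indicator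
    (fun x => ENNReal.ofReal (‖x‖ ^ (-e))) (w i)).toNNReal, fun v hv z => ?_⟩
  rw [ENNReal.coe_toNNReal hfin.ne]
  let i₀ : Fin n := ⟨0, hn⟩
  -- Completing v to a unitary basis makes the inner product a coordinate; translations and unitary
  -- maps preserve Lebesgue measure, so the bound does not depend on v or z.
  obtain ⟨B, hB⟩ := Orthonormal.exists_orthonormalBasis_extension_of_card_eq (𝕜 := ℂ)
    (E := Cn n) (ι := Fin n) (by simp) (v := fun _ => v) (s := {i₀}) (by
      rw [orthonormal_iff_ite]
      rintro ⟨i, hi⟩ ⟨j, hj⟩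
      have h1 := Set.mem_singleton_iff.1 hi
      have h2 := Set.mem_singleton_iff.1 hj
      subst h1; subst h2
      simp [Set.domRestrict, inner_self_eq_norm_sq_to_K, hv])
  have hBv : B i₀ = v := hB i₀ rfl
  have hpres : MeasurePreserving (fun w : Cn n => B.repr w) volume volume :=
    LinearIsometryEquiv.measurePreserving
      ({ B.repr.toLinearEquiv.restrictScalars ℝ with
          norm_map' := B.repr.norm_map } : Cn n ≃ₗᵢ[ℝ] Cn n)
  have hpres2 : MeasurePreserving (fun ζ : Cn n => B.repr (ζ - z)) volume volume :=
    hpres.comp (measurePreserving_sub_right volume z)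
  let Φ : Cn n → ENNReal := fun w =>
    ∏ i, (ball (0 : ℂ) 1).indicator (fun x => ENNReal.ofReal (‖x‖ ^ (-e))) (w i)
  have hΦ : Measurable Φ := by
    refine Finset.measurable_prod _ fun i _ => ?_
    refine Measurable.comp (Measurable.indicator ?_ measurableSet_ball) (by fun_prop)
    exact (measurable_norm.pow_const _).ennreal_ofReal
  have hae : ∀ᵐ ζ : Cn n, ∀ i, (B.repr (ζ - z)) i ≠ 0 :=
    hpres2.quasiMeasurePreserving.ae (ae_coord_ne_zero n)
  calc ∫⁻ ζ in ball z 1, ENNReal.ofReal (‖inner ℂ v (ζ - z)‖ ^ (-b) * ‖ζ - z‖ ^ (-c))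
      ≤ ∫⁻ ζ in ball z 1, Φ (B.repr (ζ - z)) := by
        refine lintegral_mono_ae ?_
        filter_upwards [ae_restrict_mem measurableSet_ball, ae_restrict_of_ae hae] with ζ h1 h2
        have hnorm : ‖B.repr (ζ - z)‖ = ‖ζ - z‖ := B.repr.norm_map _
        have hlt : ‖B.repr (ζ - z)‖ < 1 := by rw [hnorm]; exact mem_ball_iff_norm.1 h1
        have hin : inner ℂ v (ζ - z) = (B.repr (ζ - z)) i₀ := by
          rw [B.repr_apply_apply, hBv]
        have h3 := prod_rpow_bound i₀ hbe he0 hce _ hlt h2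
        rw [hin, ← hnorm]
        refine (ENNReal.ofReal_le_ofReal h3).trans ?_
        rw [ENNReal.ofReal_prod_of_nonneg fun i _ => by positivity]
        refine le_of_eq (Finset.prod_congr rfl fun i _ => ?_)
        rw [Set.indicator_of_mem]
        exact mem_ball_zero_iff.2 ((PiLp.norm_apply_le _ i).trans_lt hlt)
    _ ≤ ∫⁻ ζ, Φ (B.repr (ζ - z)) := setLIntegral_le_lintegral _ _
    _ = ∫⁻ w, Φ w := hpres2.lintegral_comp hΦ

/-! ### Hermitian forms over compact sets -/

/-- The quadratic form `v ↦ Re (v* M v)`. -/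
def quadForm {n : ℕ} (M : Matrix (Fin n) (Fin n) ℂ) (v : Cn n) : ℝ :=
  (∑ j, ∑ k, conj (v j) * M j k * v k).re

theorem quadForm_pos {n : ℕ} {M : Matrix (Fin n) (Fin n) ℂ} (hM : M.PosDef) {v : Cn n}
    (hv : v ≠ 0) : 0 < quadForm M v := by
  have h := hM.re_dotProduct_pos (x := v.ofLp) (by simpa using hv)
  have e : star v.ofLp ⬝ᵥ (M *ᵥ v.ofLp) = ∑ j, ∑ k, conj (v j) * M j k * v k := by
    simp only [dotProduct, Matrix.mulVec, Finset.mul_sum, Pi.star_apply, mul_assoc]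
    rfl
  rw [e] at h
  exact h

theorem quadForm_smul {n : ℕ} (M : Matrix (Fin n) (Fin n) ℂ) (t : ℝ) (v : Cn n) :
    quadForm M ((t : ℂ) • v) = t ^ 2 * quadForm M v := by
  have : ∑ j, ∑ k, conj (((t : ℂ) • v) j) * M j k * ((t : ℂ) • v) k
      = ((t ^ 2 : ℝ) : ℂ) * ∑ j, ∑ k, conj (v j) * M j k * v k := by
    simp only [Finset.mul_sum]
    refine Finset.sum_congr rfl fun j _ => Finset.sum_congr rfl fun k _ => ?_
    simp
    ring
  rw [quadForm, this, Complex.re_ofReal_mul, quadForm]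

/-- By homogeneity it suffices to bound the form below on the compact set K × unit sphere, where it
is continuous and positive. -/
theorem exists_quadForm_ge {n : ℕ} {K : Set (Cn n)} (hK : IsCompact K)
    {M : Cn n → Matrix (Fin n) (Fin n) ℂ} (hc : ∀ j k, ContinuousOn (fun ζ => M ζ j k) K)
    (hM : ∀ ζ ∈ K, (M ζ).PosDef) :
    ∃ c : ℝ, 0 < c ∧ ∀ ζ ∈ K, ∀ v : Cn n, c * ‖v‖ ^ 2 ≤ quadForm (M ζ) v := by
  have hcont : ContinuousOn (fun p : Cn n × Cn n => quadForm (M p.1) p.2)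
      (K ×ˢ sphere (0 : Cn n) 1) := by
    unfold quadForm
    refine Complex.continuous_re.comp_continuousOn ?_
    refine continuousOn_finsetSum _ fun j _ => continuousOn_finsetSum _ fun k _ => ?_
    refine ContinuousOn.mul (ContinuousOn.mul ?_ ?_) ?_
    · exact (by fun_prop : Continuous fun p : Cn n × Cn n => conj (p.2 j)).continuousOn
    · exact (hc j k).comp continuous_fst.continuousOn fun p hp => hp.1
    · exact (by fun_prop : Continuous fun p : Cn n × Cn n => p.2 k).continuousOn
  obtain ⟨c, hc0, hcb⟩ := (hK.prod (isCompact_sphere (0 : Cn n) 1)).exists_forall_le' hcont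
    (a := 0) (by
      rintro ⟨ζ, v⟩ ⟨h1, h2⟩
      refine quadForm_pos (hM ζ h1) fun h => ?_
      have h3 : v = 0 := h
      rw [mem_sphere_zero_iff_norm, h3, norm_zero] at h2
      exact zero_ne_one h2)
  refine ⟨c, hc0, fun ζ hζ v => ?_⟩
  by_cases hv : v = 0
  · subst hv; simp [quadForm]
  have hv0 : ‖v‖ ≠ 0 := norm_ne_zero_iff.2 hv
  have h1 := hcb (ζ, ((‖v‖⁻¹ : ℝ) : ℂ) • v) ⟨hζ, by
    rw [mem_sphere_zero_iff_norm, norm_smul, Complex.norm_real, norm_inv, norm_norm,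
      inv_mul_cancel₀ hv0]⟩
  simp only [quadForm_smul] at h1
  have h2 : 0 < ‖v‖ ^ 2 := by positivity
  rw [inv_pow, inv_mul_eq_div, le_div_iff₀ h2] at h1
  exact h1

theorem quadForm_le {n : ℕ} (M : Matrix (Fin n) (Fin n) ℂ) (v : Cn n) :
    |quadForm M v| ≤ (∑ j, ∑ k, ‖M j k‖) * ‖v‖ ^ 2 := by
  refine (Complex.abs_re_le_norm _).trans ?_
  rw [Finset.sum_mul]
  refine (norm_sum_le _ _).trans (Finset.sum_le_sum fun j _ => ?_)
  rw [Finset.sum_mul]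
  refine (norm_sum_le _ _).trans (Finset.sum_le_sum fun k _ => ?_)
  rw [norm_mul, norm_mul, RCLike.norm_conj]
  have h1 : ‖v j‖ ≤ ‖v‖ := PiLp.norm_apply_le v j
  have h2 : ‖v k‖ ≤ ‖v‖ := PiLp.norm_apply_le v k
  calc ‖v j‖ * ‖M j k‖ * ‖v k‖ ≤ ‖v‖ * ‖M j k‖ * ‖v‖ := by gcongr
    _ = _ := by ring

theorem exists_quadForm_le {n : ℕ} {K : Set (Cn n)} (hK : IsCompact K)
    {M : Cn n → Matrix (Fin n) (Fin n) ℂ} (hc : ∀ j k, ContinuousOn (fun ζ => M ζ j k) K) :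
    ∃ C : ℝ, 0 ≤ C ∧ ∀ ζ ∈ K, ∀ v : Cn n, |quadForm (M ζ) v| ≤ C * ‖v‖ ^ 2 := by
  obtain ⟨C, hC⟩ := hK.exists_bound_of_continuousOn (f := fun ζ => ∑ j, ∑ k, ‖M ζ j k‖)
    (continuousOn_finsetSum _ fun j _ => continuousOn_finsetSum _ fun k _ => (hc j k).norm)
  refine ⟨max C 0, le_max_right _ _, fun ζ hζ v => (quadForm_le _ v).trans ?_⟩
  gcongr
  exact (le_abs_self _).trans ((hC ζ hζ).trans (le_max_left _ _))

/-! ### The geodesic distance -/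

theorem tangentLength_eq {n : ℕ} (g : Cn n → Matrix (Fin n) (Fin n) ℂ) (ζ v : Cn n) :
    tangentLength g ζ v = Real.sqrt (quadForm (g ζ) (WithLp.toLp 2 fun j => conj (v j))) := by
  unfold tangentLength quadForm
  congr 2
  refine Finset.sum_congr rfl fun j _ => Finset.sum_congr rfl fun k _ => ?_
  rw [Complex.conj_conj]
  ring

theorem norm_toLp_conj {n : ℕ} (v : Cn n) : ‖(WithLp.toLp 2 fun j => conj (v j) : Cn n)‖ = ‖v‖ := by
  simp [EuclideanSpace.norm_eq]

theorem exists_tangentLength_ge {n : ℕ} {K : Set (Cn n)} (hK : IsCompact K)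
    {g : Cn n → Matrix (Fin n) (Fin n) ℂ} (hc : ∀ j k, Continuous (fun ζ => g ζ j k))
    (hM : ∀ ζ, (g ζ).PosDef) :
    ∃ c : ℝ, 0 < c ∧ ∀ ζ ∈ K, ∀ v : Cn n, c * ‖v‖ ≤ tangentLength g ζ v := by
  obtain ⟨c, hc0, h⟩ := exists_quadForm_ge hK (fun j k => (hc j k).continuousOn) fun ζ _ => hM ζ
  refine ⟨Real.sqrt c, Real.sqrt_pos.2 hc0, fun ζ hζ v => ?_⟩
  rw [tangentLength_eq]
  refine Real.le_sqrt_of_sq_le ?_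
  rw [mul_pow, Real.sq_sqrt hc0.le, ← norm_toLp_conj v]
  exact h ζ hζ _

theorem continuous_tangentLength {n : ℕ} {g : Cn n → Matrix (Fin n) (Fin n) ℂ}
    (hc : ∀ j k, Continuous (fun ζ => g ζ j k)) {γ v : ℝ → Cn n} (hγ : Continuous γ)
    (hv : Continuous v) : Continuous fun s => tangentLength g (γ s) (v s) := by
  unfold tangentLength
  refine Real.continuous_sqrt.comp (Complex.continuous_re.comp ?_)
  refine continuous_finsetSum _ fun j _ => continuous_finsetSum _ fun k _ => ?_
  exact (((hc j k).comp hγ).mul (by fun_prop)).mul (by fun_prop)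

theorem exists_smooth_cutoff {n : ℕ} {K W : Set (Cn n)} (hK : IsCompact K) (hW : IsOpen W)
    (hKW : K ⊆ W) : ∃ f : Cn n → ℝ, ContDiff ℝ ∞ f ∧ HasCompactSupport f ∧ tsupport f ⊆ W ∧
      (∀ᶠ x in nhdsSet K, f x = 1) ∧ ∀ x, f x ∈ Icc (0 : ℝ) 1 := by
  obtain ⟨L, hL, hKL, hLW⟩ := exists_compact_between hK hW hKW
  obtain ⟨f, h1, h2, h3⟩ := exists_contMDiffMap_one_nhds_of_subset_interior
    (modelWithCornersSelf ℝ (Cn n)) (n := ⊤) hK.isClosed hKL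
  have hs : tsupport f ⊆ L := by
    refine closure_minimal (fun x hx => ?_) hL.isClosed
    by_contra h
    exact hx (h2 x h)
  exact ⟨f, f.contMDiff.contDiff, hL.of_isClosed_subset (isClosed_tsupport _) hs,
    hs.trans hLW, h1, h3⟩

theorem sub_le_integral_tangentLength {n : ℕ} {g : Cn n → Matrix (Fin n) (Fin n) ℂ}
    (hc : ∀ j k, Continuous (fun ζ => g ζ j k)) {ψ : Cn n → ℝ} (hψ : ContDiff ℝ 1 ψ) {A : ℝ}
    (hb : ∀ p w, |fderiv ℝ ψ p w| ≤ A * tangentLength g p w) {γ : ℝ → Cn n}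
    (hγ : ContDiff ℝ 1 γ) :
    ψ (γ 1) - ψ (γ 0) ≤ A * ∫ s in (0 : ℝ)..1, tangentLength g (γ s) (deriv γ s) := by
  have hγd : Differentiable ℝ γ := hγ.differentiable one_ne_zero
  have hγ' : Continuous (deriv γ) := hγ.continuous_deriv le_rfl
  have hψd : Differentiable ℝ ψ := hψ.differentiable one_ne_zero
  have hψ' : Continuous (fderiv ℝ ψ) := hψ.continuous_fderiv one_ne_zero
  have hcd : ∀ s, HasDerivAt (ψ ∘ γ) (fderiv ℝ ψ (γ s) (deriv γ s)) s := fun s =>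
    (hψd (γ s)).hasFDerivAt.comp_hasDerivAt s (hγd s).hasDerivAt
  have hcont1 : Continuous fun s => fderiv ℝ ψ (γ s) (deriv γ s) :=
    (hψ'.comp hγ.continuous).clm_apply hγ'
  have hcont2 : Continuous fun s => A * tangentLength g (γ s) (deriv γ s) :=
    continuous_const.mul (continuous_tangentLength hc hγ.continuous hγ')
  have hFTC := intervalIntegral.integral_eq_sub_of_hasDerivAt (a := 0) (b := 1)
    (fun s _ => hcd s) (hcont1.intervalIntegrable _ _)
  rw [← intervalIntegral.integral_const_mul]
  refine hFTC.symm.le.trans ?_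
  exact intervalIntegral.integral_mono_on zero_le_one (hcont1.intervalIntegrable _ _)
      (hcont2.intervalIntegrable _ _) fun s _ => (le_abs_self _).trans (hb _ _)

/-- A function whose differential is controlled by the metric is Lipschitz for the geodesic
distance. -/
theorem sub_le_mul_geodesicDist {n : ℕ} {g : Cn n → Matrix (Fin n) (Fin n) ℂ}
    (hc : ∀ j k, Continuous (fun ζ => g ζ j k)) {ψ : Cn n → ℝ} (hψ : ContDiff ℝ 1 ψ) {A : ℝ}
    (hA : 0 < A) (hb : ∀ p w, |fderiv ℝ ψ p w| ≤ A * tangentLength g p w) (x y : Cn n) :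
    ψ y - ψ x ≤ A * geodesicDist g x y := by
  have hne : ContDiff ℝ 1 fun s : ℝ => x + s • (y - x) :=
    contDiff_const.add (contDiff_id.smul contDiff_const)
  have h : (ψ y - ψ x) / A ≤ geodesicDist g x y := by
    -- The straight segment shows that the set of lengths is non-empty, so its infimum is not the
    -- default value 0.
    refine le_csInf ⟨_, _, hne, by simp, by simp, rfl⟩ ?_
    rintro L ⟨γ, hγ, hγ0, hγ1, rfl⟩
    have h1 := sub_le_integral_tangentLength hc hψ hb hγ
    rw [hγ0, hγ1] at h1
    rw [div_le_iff₀ hA, mul_comm]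
    exact h1
  rw [div_le_iff₀ hA, mul_comm] at h
  exact h

theorem geodesicDist_nonneg {n : ℕ} (g : Cn n → Matrix (Fin n) (Fin n) ℂ) (x y : Cn n) :
    0 ≤ geodesicDist g x y := by
  refine Real.sInf_nonneg ?_
  rintro L ⟨γ, -, -, -, rfl⟩
  exact intervalIntegral.integral_nonneg zero_le_one fun s _ => Real.sqrt_nonneg _

/-- On compact sets the geodesic distance dominates a multiple of the Euclidean distance. -/
theorem exists_geodesicDist_ge {n : ℕ} {K : Set (Cn n)} (hK : IsCompact K)
    {g : Cn n → Matrix (Fin n) (Fin n) ℂ} (hc : ∀ j k, Continuous (fun ζ => g ζ j k))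
    (hM : ∀ ζ, (g ζ).PosDef) :
    ∃ c : ℝ, 0 < c ∧ ∀ x ∈ K, ∀ y ∈ K, c * ‖x - y‖ ≤ geodesicDist g x y := by
  -- Competing curves may leave K, where no lower bound of the metric is at hand. The test function
  -- is therefore a cutoff times a linear functional: its differential vanishes off a compact set,
  -- and on that set g is bounded below.
  obtain ⟨f, hf, hfc, -, hf1, hf01⟩ := exists_smooth_cutoff hK isOpen_univ (subset_univ _)
  obtain ⟨c, hc0, hlen⟩ := exists_tangentLength_ge hfc.isCompact hc hM
  obtain ⟨R, hR⟩ := hfc.isCompact.isBounded.exists_norm_le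
  obtain ⟨B, hB⟩ := (hf.continuous_fderiv (by simp)).bounded_above_of_compact_support
    (hfc.fderiv (𝕜 := ℝ))
  have hdf : Differentiable ℝ f := hf.differentiable (by simp)
  obtain ⟨C, hC⟩ : ∃ C : ℝ, C = 1 + |R| * |B| := ⟨_, rfl⟩
  have hCpos : 0 < C := by rw [hC]; positivity
  refine ⟨c / C, by positivity, fun x hx y hy => ?_⟩
  by_cases hxy : x = y
  · subst hxy
    simpa using geodesicDist_nonneg g x x
  have hd : 0 < ‖y - x‖ := norm_pos_iff.2 (sub_ne_zero.2 (Ne.symm hxy))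
  -- The unit functional in the direction of y - x; its increment from x to y is the Euclidean
  -- distance.
  let ℓ : Cn n →L[ℝ] ℝ := (‖y - x‖⁻¹) • innerSL ℝ (y - x)
  have hℓn : ∀ p, |ℓ p| ≤ ‖p‖ := by
    intro p
    have h := norm_inner_le_norm (𝕜 := ℝ) (y - x) p
    simp only [ℓ, smul_apply, innerSL_apply_apply, smul_eq_mul, abs_mul, abs_inv, abs_norm]
    rw [inv_mul_le_iff₀ hd]
    exact h
  have hℓxy : ℓ y - ℓ x = ‖y - x‖ := by
    rw [← map_sub]
    simp only [ℓ, smul_apply, innerSL_apply_apply, smul_eq_mul, real_inner_self_eq_norm_sq]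
    field_simp
  clear_value ℓ
  have hψ : ∀ p, fderiv ℝ (fun p => f p * ℓ p) p = f p • ℓ + ℓ p • fderiv ℝ f p := fun p =>
    ((hdf p).hasFDerivAt.mul ℓ.hasFDerivAt).fderiv
  have hbound : ∀ p w, |fderiv ℝ (fun p => f p * ℓ p) p w| ≤ C / c * tangentLength g p w := by
    intro p w
    rw [hψ]
    by_cases hp : p ∈ tsupport f
    · have h1 := hlen p hp w
      have h2 : |(f p • ℓ + ℓ p • fderiv ℝ f p) w| ≤ C * ‖w‖ := by
        simp only [add_apply, smul_apply, smul_eq_mul]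
        refine (abs_add_le _ _).trans ?_
        rw [abs_mul, abs_mul, hC, add_mul, one_mul, mul_assoc]
        have h3 : |f p| ≤ 1 := abs_le.2 ⟨by linarith [(hf01 p).1], (hf01 p).2⟩
        have h4 : |fderiv ℝ f p w| ≤ |B| * ‖w‖ :=
          (ContinuousLinearMap.le_opNorm _ _).trans
            (mul_le_mul_of_nonneg_right ((hB p).trans (le_abs_self _)) (norm_nonneg _))
        have h5 : |ℓ p| ≤ |R| := (hℓn p).trans ((hR p hp).trans (le_abs_self _))
        refine add_le_add ?_ (mul_le_mul h5 h4 (abs_nonneg _) (abs_nonneg _))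
        exact (mul_le_mul h3 (hℓn w) (abs_nonneg _) zero_le_one).trans_eq (one_mul _)
      rw [div_mul_eq_mul_div, le_div_iff₀ hc0]
      calc _ ≤ C * ‖w‖ * c := mul_le_mul_of_nonneg_right h2 hc0.le
        _ = C * (c * ‖w‖) := by ring
        _ ≤ _ := mul_le_mul_of_nonneg_left h1 hCpos.le
    · have h1 : f p = 0 := image_eq_zero_of_notMem_tsupport hp
      have h2 : fderiv ℝ f p = 0 :=
        image_eq_zero_of_notMem_tsupport fun h => hp (tsupport_fderiv_subset ℝ h)
      rw [h1, h2]
      simp only [zero_smul, smul_zero, add_zero, zero_apply, abs_zero]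
      exact mul_nonneg (by positivity) (Real.sqrt_nonneg _)
  have hmain := sub_le_mul_geodesicDist hc
    ((hf.of_le (by simp)).mul ℓ.contDiff : ContDiff ℝ 1 fun p => f p * ℓ p) (by positivity)
    hbound x y
  rw [hf1.self_of_nhdsSet x hx, hf1.self_of_nhdsSet y hy, one_mul, one_mul, hℓxy,
    div_mul_eq_mul_div, le_div_iff₀ hc0] at hmain
  rw [norm_sub_rev, div_mul_eq_mul_div, div_le_iff₀ hCpos]
  linarith

theorem geodesicDist_self {n : ℕ} (g : Cn n → Matrix (Fin n) (Fin n) ℂ) (x : Cn n) :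
    geodesicDist g x x = 0 := by
  refine le_antisymm ?_ (geodesicDist_nonneg g x x)
  refine csInf_le ⟨0, ?_⟩ ⟨fun _ => x, contDiff_const, rfl, rfl, by simp [tangentLength]⟩
  rintro L ⟨γ, -, -, -, rfl⟩
  exact intervalIntegral.integral_nonneg zero_le_one fun s _ => Real.sqrt_nonneg _

theorem exists_pos_forall_mem_of_diagonal {n : ℕ} {K : Set (Cn n)} (hK : IsCompact K)
    {O : Set (Cn n × Cn n)} (hO : IsOpen O) (hd : ∀ x ∈ K, (x, x) ∈ O) :
    ∃ η : ℝ, 0 < η ∧ ∀ x ∈ K, ∀ y, ‖x - y‖ < η → (x, y) ∈ O := by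
  obtain ⟨η, hη, h⟩ := (hK.image (f := fun x : Cn n => (x, x))
    (by fun_prop)).exists_thickening_subset_open hO (by rintro _ ⟨x, hx, rfl⟩; exact hd x hx)
  refine ⟨η, hη, fun x hx y hxy => h ?_⟩
  rw [mem_thickening_iff]
  refine ⟨(x, x), ⟨x, hx, rfl⟩, ?_⟩
  rw [Prod.dist_eq, dist_self, max_eq_right dist_nonneg, dist_eq_norm, norm_sub_rev]
  exact hxy

/-- Near the diagonal of a compact set, `ρ²` dominates the squared Euclidean distance, and the
patching function is `1`. -/
theorem exists_rho_bounds {n : ℕ} {D : Set (Cn n)} {r : Cn n → ℝ} {K : Set (Cn n)}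
    (hK : IsCompact K) {g : Cn n → Matrix (Fin n) (Fin n) ℂ} (hg : IsLeviMetric D r g)
    {ρ : Cn n → Cn n → ℝ} (hρ : IsDistanceFunction g ρ) {κ : ℝ} (hκ : 0 < κ)
    {χ : Cn n → Cn n → ℝ} (hχ : IsPatching ρ κ χ) :
    ∃ c η : ℝ, 0 < c ∧ 0 < η ∧ ∀ x ∈ K, ∀ y ∈ K, ‖x - y‖ < η →
      c * ‖x - y‖ ^ 2 ≤ ρ x y ^ 2 ∧ χ x y = 1 := by
  obtain ⟨c, hc, h1⟩ := exists_geodesicDist_ge hK (fun j k => (hg.smooth j k).continuous) hg.posDef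
  obtain ⟨O, hO, hOd, hOρ⟩ := hρ.geodesic
  obtain ⟨η₁, hη₁, h2⟩ := exists_pos_forall_mem_of_diagonal hK hO fun x _ => hOd x
  have hρ0 : ∀ x, ρ x x = 0 := fun x => (hOρ (x, x) (hOd x)).trans (geodesicDist_self g x)
  obtain ⟨η₂, hη₂, h3⟩ := exists_pos_forall_mem_of_diagonal hK
    (O := {p : Cn n × Cn n | ρ p.1 p.2 ^ 2 < κ / 2})
    (isOpen_lt hρ.smooth_sq.continuous continuous_const) fun x _ => by simp [hρ0, hκ]
  refine ⟨c ^ 2, min η₁ η₂, by positivity, lt_min hη₁ hη₂, fun x hx y hy hxy => ⟨?_, ?_⟩⟩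
  · rw [hOρ (x, y) (h2 x hx y (hxy.trans_le (min_le_left _ _))), ← mul_pow]
    exact pow_le_pow_left₀ (by positivity) (h1 x hx y hy) 2
  · exact hχ.eq_one x y (h3 x hx y (hxy.trans_le (min_le_right _ _))).le

/-! ### Smooth functions of compact support -/

/-- Replacing r by such an f gives bounds, Lipschitz constants and Taylor remainders valid on the
whole space, although segments between points of D may leave D. Agreement of germs on K keeps all
derivatives there. -/
theorem exists_compactSupport_extension {n : ℕ} {K W : Set (Cn n)} (hK : IsCompact K)
    (hW : IsOpen W) (hKW : K ⊆ W) {r : Cn n → ℝ} (hr : ContDiffOn ℝ ∞ r W) :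
    ∃ f : Cn n → ℝ, ContDiff ℝ ∞ f ∧ HasCompactSupport f ∧ ∀ x ∈ K, f =ᶠ[nhds x] r := by
  obtain ⟨θ, h1, h2, h3, h4, -⟩ := exists_smooth_cutoff hK hW hKW
  refine ⟨fun x => θ x * r x, ?_, h2.mul_right, fun x hx => ?_⟩
  · rw [contDiff_iff_contDiffAt]
    intro x
    by_cases hx : x ∈ W
    · exact h1.contDiffAt.mul (hr.contDiffAt (hW.mem_nhds hx))
    · have h5 : (fun x => θ x * r x) =ᶠ[nhds x] fun _ => 0 := by
        have := notMem_tsupport_iff_eventuallyEq.1 fun h => hx (h3 h)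
        filter_upwards [this] with y hy
        rw [hy]; simp
      exact contDiffAt_const.congr_of_eventuallyEq h5
  · have h5 : ∀ᶠ y in nhds x, θ y = 1 := h4.filter_mono (nhds_le_nhdsSet hx)
    filter_upwards [h5] with y hy
    rw [hy, one_mul]

theorem exists_bound_lipschitz {n : ℕ} {G : Type*} [NormedAddCommGroup G] [NormedSpace ℝ G]
    {F : Cn n → G} (hF : ContDiff ℝ 1 F) (hc : HasCompactSupport F) :
    ∃ C : ℝ, 0 ≤ C ∧ (∀ x, ‖F x‖ ≤ C) ∧ ∀ x y, ‖F x - F y‖ ≤ C * ‖x - y‖ := by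
  obtain ⟨A, hA⟩ := hF.continuous.bounded_above_of_compact_support hc
  obtain ⟨B, hB⟩ := (hF.continuous_fderiv one_ne_zero).bounded_above_of_compact_support
    (hc.fderiv (𝕜 := ℝ))
  have hd : Differentiable ℝ F := hF.differentiable one_ne_zero
  refine ⟨max A B, ((norm_nonneg _).trans (hA 0)).trans (le_max_left _ _),
    fun x => (hA x).trans (le_max_left _ _), fun x y => ?_⟩
  exact convex_univ.norm_image_sub_le_of_norm_fderiv_le (fun x _ => hd x)
    (fun x _ => (hB x).trans (le_max_right _ _)) (mem_univ y) (mem_univ x)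

theorem exists_taylor_two {n : ℕ} {f : Cn n → ℝ} (hf : ContDiff ℝ ∞ f)
    (hc : HasCompactSupport f) :
    ∃ C : ℝ, 0 ≤ C ∧ ∀ x h : Cn n,
      |f (x + h) - f x - fderiv ℝ f x h - 1 / 2 * fderiv ℝ (fderiv ℝ f) x h h| ≤ C * ‖h‖ ^ 3 := by
  have hf1 : ContDiff ℝ ∞ (fderiv ℝ f) := hf.fderiv_right (by simp)
  have hf2 : ContDiff ℝ ∞ (fderiv ℝ (fderiv ℝ f)) := hf1.fderiv_right (by simp)
  obtain ⟨B, hB0, -, hB⟩ := exists_bound_lipschitz (hf2.of_le (by simp))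
    ((hc.fderiv (𝕜 := ℝ)).fderiv (𝕜 := ℝ))
  have hd : Differentiable ℝ f := hf.differentiable (by simp)
  have hd1 : Differentiable ℝ (fderiv ℝ f) := hf1.differentiable (by simp)
  refine ⟨B, hB0, fun x h => ?_⟩
  have hfirst : ∀ y ∈ closedBall x ‖h‖,
      ‖fderiv ℝ f y - fderiv ℝ f x - fderiv ℝ (fderiv ℝ f) x (y - x)‖ ≤ B * ‖h‖ * ‖y - x‖ := by
    intro y hy
    refine Convex.norm_image_sub_le_of_norm_fderiv_le' (s := closedBall x ‖h‖)
      (fun y _ => hd1 y) (fun y hy => ?_) (convex_closedBall x ‖h‖)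
      (mem_closedBall_self (norm_nonneg _)) hy
    refine (hB y x).trans ?_
    gcongr
    exact mem_closedBall_iff_norm.1 hy
  -- The second-order remainder along the segment, up to the constant f x. Its derivative is
  -- controlled by the first-order remainder of the differential of f, so one mean value estimate
  -- finishes.
  let u : ℝ → ℝ := fun t =>
    f (x + t • h) - t * fderiv ℝ f x h - t ^ 2 / 2 * fderiv ℝ (fderiv ℝ f) x h h
  have hline : ∀ t : ℝ, HasDerivAt (fun t : ℝ => x + t • h) h t := fun t => by
    simpa using ((hasDerivAt_id t).smul_const h).const_add x
  have hu : ∀ t, HasDerivAt u (fderiv ℝ f (x + t • h) h - fderiv ℝ f x h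
      - t * fderiv ℝ (fderiv ℝ f) x h h) t := by
    intro t
    have h1 : HasDerivAt (fun t : ℝ => f (x + t • h)) (fderiv ℝ f (x + t • h) h) t :=
      (hd (x + t • h)).hasFDerivAt.comp_hasDerivAt t (hline t)
    have h2 : HasDerivAt (fun t : ℝ => t * fderiv ℝ f x h) (fderiv ℝ f x h) t := by
      simpa using (hasDerivAt_id t).mul_const (fderiv ℝ f x h)
    have h3 : HasDerivAt (fun t : ℝ => t ^ 2 / 2 * fderiv ℝ (fderiv ℝ f) x h h)
        (t * fderiv ℝ (fderiv ℝ f) x h h) t := by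
      refine (((hasDerivAt_pow 2 t).div_const 2).mul_const _).congr_deriv ?_
      push_cast
      ring
    exact (h1.sub h2).sub h3
  have hbound : ∀ t ∈ Icc (0 : ℝ) 1, ‖deriv u t‖ ≤ B * ‖h‖ ^ 3 := by
    intro t ht
    rw [(hu t).deriv]
    have hn : ‖x + t • h - x‖ ≤ ‖h‖ := by
      rw [add_sub_cancel_left, norm_smul, Real.norm_eq_abs, abs_of_nonneg ht.1]
      exact mul_le_of_le_one_left (norm_nonneg _) ht.2
    have h1 := hfirst (x + t • h) (mem_closedBall_iff_norm.2 hn)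
    have h2 : fderiv ℝ f (x + t • h) h - fderiv ℝ f x h - t * fderiv ℝ (fderiv ℝ f) x h h
        = (fderiv ℝ f (x + t • h) - fderiv ℝ f x
            - fderiv ℝ (fderiv ℝ f) x (x + t • h - x)) h := by
      rw [add_sub_cancel_left, map_smul]
      simp only [sub_apply, smul_apply, smul_eq_mul]
    rw [h2]
    refine (ContinuousLinearMap.le_opNorm _ _).trans ?_
    calc _ ≤ B * ‖h‖ * ‖h‖ * ‖h‖ := by
          refine mul_le_mul_of_nonneg_right (h1.trans ?_) (norm_nonneg _)
          exact mul_le_mul_of_nonneg_left hn (by positivity)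
      _ = _ := by ring
  have hmv := (convex_Icc (0 : ℝ) 1).norm_image_sub_le_of_norm_deriv_le
    (fun t _ => (hu t).differentiableAt) hbound (left_mem_Icc.2 zero_le_one)
    (right_mem_Icc.2 zero_le_one)
  simp only [u, Real.norm_eq_abs, one_smul, zero_smul, add_zero, sub_zero, abs_one, mul_one] at hmv
  convert hmv using 2
  ring

/-! ### Wirtinger calculus -/

theorem eq_sum_single {n : ℕ} (v : Cn n) :
    v = ∑ j, ((v j).re • (EuclideanSpace.single j 1 : Cn n)
      + (v j).im • (EuclideanSpace.single j Complex.I : Cn n)) := by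
  ext i
  simp only [WithLp.ofLp_sum, Finset.sum_apply, PiLp.add_apply, PiLp.smul_apply, PiLp.single_apply]
  rw [Finset.sum_eq_single i]
  · simp
  · intro j _ hj
    simp [Ne.symm hj]
  · simp

theorem fderiv_eq_sum_dz {n : ℕ} (F : Cn n → ℂ) (ζ v : Cn n) :
    fderiv ℝ F ζ v = ∑ j, (dz j F ζ * v j + dzbar j F ζ * conj (v j)) := by
  conv_lhs => rw [eq_sum_single v]
  rw [map_sum]
  refine Finset.sum_congr rfl fun j _ => ?_
  rw [map_add, map_smul, map_smul]
  obtain ⟨x, y⟩ := v j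
  have h1 : (⟨x, y⟩ : ℂ) = x + y * Complex.I := Complex.mk_eq_add_mul_I x y
  simp only [dz, dzbar, h1, Complex.real_smul, map_add, map_mul, Complex.conj_ofReal,
    Complex.conj_I]
  linear_combination ((y : ℂ) * fderiv ℝ F ζ (EuclideanSpace.single j Complex.I)) * Complex.I_sq

theorem contDiff_dz {n : ℕ} (j : Fin n) {F : Cn n → ℂ} (hF : ContDiff ℝ ∞ F) :
    ContDiff ℝ ∞ (dz j F) := by
  have h : ContDiff ℝ ∞ (fderiv ℝ F) := hF.fderiv_right (by simp)
  unfold dz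
  exact ((h.clm_apply contDiff_const).sub
    (contDiff_const.mul (h.clm_apply contDiff_const))).div_const 2

theorem contDiff_dzbar {n : ℕ} (j : Fin n) {F : Cn n → ℂ} (hF : ContDiff ℝ ∞ F) :
    ContDiff ℝ ∞ (dzbar j F) := by
  have h : ContDiff ℝ ∞ (fderiv ℝ F) := hF.fderiv_right (by simp)
  unfold dzbar
  exact ((h.clm_apply contDiff_const).add
    (contDiff_const.mul (h.clm_apply contDiff_const))).div_const 2

theorem hasCompactSupport_dz {n : ℕ} (j : Fin n) {F : Cn n → ℂ} (hF : HasCompactSupport F) :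
    HasCompactSupport (dz j F) := by
  refine (hF.fderiv (𝕜 := ℝ)).mono fun x hx => ?_
  contrapose! hx
  simp only [Function.mem_support, not_not] at hx ⊢
  simp [dz, hx]

theorem dz_eventuallyEq {n : ℕ} (j : Fin n) {F G : Cn n → ℂ} {ζ : Cn n} (h : F =ᶠ[nhds ζ] G) :
    dz j F =ᶠ[nhds ζ] dz j G := by
  filter_upwards [h.fderiv (𝕜 := ℝ)] with y hy
  simp [dz, hy]

theorem dzbar_eventuallyEq {n : ℕ} (j : Fin n) {F G : Cn n → ℂ} {ζ : Cn n} (h : F =ᶠ[nhds ζ] G) :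
    dzbar j F =ᶠ[nhds ζ] dzbar j G := by
  filter_upwards [h.fderiv (𝕜 := ℝ)] with y hy
  simp [dzbar, hy]

theorem toC_eventuallyEq {n : ℕ} {f r : Cn n → ℝ} {ζ : Cn n} (h : f =ᶠ[nhds ζ] r) :
    toC f =ᶠ[nhds ζ] toC r := by
  filter_upwards [h] with y hy
  simp [toC, hy]

theorem leviPoly_congr {n : ℕ} {f r : Cn n → ℝ} {ζ : Cn n} (h : f =ᶠ[nhds ζ] r) (z : Cn n) :
    leviPoly f ζ z = leviPoly r ζ z := by
  have h1 := toC_eventuallyEq h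
  unfold leviPoly
  simp only [(dz_eventuallyEq _ h1).eq_of_nhds,
    (dz_eventuallyEq _ (dz_eventuallyEq _ h1)).eq_of_nhds]

theorem leviMatrix_congr {n : ℕ} {f r : Cn n → ℝ} {ζ : Cn n} (h : f =ᶠ[nhds ζ] r) :
    leviMatrix f ζ = leviMatrix r ζ := by
  have h1 := toC_eventuallyEq h
  ext j k
  exact (dz_eventuallyEq _ (dzbar_eventuallyEq _ h1)).eq_of_nhds

theorem fderiv_conj {n : ℕ} {F : Cn n → ℂ} {ζ : Cn n} (hF : DifferentiableAt ℝ F ζ) (v : Cn n) :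
    fderiv ℝ (fun y => conj (F y)) ζ v = conj (fderiv ℝ F ζ v) := by
  have h := (Complex.conjCLE.toContinuousLinearMap.hasFDerivAt (x := F ζ)).comp ζ hF.hasFDerivAt
  have h2 : HasFDerivAt (fun y => conj (F y)) _ ζ := h
  rw [h2.fderiv]
  rfl

theorem dzbar_conj {n : ℕ} (j : Fin n) {F : Cn n → ℂ} {ζ : Cn n} (hF : DifferentiableAt ℝ F ζ) :
    dzbar j (fun y => conj (F y)) ζ = conj (dz j F ζ) := by
  simp only [dz, dzbar, fderiv_conj hF, map_div₀, map_sub, map_mul, Complex.conj_I, map_ofNat]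
  ring

theorem dzbar_toC {n : ℕ} (j : Fin n) {r : Cn n → ℝ} {ζ : Cn n} (hr : DifferentiableAt ℝ r ζ) :
    dzbar j (toC r) ζ = conj (dz j (toC r) ζ) := by
  have h1 : DifferentiableAt ℝ (toC r) ζ :=
    Complex.ofRealCLM.differentiableAt.comp ζ hr
  have h2 : toC r = fun y => conj (toC r y) := by
    funext y; simp [toC]
  conv_lhs => rw [h2]
  exact dzbar_conj j h1

theorem fderiv_toC {n : ℕ} {r : Cn n → ℝ} {ζ : Cn n} (hr : DifferentiableAt ℝ r ζ) (v : Cn n) :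
    fderiv ℝ (toC r) ζ v = (fderiv ℝ r ζ v : ℂ) := by
  have h : HasFDerivAt (toC r) _ ζ :=
    (Complex.ofRealCLM.hasFDerivAt (x := r ζ)).comp ζ hr.hasFDerivAt
  rw [h.fderiv]
  rfl

theorem contDiff_toC {n : ℕ} {f : Cn n → ℝ} (hf : ContDiff ℝ ∞ f) : ContDiff ℝ ∞ (toC f) :=
  Complex.ofRealCLM.contDiff.comp hf

/-- The complex gradient, with the coordinates `conj (∂r/∂ζ_j)`, so that `⟨∇r, v⟩ = ∂r(v)`. -/
def cgrad {n : ℕ} (r : Cn n → ℝ) (ζ : Cn n) : Cn n := WithLp.toLp 2 fun j => conj (dz j (toC r) ζ)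

theorem inner_cgrad {n : ℕ} (r : Cn n → ℝ) (ζ v : Cn n) :
    inner ℂ (cgrad r ζ) v = ∑ j, dz j (toC r) ζ * v j := by
  simp [cgrad, PiLp.inner_apply, mul_comm]

theorem fderiv_eq_inner_cgrad {n : ℕ} {r : Cn n → ℝ} {ζ : Cn n} (hr : DifferentiableAt ℝ r ζ)
    (v : Cn n) : fderiv ℝ r ζ v = 2 * (inner ℂ (cgrad r ζ) v : ℂ).re := by
  have h : ((fderiv ℝ r ζ v : ℝ) : ℂ) = ∑ j, (dz j (toC r) ζ * v j + conj (dz j (toC r) ζ * v j)) := by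
    rw [← fderiv_toC hr, fderiv_eq_sum_dz]
    simp only [dzbar_toC _ hr, map_mul]
  have h2 := congrArg Complex.re h
  rw [Complex.ofReal_re, Finset.sum_add_distrib, Complex.add_re, ← map_sum, Complex.conj_re,
    ← inner_cgrad] at h2
  rw [h2]; ring

/-- The Levi form `∑ (∂²r/∂ζ_j∂ζ̄_k) v_j v̄_k`. -/
def leviForm {n : ℕ} (r : Cn n → ℝ) (ζ v : Cn n) : ℝ :=
  quadForm (leviMatrix r ζ) (WithLp.toLp 2 fun j => conj (v j))

theorem leviForm_eq {n : ℕ} (r : Cn n → ℝ) (ζ v : Cn n) :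
    leviForm r ζ v = (∑ j, ∑ k, dz j (dzbar k (toC r)) ζ * v j * conj (v k)).re := by
  unfold leviForm quadForm
  congr 1
  refine Finset.sum_congr rfl fun j _ => Finset.sum_congr rfl fun k _ => ?_
  rw [Complex.conj_conj]
  simp only [leviMatrix, Matrix.of_apply]
  ring

/-- Apply the expansion of a differential in Wirtinger derivatives twice. As f is real, the
remaining second derivatives are conjugates of those displayed, so symmetry of mixed derivatives is
not needed. -/
theorem fderiv_fderiv_eq {n : ℕ} {f : Cn n → ℝ} (hf : ContDiff ℝ ∞ f) (ζ v : Cn n) :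
    fderiv ℝ (fderiv ℝ f) ζ v v
      = 2 * (∑ j, ∑ k, dz j (dz k (toC f)) ζ * v j * v k).re + 2 * leviForm f ζ v := by
  have hd : Differentiable ℝ f := hf.differentiable (by simp)
  have hd1 : Differentiable ℝ (fderiv ℝ f) :=
    (hf.fderiv_right (m := ∞) (by simp)).differentiable (by simp)
  have hz : ∀ k, Differentiable ℝ (dz k (toC f)) := fun k =>
    (contDiff_dz k (contDiff_toC hf)).differentiable (by simp)
  have hzb : ∀ k, Differentiable ℝ (dzbar k (toC f)) := fun k =>
    (contDiff_dzbar k (contDiff_toC hf)).differentiable (by simp)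
  have hdirr : HasFDerivAt (fun y => fderiv ℝ f y v)
      ((ContinuousLinearMap.apply ℝ ℝ v).comp (fderiv ℝ (fderiv ℝ f) ζ)) ζ :=
    (ContinuousLinearMap.apply ℝ ℝ v).hasFDerivAt.comp ζ (hd1 ζ).hasFDerivAt
  have h1 : fderiv ℝ (toC fun y => fderiv ℝ f y v) ζ v
      = (fderiv ℝ (fderiv ℝ f) ζ v v : ℂ) := by
    rw [fderiv_toC hdirr.differentiableAt, hdirr.fderiv]
    rfl
  have h2 : (toC fun y => fderiv ℝ f y v)
      = fun y => ∑ k, (dz k (toC f) y * v k + dzbar k (toC f) y * conj (v k)) := by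
    funext y
    rw [← fderiv_eq_sum_dz, fderiv_toC (hd y)]
    rfl
  have h3 : HasFDerivAt (fun y => ∑ k, (dz k (toC f) y * v k + dzbar k (toC f) y * conj (v k)))
      (∑ k, ((v k) • fderiv ℝ (dz k (toC f)) ζ + conj (v k) • fderiv ℝ (dzbar k (toC f)) ζ)) ζ :=
    HasFDerivAt.fun_sum fun k _ =>
      ((hz k ζ).hasFDerivAt.mul_const (v k)).add ((hzb k ζ).hasFDerivAt.mul_const (conj (v k)))
  rw [h2, h3.fderiv] at h1
  simp only [sum_apply, add_apply, smul_apply, fderiv_eq_sum_dz, smul_eq_mul] at h1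
  have hzz : ∀ j k, dzbar j (dzbar k (toC f)) ζ = conj (dz j (dz k (toC f)) ζ) := by
    intro j k
    have : dzbar k (toC f) = fun y => conj (dz k (toC f) y) := funext fun y => dzbar_toC k (hd y)
    rw [this, dzbar_conj j (hz k ζ)]
  have hzb' : ∀ j k, dzbar j (dz k (toC f)) ζ = conj (dz j (dzbar k (toC f)) ζ) := by
    intro j k
    have : dz k (toC f) = fun y => conj (dzbar k (toC f) y) := funext fun y => by
      rw [dzbar_toC k (hd y), Complex.conj_conj]
    rw [this, dzbar_conj j (hzb k ζ)]
  have h4 : ((fderiv ℝ (fderiv ℝ f) ζ v v : ℝ) : ℂ)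
      = ((∑ j, ∑ k, dz j (dz k (toC f)) ζ * v j * v k)
          + conj (∑ j, ∑ k, dz j (dz k (toC f)) ζ * v j * v k))
        + ((∑ j, ∑ k, dz j (dzbar k (toC f)) ζ * v j * conj (v k))
          + conj (∑ j, ∑ k, dz j (dzbar k (toC f)) ζ * v j * conj (v k))) := by
    rw [← h1]
    simp only [map_sum, map_mul, Complex.conj_conj, hzz, hzb']
    rw [Finset.sum_comm (f := fun j k => dz j (dz k (toC f)) ζ * v j * v k),
      Finset.sum_comm (f := fun j k => conj (dz j (dz k (toC f)) ζ) * conj (v j) * conj (v k)),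
      Finset.sum_comm (f := fun j k => dz j (dzbar k (toC f)) ζ * v j * conj (v k)),
      Finset.sum_comm (f := fun j k => conj (dz j (dzbar k (toC f)) ζ) * conj (v j) * v k)]
    simp only [← Finset.sum_add_distrib, Finset.mul_sum]
    refine Finset.sum_congr rfl fun k _ => Finset.sum_congr rfl fun j _ => ?_
    ring
  have h5 := congrArg Complex.re h4
  simp only [Complex.ofReal_re, Complex.add_re, Complex.conj_re] at h5
  rw [h5, leviForm_eq]
  ring

/-- Up to sign, F collects the ∂r term and the holomorphic half of the Hessian; the Levi form is
what remains of the second-order Taylor expansion at ζ. -/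
theorem exists_taylor_leviPoly {n : ℕ} {f : Cn n → ℝ} (hf : ContDiff ℝ ∞ f)
    (hc : HasCompactSupport f) :
    ∃ C : ℝ, 0 ≤ C ∧ ∀ ζ z : Cn n,
      |2 * (leviPoly f ζ z).re - (f ζ - f z + leviForm f ζ (z - ζ))| ≤ C * ‖ζ - z‖ ^ 3 := by
  obtain ⟨C, hC, h⟩ := exists_taylor_two hf hc
  refine ⟨C, hC, fun ζ z => ?_⟩
  have h1 := h ζ (z - ζ)
  have hd : Differentiable ℝ f := hf.differentiable (by simp)
  rw [fderiv_fderiv_eq hf, fderiv_eq_inner_cgrad (hd ζ), inner_cgrad, add_sub_cancel] at h1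
  have h2 : leviPoly f ζ z = -(∑ j, dz j (toC f) ζ * (z - ζ) j)
      - ((1 / 2 : ℝ) : ℂ) * ∑ j, ∑ k, dz j (dz k (toC f)) ζ * (z - ζ) j * (z - ζ) k := by
    unfold leviPoly
    rw [← Finset.sum_neg_distrib]
    push_cast
    congr 1
    · refine Finset.sum_congr rfl fun j _ => ?_
      simp only [PiLp.sub_apply]
      ring
    · congr 1
      refine Finset.sum_congr rfl fun j _ => Finset.sum_congr rfl fun k _ => ?_
      simp only [PiLp.sub_apply]
      ring
  rw [h2, Complex.sub_re, Complex.neg_re, Complex.re_ofReal_mul, norm_sub_rev]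
  convert h1 using 2
  ring

/-! ### The length of `∂r` -/

theorem norm_toLp_dz {n : ℕ} (r : Cn n → ℝ) (ζ : Cn n) :
    ‖(WithLp.toLp 2 fun j => dz j (toC r) ζ : Cn n)‖ = ‖cgrad r ζ‖ := by
  simp [cgrad, EuclideanSpace.norm_eq]

theorem gam_eq {n : ℕ} (r : Cn n → ℝ) (g : Cn n → Matrix (Fin n) (Fin n) ℂ) (ζ : Cn n) :
    gam r g ζ = Real.sqrt (2 * quadForm (g ζ)⁻¹ (WithLp.toLp 2 fun j => dz j (toC r) ζ)) := by
  unfold gam quadForm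
  congr 1
  rw [← Complex.re_ofReal_mul]
  push_cast
  rfl

theorem continuous_inv_entry {n : ℕ} {g : Cn n → Matrix (Fin n) (Fin n) ℂ}
    (hc : ∀ j k, Continuous (fun ζ => g ζ j k)) (hM : ∀ ζ, (g ζ).PosDef) (j k : Fin n) :
    Continuous fun ζ => (g ζ)⁻¹ j k := by
  have hg : Continuous g := continuous_matrix hc
  have h1 : (fun ζ => (g ζ)⁻¹ j k) = fun ζ => (g ζ).det⁻¹ * (g ζ).adjugate j k := by
    funext ζ
    rw [Matrix.inv_def, Ring.inverse_eq_inv']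
    rfl
  rw [h1]
  exact (hg.matrix_det.inv₀ fun ζ => (hM ζ).det_pos.ne').mul (hg.matrix_adjugate.matrix_elem j k)

/-- Allows γ to be replaced by the Euclidean length of ∂r, whose Lipschitz continuity is immediate.
-/
theorem exists_gam_bounds {n : ℕ} {K : Set (Cn n)} (hK : IsCompact K) (r : Cn n → ℝ)
    {g : Cn n → Matrix (Fin n) (Fin n) ℂ} (hc : ∀ j k, Continuous (fun ζ => g ζ j k))
    (hM : ∀ ζ, (g ζ).PosDef) :
    ∃ C : ℝ, ∀ ζ ∈ K, gam r g ζ ≤ C * ‖cgrad r ζ‖ ∧ ‖cgrad r ζ‖ ≤ C * gam r g ζ := by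
  have hcont := fun j k => (continuous_inv_entry hc hM j k).continuousOn (s := K)
  obtain ⟨c, hc0, h1⟩ := exists_quadForm_ge hK hcont fun ζ _ => (hM ζ).inv
  obtain ⟨B, hB0, h2⟩ := exists_quadForm_le hK hcont
  have hs : 0 < Real.sqrt (2 * c) := Real.sqrt_pos.2 (by positivity)
  refine ⟨max (Real.sqrt (2 * B)) (Real.sqrt (2 * c))⁻¹, fun ζ hζ => ?_⟩
  have h1' := h1 ζ hζ (WithLp.toLp 2 fun j => dz j (toC r) ζ)
  have h2' := h2 ζ hζ (WithLp.toLp 2 fun j => dz j (toC r) ζ)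
  rw [norm_toLp_dz] at h1' h2'
  have hg0 : 0 ≤ gam r g ζ := Real.sqrt_nonneg _
  constructor
  · refine le_trans ?_ (mul_le_mul_of_nonneg_right (le_max_left _ _) (norm_nonneg _))
    rw [gam_eq, ← Real.sqrt_sq (norm_nonneg (cgrad r ζ)), ← Real.sqrt_mul (by positivity)]
    refine Real.sqrt_le_sqrt ?_
    linarith [le_abs_self (quadForm (g ζ)⁻¹ (WithLp.toLp 2 fun j => dz j (toC r) ζ))]
  · refine le_trans ?_ (mul_le_mul_of_nonneg_right (le_max_right _ _) hg0)
    rw [inv_mul_eq_div, le_div_iff₀ hs, gam_eq]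
    refine Real.le_sqrt_of_sq_le ?_
    rw [mul_pow, Real.sq_sqrt (by positivity)]
    linarith

/-! ### The collar -/

/-- By continuity r ≤ -ε on the closure of D_ε, so the closure does not meet ∂D. In particular the
functions ξ, which live only on D, are available there. -/
theorem IsMorseDomain.mem_of_mem_closure_DEps {n : ℕ} {D : Set (Cn n)} {r : Cn n → ℝ}
    (hD : IsMorseDomain D r) {ε : ℝ} (hε : 0 < ε) {ζ : Cn n} (hζ : ζ ∈ closure (DEps D r ε)) :
    ζ ∈ D ∧ rEps r ε ζ ≤ 0 := by
  obtain ⟨W, hW, hDW, hr, hDef, -⟩ := hD.defining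
  have hζW : ζ ∈ W := hDW (closure_mono (fun x hx => hx.1) hζ)
  have hcont : ContinuousAt r ζ := (hr.continuousOn.continuousAt (hW.mem_nhds hζW))
  have h1 : r ζ ≤ -ε := by
    refine ContinuousWithinAt.closure_le hζ hcont.continuousWithinAt continuousWithinAt_const ?_
    rintro y ⟨-, hy⟩
    unfold rEps at hy
    linarith
  refine ⟨?_, by unfold rEps; linarith⟩
  rw [hDef]
  exact ⟨hζW, by linarith⟩

theorem IsMorseDomain.isCompact_closure {n : ℕ} {D : Set (Cn n)} {r : Cn n → ℝ}
    (hD : IsMorseDomain D r) : IsCompact (closure D) := hD.isBounded.isCompact_closure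

theorem cgrad_congr {n : ℕ} {f r : Cn n → ℝ} {ζ : Cn n} (h : f =ᶠ[nhds ζ] r) :
    cgrad f ζ = cgrad r ζ := by
  unfold cgrad
  simp only [(dz_eventuallyEq _ (toC_eventuallyEq h)).eq_of_nhds]

theorem leviForm_congr {n : ℕ} {f r : Cn n → ℝ} {ζ : Cn n} (h : f =ᶠ[nhds ζ] r) (v : Cn n) :
    leviForm f ζ v = leviForm r ζ v := by
  unfold leviForm
  rw [leviMatrix_congr h]

theorem IsMorseDomain.exists_extension {n : ℕ} {D : Set (Cn n)} {r : Cn n → ℝ}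
    (hD : IsMorseDomain D r) : ∃ f : Cn n → ℝ, ContDiff ℝ ∞ f ∧ HasCompactSupport f ∧
      ∀ x ∈ closure D, f =ᶠ[nhds x] r := by
  obtain ⟨W, hW, hDW, hr, -, -⟩ := hD.defining
  exact exists_compactSupport_extension hD.isCompact_closure hW hDW hr

/-- Where `r ≥ -m`, the Levi form is uniformly positive and `r` has no critical points in `D`. -/
theorem IsMorseDomain.exists_collar {n : ℕ} {D : Set (Cn n)} {r : Cn n → ℝ}
    (hD : IsMorseDomain D r) : ∃ m c : ℝ, 0 < m ∧ 0 < c ∧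
      (∀ ζ ∈ closure D, -m ≤ r ζ → ∀ v, c * ‖v‖ ^ 2 ≤ leviForm r ζ v) ∧
      (∀ ζ ∈ D, cgrad r ζ = 0 → r ζ ≤ -m) ∧
      IsCompact {ζ | ζ ∈ closure D ∧ r ζ ≤ -m} ∧ {ζ | ζ ∈ closure D ∧ r ζ ≤ -m} ⊆ D := by
  obtain ⟨f, hf, -, hfr⟩ := hD.exists_extension
  have hval : ∀ x ∈ closure D, f x = r x := fun x hx => (hfr x hx).eq_of_nhds
  obtain ⟨W, hW, hDW, hr, hDef, hFr⟩ := hD.defining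
  obtain ⟨U, hU, hFU, hlevi, hcrit⟩ := hD.collar
  have hDcl : ∀ x ∈ closure D, r x < 0 → x ∈ D := fun x hx h => by
    rw [hDef]; exact ⟨hDW hx, h⟩
  have hneg : ∀ x ∈ D, r x < 0 := fun x hx => by rw [hDef] at hx; exact hx.2
  have hclD : ∀ x ∈ closure D, x ∉ frontier D → x ∈ D := fun x hx h => by
    by_contra h2
    exact h ⟨hx, fun h3 => h2 (interior_subset h3)⟩
  -- Outside U the compact set D̄ \ U lies inside D, so -r has a positive lower bound there. Half of
  -- it serves as the width of the collar, so that r ≥ -m/2 forces membership in U.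
  obtain ⟨m, hm0, hm⟩ := (hD.isCompact_closure.diff hU).exists_forall_le'
    (f := fun x => -f x) hf.continuous.neg.continuousOn (a := 0) (by
      rintro x ⟨hx, hxU⟩
      have := hneg x (hclD x hx fun h => hxU (hFU h))
      rw [← hval x hx] at this
      linarith)
  have hU' : ∀ ζ ∈ closure D, -(m / 2) ≤ r ζ → ζ ∈ U := by
    intro ζ hζ h
    by_contra h2
    have h3 := hm ζ ⟨hζ, h2⟩
    simp only [hval ζ hζ] at h3
    linarith
  have hS : IsCompact (closure D ∩ {ζ | -(m / 2) ≤ f ζ}) :=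
    hD.isCompact_closure.inter_right (isClosed_le continuous_const hf.continuous)
  have hSm : ∀ ζ ∈ closure D ∩ {ζ | -(m / 2) ≤ f ζ}, ζ ∈ U := fun ζ hζ =>
    hU' ζ hζ.1 (by rw [← hval ζ hζ.1]; exact hζ.2)
  obtain ⟨c, hc0, hc⟩ := exists_quadForm_ge hS (M := leviMatrix f)
    (fun j k => (contDiff_dz j (contDiff_dzbar k (contDiff_toC hf))).continuous.continuousOn)
    (fun ζ hζ => by rw [leviMatrix_congr (hfr ζ hζ.1)]; exact hlevi ζ (hSm ζ hζ))
  refine ⟨m / 2, c, by positivity, hc0, ?_, ?_, ?_, ?_⟩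
  · intro ζ hζ h v
    rw [← leviForm_congr (hfr ζ hζ), ← norm_toLp_conj v]
    exact hc ζ ⟨hζ, by rw [← hval ζ hζ] at h; exact h⟩ _
  · intro ζ hζ h
    by_contra h2
    have hζU := hU' ζ (subset_closure hζ) (by linarith)
    have hd : DifferentiableAt ℝ r ζ :=
      (hr.contDiffAt (hW.mem_nhds (hDW (subset_closure hζ)))).differentiableAt (by simp)
    have h3 : fderiv ℝ r ζ = 0 := by
      ext v
      rw [fderiv_eq_inner_cgrad hd, h]
      simp
    have h4 := (hcrit ζ hζU h3).1
    rw [hD.isOpen.frontier_eq] at h4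
    exact h4.2 hζ
  · have : {ζ | ζ ∈ closure D ∧ r ζ ≤ -(m / 2)} = closure D ∩ {ζ | f ζ ≤ -(m / 2)} := by
      ext ζ
      simp only [mem_ofPred_eq, mem_inter_iff]
      exact and_congr_right fun h => by rw [hval ζ h]
    rw [this]
    exact hD.isCompact_closure.inter_right (isClosed_le hf.continuous continuous_const)
  · rintro ζ ⟨h1, h2⟩
    exact hDcl ζ h1 (by linarith)

/-! ### Estimates of `φ_ε` -/

/-- The non-isotropic size `|r_ε(ζ)| + |r_ε(z)| + |∂r(z)(ζ - z)| + |ζ - z|²`. -/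
def nonisotropic {n : ℕ} (r : Cn n → ℝ) (ε : ℝ) (ζ z : Cn n) : ℝ :=
  |rEps r ε ζ| + |rEps r ε z| + ‖(inner ℂ (cgrad r z) (ζ - z) : ℂ)‖ + ‖ζ - z‖ ^ 2

theorem exists_leviPoly_bounds {n : ℕ} {f : Cn n → ℝ} (hf : ContDiff ℝ ∞ f)
    (hc : HasCompactSupport f) : ∃ C : ℝ, 0 ≤ C ∧
      (∀ ζ, ‖cgrad f ζ‖ ≤ C) ∧ (∀ ζ z, ‖cgrad f ζ - cgrad f z‖ ≤ C * ‖ζ - z‖) ∧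
      (∀ ζ z, ‖leviPoly f ζ z - inner ℂ (cgrad f ζ) (ζ - z)‖ ≤ C * ‖ζ - z‖ ^ 2) ∧
      (∀ ζ v, |leviForm f ζ v| ≤ C * ‖v‖ ^ 2) := by
  have hcC : HasCompactSupport (toC f) := hc.comp_left (g := Complex.ofReal) rfl
  have hfC := contDiff_toC hf
  have hgr : ContDiff ℝ 1 (cgrad f) := by
    refine (contDiff_piLp 2).2 fun j => ?_
    exact Complex.conjCLE.contDiff.comp ((contDiff_dz j hfC).of_le (by simp))
  have hgrc : HasCompactSupport (cgrad f) := by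
    refine (hcC.fderiv (𝕜 := ℝ)).mono fun x hx => ?_
    contrapose! hx
    simp only [Function.mem_support, not_not] at hx ⊢
    ext j
    simp [cgrad, dz, hx]
  obtain ⟨C₁, hC₁, h1, h2⟩ := exists_bound_lipschitz hgr hgrc
  obtain ⟨C₂, h3⟩ : ∃ C₂ : ℝ, ∀ ζ, ∑ j, ∑ k, ‖dz j (dz k (toC f)) ζ‖ ≤ C₂ := by
    have : ∀ j k, ∃ B : ℝ, ∀ ζ, ‖dz j (dz k (toC f)) ζ‖ ≤ B := fun j k =>
      (contDiff_dz j (contDiff_dz k hfC)).continuous.bounded_above_of_compact_support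
        (hasCompactSupport_dz j (hasCompactSupport_dz k hcC))
    choose B hB using this
    exact ⟨∑ j, ∑ k, B j k, fun ζ =>
      Finset.sum_le_sum fun j _ => Finset.sum_le_sum fun k _ => hB j k ζ⟩
  obtain ⟨C₃, h4⟩ : ∃ C₃ : ℝ, ∀ ζ, ∑ j, ∑ k, ‖leviMatrix f ζ j k‖ ≤ C₃ := by
    have : ∀ j k, ∃ B : ℝ, ∀ ζ, ‖dz j (dzbar k (toC f)) ζ‖ ≤ B := fun j k => by
      refine (contDiff_dz j (contDiff_dzbar k hfC)).continuous.bounded_above_of_compact_support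
        (hasCompactSupport_dz j ?_)
      refine (hcC.fderiv (𝕜 := ℝ)).mono fun x hx => ?_
      contrapose! hx
      simp only [Function.mem_support, not_not] at hx ⊢
      simp [dzbar, hx]
    choose B hB using this
    exact ⟨∑ j, ∑ k, B j k, fun ζ =>
      Finset.sum_le_sum fun j _ => Finset.sum_le_sum fun k _ => hB j k ζ⟩
  have hle1 : C₁ ≤ max C₁ (max C₂ C₃) := le_max_left _ _
  have hle2 : C₂ ≤ max C₁ (max C₂ C₃) := (le_max_left _ _).trans (le_max_right _ _)
  have hle3 : C₃ ≤ max C₁ (max C₂ C₃) := (le_max_right _ _).trans (le_max_right _ _)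
  refine ⟨max C₁ (max C₂ C₃), hC₁.trans hle1, fun ζ => (h1 ζ).trans hle1,
    fun ζ z => (h2 ζ z).trans (by gcongr), fun ζ z => ?_, fun ζ v => ?_⟩
  · have e : leviPoly f ζ z - inner ℂ (cgrad f ζ) (ζ - z)
        = -(1 / 2 * ∑ j, ∑ k, dz j (dz k (toC f)) ζ * (ζ j - z j) * (ζ k - z k)) := by
      rw [inner_cgrad]
      unfold leviPoly
      simp only [PiLp.sub_apply]
      ring
    have hb : ‖∑ j, ∑ k, dz j (dz k (toC f)) ζ * (ζ j - z j) * (ζ k - z k)‖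
        ≤ C₂ * ‖ζ - z‖ ^ 2 := by
      refine le_trans ?_ (mul_le_mul_of_nonneg_right (h3 ζ) (by positivity))
      rw [Finset.sum_mul]
      refine (norm_sum_le _ _).trans (Finset.sum_le_sum fun j _ => ?_)
      rw [Finset.sum_mul]
      refine (norm_sum_le _ _).trans (Finset.sum_le_sum fun k _ => ?_)
      rw [norm_mul, norm_mul, mul_assoc, pow_two]
      have hj : ‖ζ j - z j‖ ≤ ‖ζ - z‖ := PiLp.norm_apply_le (ζ - z) j
      have hk : ‖ζ k - z k‖ ≤ ‖ζ - z‖ := PiLp.norm_apply_le (ζ - z) k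
      gcongr
    rw [e, norm_neg, norm_mul]
    have h12 : ‖(1 / 2 : ℂ)‖ ≤ 1 := by norm_num
    calc _ ≤ 1 * (C₂ * ‖ζ - z‖ ^ 2) := by gcongr
      _ ≤ _ := by rw [one_mul]; gcongr
  · unfold leviForm
    refine (quadForm_le _ _).trans ?_
    rw [norm_toLp_conj]
    gcongr
    exact (h4 ζ).trans hle3

/-- Uniform estimates for the ingredients of admissible kernels near the diagonal of
`D̄_ε × D̄_ε`. -/
structure GeometricBounds {n : ℕ} (D : Set (Cn n)) (r : Cn n → ℝ)
    (g : Cn n → Matrix (Fin n) (Fin n) ℂ) (ρ χ : Cn n → Cn n → ℝ) (ε₁ η C : ℝ) : Prop where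
  pos : 0 < ε₁ ∧ 0 < η ∧ η ≤ 1 ∧ 1 ≤ C
  rEps_nonpos : ∀ ε ∈ Ioo 0 ε₁, ∀ ζ ∈ closure (DEps D r ε), rEps r ε ζ ≤ 0
  abs_rEps_le : ∀ ε ∈ Ioo 0 ε₁, ∀ ζ ∈ closure (DEps D r ε), |rEps r ε ζ| ≤ C
  norm_cgrad_le : ∀ ζ ∈ closure D, ‖cgrad r ζ‖ ≤ C
  gam_le : ∀ ζ ∈ closure D, gam r g ζ ≤ C * ‖cgrad r ζ‖
  le_gam : ∀ ζ ∈ closure D, ‖cgrad r ζ‖ ≤ C * gam r g ζ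
  critical : ∀ ε ∈ Ioo 0 ε₁, ∀ ζ ∈ closure (DEps D r ε), gam r g ζ = 0 → 1 ≤ C * |rEps r ε ζ|
  sub_le : ∀ ζ ∈ closure D, ∀ z ∈ closure D, |r ζ - r z| ≤ C * ‖ζ - z‖
  cgrad_sub_le : ∀ ζ ∈ closure D, ∀ z ∈ closure D, ‖cgrad r ζ - cgrad r z‖ ≤ C * ‖ζ - z‖
  le_rho : ∀ ζ ∈ closure D, ∀ z ∈ closure D, ‖ζ - z‖ < η → ‖ζ - z‖ ^ 2 ≤ C * ρ ζ z ^ 2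
  phi_le : ∀ ε ∈ Ioo 0 ε₁, ∀ ζ ∈ closure (DEps D r ε), ∀ z ∈ closure (DEps D r ε),
    ‖ζ - z‖ < η → ‖phi r ρ χ ε ζ z‖ ≤ C * nonisotropic r ε ζ z ∧
      ‖phi r ρ χ ε z ζ‖ ≤ C * nonisotropic r ε ζ z
  le_phi : ∀ ε ∈ Ioo 0 ε₁, ∀ ζ ∈ closure (DEps D r ε), ∀ z ∈ closure (DEps D r ε),
    ‖ζ - z‖ < η → nonisotropic r ε ζ z ≤ C * ‖phi r ρ χ ε ζ z‖ ∧
      nonisotropic r ε ζ z ≤ C * ‖phi r ρ χ ε z ζ‖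

/-- The real part controls x, y and d². By the triangle inequality |s| is at most |F - x| + |x| + |F
- s|, and the last two terms are already controlled. Only the moduli of s and p need agree, because
exchanging the variables changes the sign of the linear term. -/
theorem size_bounds_of_re_le {F s p : ℂ} {x y d c C : ℝ} (hc : 0 < c) (hC : 0 ≤ C)
    (hre : c * (|x| + |y| + d ^ 2) ≤ (F - x).re) (hF : ‖F - s‖ ≤ C * d ^ 2) (hs : ‖s‖ = ‖p‖) :
    ‖F - x‖ ≤ (1 + C + (2 + C) / c) * (|x| + |y| + ‖p‖ + d ^ 2) ∧
      |x| + |y| + ‖p‖ + d ^ 2 ≤ (1 + C + (2 + C) / c) * ‖F - x‖ := by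
  have hx' : ‖(x : ℂ)‖ = |x| := Complex.norm_real x
  have hre' := hre.trans ((le_abs_self _).trans (Complex.abs_re_le_norm _))
  have hd := sq_nonneg d
  have h1 : ‖F - x‖ ≤ ‖F - s‖ + ‖s‖ + |x| := by
    rw [← hx']
    calc ‖F - x‖ = ‖(F - s) + s - x‖ := by ring_nf
      _ ≤ ‖(F - s) + s‖ + ‖(x : ℂ)‖ := norm_sub_le _ _
      _ ≤ _ := by gcongr; exact norm_add_le _ _
  have h2 : ‖s‖ ≤ ‖F - s‖ + ‖F - x‖ + |x| := by
    rw [← hx']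
    calc ‖s‖ = ‖(F - x) + x - (F - s)‖ := by ring_nf
      _ ≤ ‖(F - x) + x‖ + ‖F - s‖ := norm_sub_le _ _
      _ ≤ (‖F - x‖ + ‖(x : ℂ)‖) + ‖F - s‖ := by gcongr; exact norm_add_le _ _
      _ = _ := by ring
  have hc2 : 0 ≤ (2 + C) / c := by positivity
  have hQ : 0 ≤ |x| + |y| + ‖p‖ + d ^ 2 := by positivity
  constructor
  · have h3 : ‖F - x‖ ≤ (1 + C) * (|x| + |y| + ‖p‖ + d ^ 2) := by
      nlinarith [abs_nonneg x, abs_nonneg y, norm_nonneg p]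
    exact h3.trans (mul_le_mul_of_nonneg_right (by linarith) hQ)
  · have h3 : |x| + |y| + d ^ 2 ≤ ‖F - x‖ / c := by
      rw [le_div_iff₀ hc]; linarith
    have h4 : ‖p‖ ≤ ‖F - x‖ + (1 + C) * (‖F - x‖ / c) := by
      rw [← hs]
      nlinarith [abs_nonneg x, abs_nonneg y]
    have h5 : (1 + C + (2 + C) / c) * ‖F - x‖
        = ‖F - x‖ + C * ‖F - x‖ + (2 + C) * (‖F - x‖ / c) := by
      ring
    rw [h5]
    have : 0 ≤ C * ‖F - x‖ := by positivity
    linarith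

theorem phi_eq_of_chi_eq_one {n : ℕ} {r : Cn n → ℝ} {ρ χ : Cn n → Cn n → ℝ} {ε : ℝ} {ζ z : Cn n}
    (h : χ ζ z = 1) : phi r ρ χ ε ζ z = leviPoly r ζ z - (rEps r ε ζ : ℂ) := by
  simp [phi, h]

/-- Near the diagonal `Re φ_ε` dominates `|r_ε(ζ)| + |r_ε(z)| + |ζ - z|²`. -/
theorem exists_re_leviPoly_ge {n : ℕ} {D : Set (Cn n)} {r : Cn n → ℝ} (hD : IsMorseDomain D r) :
    ∃ m c η : ℝ, 0 < m ∧ 0 < c ∧ 0 < η ∧ η ≤ 1 ∧ (∀ ζ ∈ D, cgrad r ζ = 0 → r ζ ≤ -m) ∧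
      ∀ ε ∈ Ioo 0 (m / 2), ∀ ζ ∈ closure (DEps D r ε), ∀ z ∈ closure (DEps D r ε),
        ‖ζ - z‖ < η → c * (|rEps r ε ζ| + |rEps r ε z| + ‖ζ - z‖ ^ 2)
          ≤ (leviPoly r ζ z - (rEps r ε ζ : ℂ)).re := by
  obtain ⟨m, c₀, hm, hc₀, hlevi, hcrit, -, -⟩ := hD.exists_collar
  obtain ⟨f, hf, hfc, hfr⟩ := hD.exists_extension
  obtain ⟨C₁, hC₁, hT⟩ := exists_taylor_leviPoly hf hfc
  obtain ⟨C₂, hC₂, -, -, -, hL⟩ := exists_leviPoly_bounds hf hfc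
  have hval : ∀ x ∈ closure D, f x = r x := fun x hx => (hfr x hx).eq_of_nhds
  -- The second bound on η makes the cubic remainder at most half the Levi form in the collar; the
  -- third makes the quadratic and cubic errors small against m deep inside D.
  obtain ⟨η, hη, hηle⟩ : ∃ η : ℝ, 0 < η ∧ η ≤ min 1 (min (c₀ / (2 * (C₁ + 1)))
      (m / (4 * (C₁ + C₂ + 1)))) :=
    ⟨_, lt_min one_pos (lt_min (by positivity) (by positivity)), le_rfl⟩
  have hη1 : η ≤ 1 := hηle.trans (min_le_left _ _)
  have hη2 : η ≤ c₀ / (2 * (C₁ + 1)) := hηle.trans ((min_le_right _ _).trans (min_le_left _ _))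
  have hη3 : η ≤ m / (4 * (C₁ + C₂ + 1)) :=
    hηle.trans ((min_le_right _ _).trans (min_le_right _ _))
  rw [le_div_iff₀ (by positivity)] at hη2 hη3
  refine ⟨m, min (1 / 4) (c₀ / 4), η, hm, lt_min (by norm_num) (by positivity), hη, hη1,
    hcrit, fun ε hε ζ hζ z hz hd => ?_⟩
  have hcl : ∀ w ∈ closure (DEps D r ε), w ∈ closure D := fun w hw =>
    closure_mono (fun x hx => hx.1) hw
  have hζ0 := (hD.mem_of_mem_closure_DEps hε.1 hζ).2
  have hz0 := (hD.mem_of_mem_closure_DEps hε.1 hz).2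
  have hT' := (abs_le.1 (hT ζ z)).1
  rw [leviPoly_congr (hfr ζ (hcl ζ hζ)), hval ζ (hcl ζ hζ), hval z (hcl z hz)] at hT'
  rw [abs_of_nonpos hζ0, abs_of_nonpos hz0, Complex.sub_re, Complex.ofReal_re]
  have hd0 : 0 ≤ ‖ζ - z‖ := norm_nonneg _
  obtain ⟨d, hdd⟩ : ∃ d, d = ‖ζ - z‖ := ⟨_, rfl⟩
  have hnorm : ‖z - ζ‖ = d := by rw [hdd, norm_sub_rev]
  rw [← hdd] at hT' hd hd0 ⊢
  have hLb : |leviForm f ζ (z - ζ)| ≤ C₂ * d ^ 2 := by rw [← hnorm]; exact hL ζ (z - ζ)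
  have hd3 : C₁ * d ^ 3 ≤ C₁ * η * d ^ 2 := by
    have : d ^ 3 ≤ η * d ^ 2 := by
      rw [pow_succ' d 2]; exact mul_le_mul_of_nonneg_right hd.le (sq_nonneg d)
    rw [mul_assoc]
    exact mul_le_mul_of_nonneg_left this hC₁
  have hmin1 := min_le_left (1 / 4 : ℝ) (c₀ / 4)
  have hmin2 := min_le_right (1 / 4 : ℝ) (c₀ / 4)
  have hd2 := sq_nonneg d
  have hrel : r ζ - r z = rEps r ε ζ - rEps r ε z := by unfold rEps; ring
  rw [hrel] at hT'
  have hA : min (1 / 4 : ℝ) (c₀ / 4) * (-rEps r ε ζ + -rEps r ε z)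
      ≤ 1 / 4 * (-rEps r ε ζ + -rEps r ε z) := by
    gcongr; linarith
  rw [mul_add]
  by_cases hS : -m ≤ r ζ
  · have h1 := hlevi ζ (hcl ζ hζ) hS (z - ζ)
    rw [← leviForm_congr (hfr ζ (hcl ζ hζ)), hnorm] at h1
    have h2 : C₁ * η * d ^ 2 ≤ c₀ / 2 * d ^ 2 := by
      gcongr; linarith
    have h3 : min (1 / 4 : ℝ) (c₀ / 4) * d ^ 2 ≤ c₀ / 4 * d ^ 2 := by gcongr
    linarith
  -- Outside the collar the Levi form may be negative, but r < -m and ε < m/2 give -r_ε(ζ) > m/2,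
  -- which absorbs every other term.
  · have h1 : m / 2 ≤ -rEps r ε ζ := by
      have := hε.2
      unfold rEps; linarith
    have h2 : (C₁ + C₂ + 1) * d ^ 2 ≤ m / 4 := by
      have : d ^ 2 ≤ η := by nlinarith
      have : (C₁ + C₂ + 1) * d ^ 2 ≤ (C₁ + C₂ + 1) * η := by gcongr
      linarith
    have h3 : min (1 / 4 : ℝ) (c₀ / 4) * d ^ 2 ≤ 1 / 4 * d ^ 2 := by gcongr
    have h4 := (abs_le.1 hLb).1
    have h5 : C₁ * η * d ^ 2 ≤ C₁ * d ^ 2 := by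
      have : C₁ * η ≤ C₁ := mul_le_of_le_one_right hC₁ hη1
      gcongr
    linarith

theorem exists_geometricBounds {n : ℕ} {D : Set (Cn n)} {r : Cn n → ℝ} (hD : IsMorseDomain D r)
    {g : Cn n → Matrix (Fin n) (Fin n) ℂ} (hg : IsLeviMetric D r g) {ρ : Cn n → Cn n → ℝ}
    (hρ : IsDistanceFunction g ρ) {κ : ℝ} (hκ : 0 < κ) {χ : Cn n → Cn n → ℝ}
    (hχ : IsPatching ρ κ χ) : ∃ ε₁ η C : ℝ, GeometricBounds D r g ρ χ ε₁ η C := by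
  obtain ⟨m, c, η₁, hm, hc, hη₁, hη₁1, hcrit, hre⟩ := exists_re_leviPoly_ge hD
  obtain ⟨c', η₂, hc', hη₂, hrho⟩ := exists_rho_bounds hD.isCompact_closure hg hρ hκ hχ
  obtain ⟨Cγ, hγ⟩ := exists_gam_bounds hD.isCompact_closure r
    (fun j k => (hg.smooth j k).continuous) hg.posDef
  obtain ⟨f, hf, hfc, hfr⟩ := hD.exists_extension
  obtain ⟨Cf, hCf, hf1, hf2⟩ := exists_bound_lipschitz (hf.of_le (by simp) : ContDiff ℝ 1 f) hfc
  obtain ⟨Cl, hCl, hl1, hl2, hl3, -⟩ := exists_leviPoly_bounds hf hfc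
  have hval : ∀ x ∈ closure D, f x = r x := fun x hx => (hfr x hx).eq_of_nhds
  have hcl : ∀ ε, ∀ w ∈ closure (DEps D r ε), w ∈ closure D := fun ε w hw =>
    closure_mono (fun x hx => hx.1) hw
  have hgr : ∀ x ∈ closure D, cgrad f x = cgrad r x := fun x hx => cgrad_congr (hfr x hx)
  -- The constant of `size_bounds_of_re_le` with 2 Cl for C: one Cl for the quadratic part of F, one
  -- for moving the base point of ∂r from ζ to z.
  obtain ⟨Cφ, hCφ⟩ : ∃ Cφ, Cφ = 1 + 2 * Cl + (2 + 2 * Cl) / c := ⟨_, rfl⟩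
  have hCφ0 : 0 ≤ Cφ := by rw [hCφ]; positivity
  obtain ⟨C, hC⟩ : ∃ C, C = 1 + Cf + Cl + |Cγ| + c'⁻¹ + 2 / m + Cφ := ⟨_, rfl⟩
  have i1 : 0 < c'⁻¹ := by positivity
  have i2 : 0 < 2 / m := by positivity
  have i3 := abs_nonneg Cγ
  have i4 := le_abs_self Cγ
  have l1 : 1 ≤ C := by linarith
  have l2 : Cf ≤ C := by linarith
  have l3 : Cl ≤ C := by linarith
  have l4 : Cγ ≤ C := by linarith
  have l5 : c'⁻¹ ≤ C := by linarith
  have l6 : 2 / m ≤ C := by linarith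
  have l7 : Cφ ≤ C := by linarith
  have hgam0 : ∀ ζ, 0 ≤ gam r g ζ := fun ζ => Real.sqrt_nonneg _
  have hφ : ∀ ε ∈ Ioo 0 (m / 2), ∀ ζ ∈ closure (DEps D r ε), ∀ z ∈ closure (DEps D r ε),
      ‖ζ - z‖ < min η₁ η₂ →
      (‖phi r ρ χ ε ζ z‖ ≤ Cφ * nonisotropic r ε ζ z ∧
        nonisotropic r ε ζ z ≤ Cφ * ‖phi r ρ χ ε ζ z‖) ∧
      (‖phi r ρ χ ε z ζ‖ ≤ Cφ * nonisotropic r ε ζ z ∧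
        nonisotropic r ε ζ z ≤ Cφ * ‖phi r ρ χ ε z ζ‖) := by
    intro ε hε ζ hζ z hz hd
    have hd1 := hd.trans_le (min_le_left _ _)
    have hd2 := hd.trans_le (min_le_right _ _)
    have hd1' := hd1
    have hd2' := hd2
    rw [norm_sub_rev] at hd1' hd2'
    have hζD := hcl ε ζ hζ
    have hzD := hcl ε z hz
    constructor
    · rw [phi_eq_of_chi_eq_one (hrho ζ hζD z hzD hd2).2, hCφ]
      refine size_bounds_of_re_le (s := inner ℂ (cgrad r z) (ζ - z))
        hc (by positivity) (hre ε hε ζ hζ z hz hd1) ?_ rfl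
      have h1 := hl3 ζ z
      have h2 := hl2 ζ z
      rw [leviPoly_congr (hfr ζ hζD), hgr ζ hζD] at h1
      rw [hgr ζ hζD, hgr z hzD] at h2
      have h3 : ‖(inner ℂ (cgrad r ζ - cgrad r z) (ζ - z) : ℂ)‖ ≤ Cl * ‖ζ - z‖ ^ 2 := by
        refine (norm_inner_le_norm _ _).trans ?_
        rw [pow_two, ← mul_assoc]
        gcongr
      calc ‖leviPoly r ζ z - inner ℂ (cgrad r z) (ζ - z)‖
          = ‖(leviPoly r ζ z - inner ℂ (cgrad r ζ) (ζ - z))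
              + inner ℂ (cgrad r ζ - cgrad r z) (ζ - z)‖ := by
            rw [inner_sub_left]; ring_nf
        _ ≤ Cl * ‖ζ - z‖ ^ 2 + Cl * ‖ζ - z‖ ^ 2 := (norm_add_le _ _).trans (add_le_add h1 h3)
        _ = _ := by ring
    · rw [phi_eq_of_chi_eq_one (hrho z hzD ζ hζD hd2').2, hCφ]
      have h0 := hre ε hε z hz ζ hζ hd1'
      have h1 := hl3 z ζ
      rw [leviPoly_congr (hfr z hzD), hgr z hzD] at h1
      have h4 : nonisotropic r ε ζ z = |rEps r ε z| + |rEps r ε ζ|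
          + ‖(inner ℂ (cgrad r z) (ζ - z) : ℂ)‖ + ‖z - ζ‖ ^ 2 := by
        unfold nonisotropic
        rw [norm_sub_rev ζ z]; ring
      rw [h4]
      refine size_bounds_of_re_le (s := inner ℂ (cgrad r z) (z - ζ))
        hc (by positivity) h0 (h1.trans ?_) ?_
      · gcongr; linarith
      · rw [← neg_sub ζ z, inner_neg_right, norm_neg]
  have hQ0 : ∀ ε ζ z, 0 ≤ nonisotropic r ε ζ z := fun ε ζ z => by
    unfold nonisotropic; positivity
  refine ⟨m / 2, min η₁ η₂, C, ?_, ?_, ?_, ?_, ?_, ?_, ?_, ?_, ?_, ?_, ?_, ?_⟩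
  · exact ⟨by positivity, lt_min hη₁ hη₂, (min_le_left _ _).trans hη₁1, l1⟩
  · exact fun ε hε ζ hζ => (hD.mem_of_mem_closure_DEps hε.1 hζ).2
  · intro ε hε ζ hζ
    have h := (hD.mem_of_mem_closure_DEps hε.1 hζ).2
    rw [abs_of_nonpos h]
    have h1 := hf1 ζ
    rw [hval ζ (hcl ε ζ hζ), Real.norm_eq_abs] at h1
    have h2 := (abs_le.1 h1).1
    have := hε.1
    unfold rEps
    linarith
  · intro ζ hζ
    rw [← hgr ζ hζ]
    exact (hl1 ζ).trans l3
  · intro ζ hζ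
    exact (hγ ζ hζ).1.trans (by gcongr)
  · intro ζ hζ
    exact (hγ ζ hζ).2.trans (mul_le_mul_of_nonneg_right l4 (hgam0 ζ))
  · intro ε hε ζ hζ h0
    have h1 := (hγ ζ (hcl ε ζ hζ)).2
    rw [h0, mul_zero, norm_le_zero_iff] at h1
    have h2 := hcrit ζ (hD.mem_of_mem_closure_DEps hε.1 hζ).1 h1
    have h3 : m / 2 ≤ |rEps r ε ζ| := by
      refine le_trans ?_ (neg_le_abs _)
      have := hε.2
      unfold rEps; linarith
    calc (1 : ℝ) = 2 / m * (m / 2) := by field_simp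
      _ ≤ C * |rEps r ε ζ| := by gcongr
  · intro ζ hζ z hz
    rw [← hval ζ hζ, ← hval z hz]
    exact (hf2 ζ z).trans (by gcongr)
  · intro ζ hζ z hz
    rw [← hgr ζ hζ, ← hgr z hz]
    exact (hl2 ζ z).trans (by gcongr)
  · intro ζ hζ z hz hd
    have h := (hrho ζ hζ z hz (hd.trans_le (min_le_right _ _))).1
    calc ‖ζ - z‖ ^ 2 = c'⁻¹ * (c' * ‖ζ - z‖ ^ 2) := by field_simp
      _ ≤ c'⁻¹ * ρ ζ z ^ 2 := by gcongr
      _ ≤ _ := by gcongr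
  · intro ε hε ζ hζ z hz hd
    obtain ⟨⟨h1, -⟩, ⟨h2, -⟩⟩ := hφ ε hε ζ hζ z hz hd
    exact ⟨h1.trans (mul_le_mul_of_nonneg_right l7 (hQ0 _ _ _)),
      h2.trans (mul_le_mul_of_nonneg_right l7 (hQ0 _ _ _))⟩
  · intro ε hε ζ hζ z hz hd
    obtain ⟨⟨-, h1⟩, ⟨-, h2⟩⟩ := hφ ε hε ζ hζ z hz hd
    exact ⟨h1.trans (by gcongr), h2.trans (by gcongr)⟩

/-! ### Norms of double forms -/

theorem norm_wedgeSign {m : ℕ} (S T : Finset (Fin m)) : ‖wedgeSign S T‖ = 1 := by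
  simp [wedgeSign]

theorem norm_conjSign {n : ℕ} (S : Finset (Fin (n + n))) : ‖conjSign S‖ = 1 := by
  simp [conjSign]

theorem norm_wedge_le {n : ℕ} (a b : DoubleForm n) :
    ‖wedge a b‖ ≤ (2 ^ (n + n) * 2 ^ (n + n) : ℝ) * (‖a‖ * ‖b‖) := by
  refine (pi_norm_le_iff_of_nonneg (by positivity)).2 fun p => ?_
  have hterm : ∀ S T, ‖wedgeSign S (p.1 \ S) * wedgeSign T (p.2 \ T)
      * (a (S, T) * b (p.1 \ S, p.2 \ T))‖ ≤ ‖a‖ * ‖b‖ := by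
    intro S T
    rw [norm_mul, norm_mul, norm_wedgeSign, norm_wedgeSign, one_mul, one_mul, norm_mul]
    exact mul_le_mul (norm_le_pi_norm _ _) (norm_le_pi_norm _ _) (norm_nonneg _) (norm_nonneg _)
  have hcard : ∀ S : Finset (Fin (n + n)), (S.powerset.card : ℝ) ≤ 2 ^ (n + n) := by
    intro S
    rw [Finset.card_powerset]
    push_cast
    refine pow_le_pow_right₀ one_le_two ?_
    simpa using S.card_le_univ
  unfold wedge
  refine (norm_sum_le_of_le (f := _) _ (n := fun _ => (2 ^ (n + n) : ℝ) * (‖a‖ * ‖b‖))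
    fun S _ => ?_).trans ?_
  · refine (norm_sum_le_of_le _ fun T _ => hterm S T).trans ?_
    rw [Finset.sum_const, nsmul_eq_mul]
    exact mul_le_mul_of_nonneg_right (hcard _) (by positivity)
  · rw [Finset.sum_const, nsmul_eq_mul, mul_assoc]
    exact mul_le_mul_of_nonneg_right (hcard _) (by positivity)

theorem norm_swapForm_le {n : ℕ} (a : DoubleForm n) : ‖swapForm a‖ ≤ ‖a‖ :=
  (pi_norm_le_iff_of_nonneg (norm_nonneg _)).2 fun p => norm_le_pi_norm a (p.2, p.1)

theorem conjIndex_conjIndex {n : ℕ} (S : Finset (Fin (n + n))) : conjIndex (conjIndex S) = S := by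
  unfold conjIndex
  rw [Finset.map_map]
  ext i
  simp [finAddFlip]

/-- Needed because the local representation may hold for the conjugate of the kernel only. -/
theorem norm_le_norm_conjForm {n : ℕ} (a : DoubleForm n) : ‖a‖ ≤ ‖conjForm a‖ := by
  refine (pi_norm_le_iff_of_nonneg (norm_nonneg _)).2 fun p => ?_
  have h := norm_le_pi_norm (conjForm a) (conjIndex p.1, conjIndex p.2)
  simp only [conjForm, conjIndex_conjIndex, norm_mul, norm_conjSign, one_mul,
    RCLike.norm_conj] at h
  exact h

/-! ### Products of derivatives -/

theorem exists_norm_eval_le {σ : Type*} {N : ℕ} {Q : MvPolynomial σ ℂ} (hQ : Q.IsHomogeneous N) :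
    ∃ C : ℝ, 0 ≤ C ∧ ∀ (x : σ → ℂ) (s : ℝ), (∀ i, ‖x i‖ ≤ s) →
      ‖MvPolynomial.eval x Q‖ ≤ C * s ^ N := by
  refine ⟨∑ d ∈ Q.support, ‖Q.coeff d‖, Finset.sum_nonneg fun _ _ => norm_nonneg _,
    fun x s hs => ?_⟩
  rw [MvPolynomial.eval_eq, Finset.sum_mul]
  refine norm_sum_le_of_le _ fun d hd => ?_
  rw [norm_mul, norm_prod]
  refine mul_le_mul_of_nonneg_left ?_ (norm_nonneg _)
  have hdeg : ∑ i ∈ d.support, d i = N := by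
    have h := hQ (MvPolynomial.mem_support_iff.1 hd)
    rw [← h]
    exact DFunLike.congr_fun (Finsupp.degree_eq_weight_one (σ := σ) (R := ℕ)) d
  rw [← hdeg, ← Finset.prod_pow_eq_pow_sum]
  refine Finset.prod_le_prod (fun i _ => norm_nonneg _) fun i _ => ?_
  rw [norm_pow]
  exact pow_le_pow_left₀ (norm_nonneg _) (hs i) _

theorem IsDerivProduct.exists_norm_le {n : ℕ} {r : Cn n → ℝ} {N : ℕ} {R : Cn n → ℂ}
    (hR : IsDerivProduct r N R) :
    ∃ C : ℝ, 0 ≤ C ∧ ∀ ζ, DifferentiableAt ℝ r ζ → ‖R ζ‖ ≤ C * ‖cgrad r ζ‖ ^ N := by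
  obtain ⟨Q, hQ, hRQ⟩ := hR
  obtain ⟨C, hC, h⟩ := exists_norm_eval_le hQ
  refine ⟨C, hC, fun ζ hζ => ?_⟩
  rw [hRQ]
  have hj : ∀ j, ‖dz j (toC r) ζ‖ ≤ ‖cgrad r ζ‖ := fun j => by
    have := PiLp.norm_apply_le (cgrad r ζ) j
    simpa [cgrad] using this
  refine h _ _ ?_
  rintro (j | j)
  · exact hj j
  · simp only [Sum.elim_inr, dzbar_toC j hζ, RCLike.norm_conj]
    exact hj j

/-- The weight `|∂r| + |r_ε|`. -/
def weight {n : ℕ} (r : Cn n → ℝ) (ε : ℝ) (ζ : Cn n) : ℝ := ‖cgrad r ζ‖ + |rEps r ε ζ|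

theorem weight_nonneg {n : ℕ} (r : Cn n → ℝ) (ε : ℝ) (ζ : Cn n) : 0 ≤ weight r ε ζ := by
  unfold weight; positivity

theorem IsMorseDomain.differentiableAt {n : ℕ} {D : Set (Cn n)} {r : Cn n → ℝ}
    (hD : IsMorseDomain D r) {ζ : Cn n} (hζ : ζ ∈ closure D) : DifferentiableAt ℝ r ζ := by
  obtain ⟨W, hW, hDW, hr, -, -⟩ := hD.defining
  exact (hr.contDiffAt (hW.mem_nhds (hDW hζ))).differentiableAt (by simp)

/-- Where γ ≠ 0, the bounds |R| = O(γ^N) and |ξ| = O(γ^α) multiply to γ^(N+α), although α may be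
negative. At a critical point inside D this says nothing about ξ, but there ξ is bounded by
compactness and |r_ε| is bounded below; this is why the weight contains |r_ε|. -/
theorem exists_derivProduct_mul_xi_le {n : ℕ} {D : Set (Cn n)} {r : Cn n → ℝ}
    (hD : IsMorseDomain D r) {g : Cn n → Matrix (Fin n) (Fin n) ℂ} {ρ χ : Cn n → Cn n → ℝ}
    {ε₁ η C : ℝ} (hG : GeometricBounds D r g ρ χ ε₁ η C) {N : ℕ} {R : Cn n → ℂ}
    (hR : IsDerivProduct r N R) {α : ℤ} {ξ : Cn n → ℝ} (hξ : IsXi D r g α ξ)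
    (hα : 0 ≤ (N : ℤ) + α) :
    ∃ B : ℝ, 0 ≤ B ∧ ∀ ε ∈ Ioo 0 ε₁, ∀ ζ ∈ closure (DEps D r ε),
      ‖R ζ‖ * |ξ ζ| ≤ B * weight r ε ζ ^ ((N : ℤ) + α).toNat := by
  obtain ⟨C₁, hC₁, h1⟩ := hR.exists_norm_le
  obtain ⟨C₂, h2⟩ := hξ.2 0
  obtain ⟨m, -, -, -, -, hcrit, hKc, hKD⟩ := hD.exists_collar
  obtain ⟨C₃, h3⟩ := hKc.exists_bound_of_continuousOn (hξ.1.continuousOn.mono hKD)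
  obtain ⟨-, -, -, hC1⟩ := hG.pos
  have hC0 : 0 ≤ C := zero_le_one.trans hC1
  obtain ⟨a, ha⟩ := Int.eq_ofNat_of_zero_le hα
  rw [ha, Int.toNat_natCast]
  refine ⟨C₁ * C ^ N * |C₂| * C ^ a + C₁ * C ^ N * |C₃| * C ^ a, by positivity,
    fun ε hε ζ hζ => ?_⟩
  have hζD := (hD.mem_of_mem_closure_DEps hε.1 hζ).1
  have hζcl := subset_closure hζD
  have hR1 := h1 ζ (hD.differentiableAt hζcl)
  have hw := weight_nonneg r ε ζ
  rw [add_mul]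
  by_cases h0 : gam r g ζ = 0
  · have hc0 : cgrad r ζ = 0 := by
      have := hG.le_gam ζ hζcl
      rw [h0, mul_zero] at this
      exact norm_le_zero_iff.1 this
    have hξb : |ξ ζ| ≤ |C₃| := (h3 ζ ⟨hζcl, hcrit ζ hζD hc0⟩).trans (le_abs_self _)
    have h4 : 1 ≤ C * weight r ε ζ := by
      refine (hG.critical ε hε ζ hζ h0).trans ?_
      unfold weight
      gcongr
      linarith [norm_nonneg (cgrad r ζ)]
    have h5 : ‖R ζ‖ ≤ C₁ * C ^ N :=
      hR1.trans (by gcongr; exact hG.norm_cgrad_le ζ hζcl)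
    calc ‖R ζ‖ * |ξ ζ| ≤ C₁ * C ^ N * |C₃| := by
          exact mul_le_mul h5 hξb (abs_nonneg _) (by positivity)
      _ ≤ C₁ * C ^ N * |C₃| * (C * weight r ε ζ) ^ a :=
          le_mul_of_one_le_right (by positivity) (one_le_pow₀ h4)
      _ = C₁ * C ^ N * |C₃| * C ^ a * weight r ε ζ ^ a := by rw [mul_pow]; ring
      _ ≤ _ := le_add_of_nonneg_left (by positivity)
  · have hg0 : 0 < gam r g ζ := lt_of_le_of_ne (Real.sqrt_nonneg _) (Ne.symm h0)
    have h4 := h2 ζ hζD h0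
    rw [pow_zero, one_mul, norm_iteratedFDeriv_zero, Real.norm_eq_abs] at h4
    have h5 : ‖R ζ‖ ≤ C₁ * C ^ N * gam r g ζ ^ N := by
      rw [mul_assoc, ← mul_pow]
      refine hR1.trans ?_
      gcongr
      exact hG.le_gam ζ hζcl
    have h6 : |ξ ζ| ≤ |C₂| * gam r g ζ ^ α :=
      h4.trans (by gcongr; exact le_abs_self _)
    have h7 : gam r g ζ ≤ C * weight r ε ζ := by
      refine (hG.gam_le ζ hζcl).trans ?_
      unfold weight
      gcongr
      linarith [abs_nonneg (rEps r ε ζ)]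
    calc ‖R ζ‖ * |ξ ζ| ≤ (C₁ * C ^ N * gam r g ζ ^ N) * (|C₂| * gam r g ζ ^ α) := by gcongr
      _ = C₁ * C ^ N * |C₂| * (gam r g ζ ^ (N : ℤ) * gam r g ζ ^ α) := by
          rw [zpow_natCast]; ring
      _ = C₁ * C ^ N * |C₂| * gam r g ζ ^ a := by
          rw [← zpow_add₀ hg0.ne', ha, zpow_natCast]
      _ ≤ C₁ * C ^ N * |C₂| * (C * weight r ε ζ) ^ a := by gcongr
      _ = C₁ * C ^ N * |C₂| * C ^ a * weight r ε ζ ^ a := by rw [mul_pow]; ring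
      _ ≤ _ := le_add_of_nonneg_right (by positivity)

/-! ### Real inequalities -/

theorem zpow_le_of_comparable {x Q C : ℝ} (hx : 0 < x) (hQ : 0 < Q) (hC : 1 ≤ C)
    (h1 : x ≤ C * Q) (h2 : Q ≤ C * x) (t : ℤ) : x ^ t ≤ C ^ t.natAbs * Q ^ t := by
  have hC0 : 0 < C := zero_lt_one.trans_le hC
  obtain ⟨k, rfl | rfl⟩ := t.eq_nat_or_neg
  · simp only [Int.natAbs_natCast, zpow_natCast]
    rw [← mul_pow]
    exact pow_le_pow_left₀ hx.le h1 k
  · simp only [Int.natAbs_neg, Int.natAbs_natCast, zpow_neg, zpow_natCast]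
    rw [← div_eq_mul_inv, inv_le_comm₀ (by positivity) (by positivity), inv_div,
      div_le_iff₀ (by positivity), ← mul_pow, mul_comm x]
    exact pow_le_pow_left₀ hQ.le h2 k

/-- Here p stands for 1/P_ε and S for |r_ε(ζ)| + |r_ε(z)| + d. Since Q is O(S) and p is O(S⁻²), each
factor Q cancels half a factor p, and the surplus of p is turned into powers of d by d ≤ S. -/
theorem rpow_bound_of_nonneg_exponent {a b j t₀ k : ℕ} {lam C : ℝ} (hlam : 1 ≤ lam) (hC : 1 ≤ C) :
    ∃ B : ℝ, 0 ≤ B ∧ ∀ K G₁ G₂ p Q S d : ℝ, 0 ≤ K → 0 ≤ G₁ → 0 ≤ G₂ → 0 ≤ p → 0 ≤ Q → 0 < d →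
      d ≤ S → S ≤ C → G₁ ≤ C → G₂ ≤ C → p * S ^ 2 ≤ C → Q ≤ C * S →
      K ≤ C * (G₁ ^ a * G₂ ^ b) * p ^ t₀ * d ^ j * Q ^ k →
      K ^ lam ≤ B * d ^ (-(lam * ((2 * t₀ - k : ℕ) - j : ℝ))) := by
  have hC0 : 0 < C := zero_lt_one.trans_le hC
  refine ⟨(C * (C ^ a * C ^ b) * C ^ t₀ * C ^ k * C ^ k) ^ lam, by positivity, ?_⟩
  intro K G₁ G₂ p Q S d hK hG₁ hG₂ hp hQ hd hdS hSC hG₁C hG₂C hpS hQS hKle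
  have hS : 0 < S := hd.trans_le hdS
  have h1 : p ^ t₀ * S ^ (2 * t₀) ≤ C ^ t₀ := by
    rw [pow_mul, ← mul_pow]
    exact pow_le_pow_left₀ (by positivity) hpS _
  have h2 : p ^ t₀ * S ^ k * d ^ (2 * t₀ - k) ≤ C ^ t₀ * C ^ k := by
    rcases le_total k (2 * t₀) with h | h
    · calc p ^ t₀ * S ^ k * d ^ (2 * t₀ - k) ≤ p ^ t₀ * S ^ k * S ^ (2 * t₀ - k) := by gcongr
        _ = p ^ t₀ * S ^ (2 * t₀) := by
          rw [mul_assoc, ← pow_add, Nat.add_sub_cancel' h]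
        _ ≤ C ^ t₀ := h1
        _ ≤ C ^ t₀ * C ^ k := le_mul_of_one_le_right (by positivity) (one_le_pow₀ hC)
    · rw [Nat.sub_eq_zero_of_le h, pow_zero, mul_one]
      calc p ^ t₀ * S ^ k = (p ^ t₀ * S ^ (2 * t₀)) * S ^ (k - 2 * t₀) := by
            rw [mul_assoc, ← pow_add, Nat.add_sub_cancel' h]
        _ ≤ C ^ t₀ * C ^ (k - 2 * t₀) := by gcongr
        _ ≤ C ^ t₀ * C ^ k := by
            gcongr
            exact Nat.sub_le _ _
  have h3 : K ≤ (C * (C ^ a * C ^ b) * C ^ t₀ * C ^ k * C ^ k) * d ^ ((j : ℝ) - (2 * t₀ - k : ℕ)) := by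
    rw [Real.rpow_sub hd, Real.rpow_natCast, Real.rpow_natCast, ← mul_div_assoc,
      le_div_iff₀ (by positivity)]
    calc K * d ^ (2 * t₀ - k)
        ≤ C * (C ^ a * C ^ b) * p ^ t₀ * d ^ j * (C * S) ^ k * d ^ (2 * t₀ - k) := by
          gcongr
          refine hKle.trans ?_
          gcongr
      _ = C * (C ^ a * C ^ b) * d ^ j * C ^ k * (p ^ t₀ * S ^ k * d ^ (2 * t₀ - k)) := by
          rw [mul_pow]; ring
      _ ≤ C * (C ^ a * C ^ b) * d ^ j * C ^ k * (C ^ t₀ * C ^ k) := by gcongr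
      _ = _ := by ring
  calc K ^ lam ≤ _ := Real.rpow_le_rpow hK h3 (by linarith)
    _ = _ := by
      rw [Real.mul_rpow (by positivity) (by positivity), ← Real.rpow_mul hd.le]
      congr 2
      ring

/-- Here p stands for 1/P_ε, G₁ and G₂ for the weights, H for the weight at the base point plus d,
and x for the coordinate in the direction of ∂r. The parameter β is the part of the singularity
assigned to x. -/
theorem rpow_bound_of_neg_exponent {a b j t₀ t : ℕ} {lam C β : ℝ} (hlam : 1 ≤ lam) (hC : 1 ≤ C)
    (hβ0 : 0 ≤ β) (hβ2 : β ≤ 2 * lam) (hβt : β ≤ lam * t) :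
    ∃ B : ℝ, 0 ≤ B ∧ ∀ K G₁ G₂ p Q H d x : ℝ, 0 ≤ K → 0 ≤ G₁ → 0 ≤ G₂ → 0 ≤ p → 0 < Q → 0 < x →
      0 < d → d ≤ H → H ≤ C → G₁ ≤ C * H → G₂ ≤ C * H → p * d ^ 2 ≤ C →
      H * x + d ^ 2 ≤ C * Q →
      K ≤ C * (G₁ ^ a * G₂ ^ b) * p ^ t₀ * d ^ j * (Q ^ t)⁻¹ →
      K ^ lam ≤ B * (x ^ (-β)
        * d ^ (-(lam * ((2 - (a + b) : ℕ) + 2 * t₀ + 2 * t - j : ℝ) - 2 * β))) := by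
  have hC0 : 0 < C := zero_lt_one.trans_le hC
  refine ⟨(C * (C ^ a * C ^ b) * C ^ (a + b) * C ^ t₀ * C ^ t) ^ lam * C ^ (2 * lam - β),
    by positivity, ?_⟩
  intro K G₁ G₂ p Q H d x hK hG₁ hG₂ hp hQ hx hd hdH hHC hG₁H hG₂H hpd hHQ hKle
  have hH : 0 < H := hd.trans_le hdH
  obtain ⟨E, hE⟩ : ∃ E, E = H * x + d ^ 2 := ⟨_, rfl⟩
  have hE0 : 0 < E := by rw [hE]; positivity
  -- Exactly two factors H are kept: missing ones are paid for by d ≤ H, excess ones are bounded.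
  have hw : H ^ (a + b) * d ^ (2 - (a + b)) ≤ C ^ (a + b) * H ^ 2 := by
    rcases le_total (a + b) 2 with h | h
    · calc H ^ (a + b) * d ^ (2 - (a + b)) ≤ H ^ (a + b) * H ^ (2 - (a + b)) := by gcongr
        _ = H ^ 2 := by rw [← pow_add, Nat.add_sub_cancel' h]
        _ ≤ _ := le_mul_of_one_le_left (by positivity) (one_le_pow₀ hC)
    · rw [Nat.sub_eq_zero_of_le h, pow_zero, mul_one]
      calc H ^ (a + b) = H ^ (a + b - 2) * H ^ 2 := by rw [← pow_add, Nat.sub_add_cancel h]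
        _ ≤ C ^ (a + b - 2) * H ^ 2 := by gcongr
        _ ≤ _ := by
          gcongr
          exact Nat.sub_le _ _
  have hpt : p ^ t₀ * d ^ (2 * t₀) ≤ C ^ t₀ := by
    rw [pow_mul, ← mul_pow]
    exact pow_le_pow_left₀ (by positivity) hpd _
  have hQt : (Q ^ t)⁻¹ ≤ C ^ t * (E ^ t)⁻¹ := by
    rw [← div_eq_mul_inv, inv_le_comm₀ (by positivity) (by positivity), inv_div,
      div_le_iff₀ (by positivity), ← mul_pow, mul_comm Q]
    exact pow_le_pow_left₀ hE0.le (hE ▸ hHQ) t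
  have h3 : K ≤ (C * (C ^ a * C ^ b) * C ^ (a + b) * C ^ t₀ * C ^ t)
      * (H ^ (2 : ℝ) * d ^ ((j : ℝ) - ((2 - (a + b) : ℕ) + 2 * t₀)) * E ^ (-(t : ℝ))) := by
    rw [Real.rpow_neg hE0.le, Real.rpow_natCast, Real.rpow_sub hd, Real.rpow_natCast,
      Real.rpow_add hd, Real.rpow_natCast, show (2 * (t₀ : ℝ)) = ((2 * t₀ : ℕ) : ℝ) by push_cast; rfl,
      Real.rpow_natCast, Real.rpow_two]
    have hdd : 0 < d ^ (2 - (a + b)) * d ^ (2 * t₀) := by positivity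
    calc K = K * (d ^ (2 - (a + b)) * d ^ (2 * t₀)) / (d ^ (2 - (a + b)) * d ^ (2 * t₀)) := by
          field_simp
      _ ≤ (C * (C ^ a * C ^ b) * C ^ (a + b) * C ^ t₀ * C ^ t) * H ^ 2 * d ^ j * (E ^ t)⁻¹
            / (d ^ (2 - (a + b)) * d ^ (2 * t₀)) := by
          gcongr ?_ / _
          calc K * (d ^ (2 - (a + b)) * d ^ (2 * t₀))
              ≤ C * ((C * H) ^ a * (C * H) ^ b) * p ^ t₀ * d ^ j * (C ^ t * (E ^ t)⁻¹)
                  * (d ^ (2 - (a + b)) * d ^ (2 * t₀)) := by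
                gcongr
                refine hKle.trans ?_
                gcongr
            _ = C * (C ^ a * C ^ b) * d ^ j * (C ^ t * (E ^ t)⁻¹)
                  * (H ^ (a + b) * d ^ (2 - (a + b))) * (p ^ t₀ * d ^ (2 * t₀)) := by
                rw [mul_pow, mul_pow, pow_add H]; ring
            _ ≤ C * (C ^ a * C ^ b) * d ^ j * (C ^ t * (E ^ t)⁻¹)
                  * (C ^ (a + b) * H ^ 2) * C ^ t₀ := by gcongr
            _ = _ := by ring
      _ = _ := by ring
  -- Of the total exponent λt, the share β is estimated by E ≥ H x and the rest by E ≥ d².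
  have hElow : E ^ (-(t : ℝ) * lam) ≤ (H * x) ^ (-β) * d ^ (-(2 * (lam * t - β))) := by
    have e : -(t : ℝ) * lam = -β + -(lam * t - β) := by ring
    rw [e, Real.rpow_add hE0]
    have h5 : d ^ (-(2 * (lam * t - β))) = (d ^ 2) ^ (-(lam * t - β)) := by
      rw [← Real.rpow_two, ← Real.rpow_mul hd.le]; congr 1; ring
    rw [h5]
    refine mul_le_mul ?_ ?_ (by positivity) (by positivity)
    · refine Real.rpow_le_rpow_of_nonpos (by positivity) ?_ (by linarith)
      rw [hE]; linarith [sq_nonneg d]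
    · refine Real.rpow_le_rpow_of_nonpos (by positivity) ?_ (by linarith)
      rw [hE]
      have : 0 ≤ H * x := by positivity
      linarith
  -- The two factors H saved above compensate the H^(-β) coming from H x; this is where β ≤ 2λ is
  -- used.
  have hHlow : H ^ (2 * lam) * H ^ (-β) ≤ C ^ (2 * lam - β) := by
    rw [← Real.rpow_add hH]
    exact Real.rpow_le_rpow hH.le hHC (by linarith)
  obtain ⟨A, hA⟩ : ∃ A, A = C * (C ^ a * C ^ b) * C ^ (a + b) * C ^ t₀ * C ^ t := ⟨_, rfl⟩
  have hA0 : 0 ≤ A := by rw [hA]; positivity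
  rw [← hA] at h3 ⊢
  have h4 := Real.rpow_le_rpow hK h3 (by linarith : (0 : ℝ) ≤ lam)
  rw [Real.mul_rpow hA0 (by positivity), Real.mul_rpow (by positivity) (by positivity),
    Real.mul_rpow (by positivity) (by positivity), ← Real.rpow_mul hH.le, ← Real.rpow_mul hd.le,
    ← Real.rpow_mul hE0.le] at h4
  refine h4.trans ?_
  rw [mul_assoc (A ^ lam) (C ^ (2 * lam - β))]
  refine mul_le_mul_of_nonneg_left ?_ (Real.rpow_nonneg hA0 _)
  obtain ⟨μ, hμ⟩ : ∃ μ : ℝ, μ = ((j : ℝ) - ((2 - (a + b) : ℕ) + 2 * t₀)) * lam := ⟨_, rfl⟩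
  rw [← hμ]
  calc H ^ (2 * lam) * d ^ μ * E ^ (-(t : ℝ) * lam)
      ≤ H ^ (2 * lam) * d ^ μ * ((H * x) ^ (-β) * d ^ (-(2 * (lam * t - β)))) := by gcongr
    _ = (H ^ (2 * lam) * H ^ (-β)) * (x ^ (-β) * (d ^ μ * d ^ (-(2 * (lam * t - β))))) := by
        rw [Real.mul_rpow hH.le hx.le]; ring
    _ ≤ C ^ (2 * lam - β) * (x ^ (-β) * (d ^ μ * d ^ (-(2 * (lam * t - β))))) := by gcongr
    _ = _ := by
        rw [← Real.rpow_add hd, hμ]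
        congr 3
        ring

/-! ### Pointwise estimates of admissible kernels -/

theorem mem_closure_of_mem_closure_DEps {n : ℕ} {D : Set (Cn n)} {r : Cn n → ℝ} {ε : ℝ} {ζ : Cn n}
    (h : ζ ∈ closure (DEps D r ε)) : ζ ∈ closure D :=
  closure_mono (fun _ hx => hx.1) h

theorem nonisotropic_nonneg {n : ℕ} (r : Cn n → ℝ) (ε : ℝ) (ζ z : Cn n) :
    0 ≤ nonisotropic r ε ζ z := by
  unfold nonisotropic; positivity

theorem nonisotropic_pos {n : ℕ} (r : Cn n → ℝ) (ε : ℝ) {ζ z : Cn n} (h : ζ ≠ z) :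
    0 < nonisotropic r ε ζ z := by
  have : 0 < ‖ζ - z‖ := norm_pos_iff.2 (sub_ne_zero.2 h)
  unfold nonisotropic
  positivity

section

variable {n : ℕ} {D : Set (Cn n)} {r : Cn n → ℝ} {g : Cn n → Matrix (Fin n) (Fin n) ℂ}
  {ρ χ : Cn n → Cn n → ℝ} {ε₁ η C : ℝ}

/-- Because |r(ζ) - r(z)| = O(d), the square of |r_ε(ζ)| + |r_ε(z)| is O(d² + r_ε(ζ) r_ε(z)).
Multiplied by γ(ζ) γ(z), which is bounded, this is dominated by the denominator of 1/P_ε. -/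
theorem GeometricBounds.invP_bounds (hG : GeometricBounds D r g ρ χ ε₁ η C) :
    ∃ B : ℝ, 0 ≤ B ∧ ∀ ε ∈ Ioo 0 ε₁, ∀ ζ ∈ closure (DEps D r ε), ∀ z ∈ closure (DEps D r ε),
      ‖ζ - z‖ < η → 0 ≤ invP r g ρ ε ζ z ∧
        invP r g ρ ε ζ z * (|rEps r ε ζ| + |rEps r ε z| + ‖ζ - z‖) ^ 2 ≤ B := by
  obtain ⟨-, -, -, hC1⟩ := hG.pos
  have hC0 : 0 < C := zero_lt_one.trans_le hC1
  refine ⟨2 * (C ^ 2 * C + C) + 4 * (C * C * (C * C)), by positivity,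
    fun ε hε ζ hζ z hz hd => ?_⟩
  have hζD := mem_closure_of_mem_closure_DEps hζ
  have hzD := mem_closure_of_mem_closure_DEps hz
  have h1 := hG.rEps_nonpos ε hε ζ hζ
  have h2 := hG.rEps_nonpos ε hε z hz
  have hrr : 0 ≤ rEps r ε ζ * rEps r ε z := mul_nonneg_of_nonpos_of_nonpos h1 h2
  have hγ1 : 0 ≤ gam r g ζ := Real.sqrt_nonneg _
  have hγ2 : 0 ≤ gam r g z := Real.sqrt_nonneg _
  have hγC : ∀ w ∈ closure D, gam r g w ≤ C * C := fun w hw =>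
    (hG.gam_le w hw).trans (by gcongr; exact hG.norm_cgrad_le w hw)
  obtain ⟨P, hP⟩ : ∃ P, P = gam r g ζ * gam r g z := ⟨_, rfl⟩
  have hP0 : 0 ≤ P := by rw [hP]; positivity
  have hPC : P ≤ C * C * (C * C) := by
    rw [hP]
    exact mul_le_mul (hγC ζ hζD) (hγC z hzD) hγ2 (by positivity)
  have hrho := hG.le_rho ζ hζD z hzD hd
  have hsub := hG.sub_le ζ hζD z hzD
  obtain ⟨X, hX⟩ : ∃ X, X = P * ρ ζ z ^ 2 + 2 * rEps r ε ζ * rEps r ε z := ⟨_, rfl⟩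
  have hPρ : 0 ≤ P * ρ ζ z ^ 2 := by positivity
  have hX0 : 0 ≤ X := by rw [hX]; linarith
  have hinv : invP r g ρ ε ζ z = P / X := by rw [hX, hP]; rfl
  rw [hinv]
  refine ⟨by positivity, ?_⟩
  have hA : (|rEps r ε ζ| + |rEps r ε z|) ^ 2
      ≤ C ^ 2 * ‖ζ - z‖ ^ 2 + 4 * (rEps r ε ζ * rEps r ε z) := by
    have h3 : (rEps r ε ζ - rEps r ε z) ^ 2 ≤ (C * ‖ζ - z‖) ^ 2 := by
      have : rEps r ε ζ - rEps r ε z = r ζ - r z := by unfold rEps; ring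
      rw [this, ← sq_abs]
      exact pow_le_pow_left₀ (abs_nonneg _) hsub 2
    rw [abs_of_nonpos h1, abs_of_nonpos h2]
    rw [mul_pow] at h3
    linarith
  have hS : (|rEps r ε ζ| + |rEps r ε z| + ‖ζ - z‖) ^ 2
      ≤ 2 * (C ^ 2 * C + C) * ρ ζ z ^ 2 + 8 * (rEps r ε ζ * rEps r ε z) := by
    have h4 : C ^ 2 * ‖ζ - z‖ ^ 2 ≤ C ^ 2 * (C * ρ ζ z ^ 2) := by gcongr
    linarith [sq_nonneg (|rEps r ε ζ| + |rEps r ε z| - ‖ζ - z‖)]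
  -- If the denominator vanishes, the quotient has the value 0 by convention.
  rcases hX0.eq_or_lt with h0 | h0
  · rw [← h0, div_zero, zero_mul]; positivity
  rw [div_mul_eq_mul_div, div_le_iff₀ h0]
  calc P * (|rEps r ε ζ| + |rEps r ε z| + ‖ζ - z‖) ^ 2
      ≤ P * (2 * (C ^ 2 * C + C) * ρ ζ z ^ 2 + 8 * (rEps r ε ζ * rEps r ε z)) := by gcongr
    _ = 2 * (C ^ 2 * C + C) * (P * ρ ζ z ^ 2) + 8 * (P * (rEps r ε ζ * rEps r ε z)) := by ring
    _ ≤ 2 * (C ^ 2 * C + C) * (P * ρ ζ z ^ 2)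
          + 8 * (C * C * (C * C) * (rEps r ε ζ * rEps r ε z)) := by gcongr
    _ ≤ 2 * (C ^ 2 * C + C) * (P * ρ ζ z ^ 2)
          + 8 * (C * C * (C * C) * (rEps r ε ζ * rEps r ε z))
          + (2 * (C ^ 2 * C + C) * (2 * (rEps r ε ζ * rEps r ε z))
            + 4 * (C * C * (C * C)) * (P * ρ ζ z ^ 2)) := le_add_of_nonneg_right (by positivity)
    _ = _ := by rw [hX]; ring

theorem norm_kernelTerm (e : Exponents) (R R' : Cn n → ℂ) (a b : Cn n → Cn n → DoubleForm n)
    (ε : ℝ) (ζ z : Cn n) :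
    ‖kernelTerm r g ρ χ e R R' a b ε ζ z‖ = ‖R ζ‖ * ‖R' z‖ * |invP r g ρ ε ζ z| ^ e.t0
      * ‖phi r ρ χ ε ζ z‖ ^ e.t1 * ‖phi r ρ χ ε ζ z‖ ^ e.t2
      * ‖phi r ρ χ ε z ζ‖ ^ e.t3 * ‖phi r ρ χ ε z ζ‖ ^ e.t4
      * |rEps r ε ζ| ^ e.l * |rEps r ε z| ^ e.m * ‖wedge (a ζ z) (swapForm (b z ζ))‖ := by
  unfold kernelTerm
  rw [norm_smul]
  simp only [norm_mul, norm_pow, norm_zpow, RCLike.norm_conj, Complex.norm_real, Real.norm_eq_abs]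

/-- All four powers of φ_ε, its conjugate and their transposes become powers of Q, whatever their
signs, and the factors r_ε are at most Q. Each R is paired with the ξ at the same point. The power
d^k is dropped, in accordance with the type, which does not involve k. -/
theorem exists_kernelTerm_le (hD : IsMorseDomain D r) (hG : GeometricBounds D r g ρ χ ε₁ η C)
    {ε₀ : ℝ} (hε₀ : ε₀ ≤ ε₁) {U : Set (Cn n)} {e : Exponents} (he : e.Valid) {R R' : Cn n → ℂ}
    (hR : IsDerivProduct r e.N R) (hR' : IsDerivProduct r e.M R')
    {a b : ℝ → Cn n → Cn n → DoubleForm n} (ha : IsScriptE D r g ε₀ U e.j e.α a)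
    (hb : IsScriptE D r g ε₀ U e.k e.β b) :
    ∃ B : ℝ, 0 ≤ B ∧ ∀ ε ∈ Ioo 0 ε₀, ∀ ζ ∈ U ∩ closure (DEps D r ε),
      ∀ z ∈ U ∩ closure (DEps D r ε), ζ ≠ z → ‖ζ - z‖ < η →
      ‖kernelTerm r g ρ χ e R R' (a ε) (b ε) ε ζ z‖
        ≤ B * (weight r ε ζ ^ ((e.N : ℤ) + e.α).toNat * weight r ε z ^ ((e.M : ℤ) + e.β).toNat)
          * invP r g ρ ε ζ z ^ e.t0 * ‖ζ - z‖ ^ e.j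
          * nonisotropic r ε ζ z ^ ((e.l : ℤ) + e.m - e.t) := by
  obtain ⟨-, ξ, hξ, Ca, hCa⟩ := ha
  obtain ⟨-, ξ', hξ', Cb, hCb⟩ := hb
  obtain ⟨B₁, hB₁, h1⟩ := exists_derivProduct_mul_xi_le hD hG hR hξ he.2.1
  obtain ⟨B₂, hB₂, h2⟩ := exists_derivProduct_mul_xi_le hD hG hR' hξ' he.2.2
  obtain ⟨B₃, hB₃, h3⟩ := hG.invP_bounds
  obtain ⟨-, -, hη1, hC1⟩ := hG.pos
  have hC0 : 0 < C := zero_lt_one.trans_le hC1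
  obtain ⟨T, hT⟩ : ∃ T : ℝ, T = C ^ e.t1.natAbs * C ^ e.t2.natAbs * C ^ e.t3.natAbs
    * C ^ e.t4.natAbs := ⟨_, rfl⟩
  obtain ⟨V, hV⟩ : ∃ V : ℝ, V = 2 ^ (n + n) * 2 ^ (n + n) := ⟨_, rfl⟩
  have hT0 : 0 ≤ T := by rw [hT]; positivity
  have hV0 : 0 ≤ V := by rw [hV]; positivity
  refine ⟨V * |Ca| * |Cb| * T * B₁ * B₂, by positivity, fun ε hε' ζ hζ z hz hne hd => ?_⟩
  have hε : ε ∈ Ioo 0 ε₁ := ⟨hε'.1, hε'.2.trans_le hε₀⟩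
  have hd0 : 0 < ‖ζ - z‖ := norm_pos_iff.2 (sub_ne_zero.2 hne)
  have hd1 : ‖ζ - z‖ ≤ 1 := hd.le.trans hη1
  have hQ := nonisotropic_pos r ε hne
  have hp := (h3 ε hε ζ hζ.2 z hz.2 hd).1
  have hw1 := weight_nonneg r ε ζ
  have hw2 := weight_nonneg r ε z
  obtain ⟨hφ1, hφ2⟩ := hG.phi_le ε hε ζ hζ.2 z hz.2 hd
  obtain ⟨hφ3, hφ4⟩ := hG.le_phi ε hε ζ hζ.2 z hz.2 hd
  have hφp : 0 < ‖phi r ρ χ ε ζ z‖ := by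
    by_contra h
    have : C * ‖phi r ρ χ ε ζ z‖ ≤ 0 := mul_nonpos_of_nonneg_of_nonpos hC0.le (not_lt.1 h)
    linarith
  have hφp' : 0 < ‖phi r ρ χ ε z ζ‖ := by
    by_contra h
    have : C * ‖phi r ρ χ ε z ζ‖ ≤ 0 := mul_nonpos_of_nonneg_of_nonpos hC0.le (not_lt.1 h)
    linarith
  have z1 := zpow_le_of_comparable hφp hQ hC1 hφ1 hφ3 e.t1
  have z2 := zpow_le_of_comparable hφp hQ hC1 hφ1 hφ3 e.t2
  have z3 := zpow_le_of_comparable hφp' hQ hC1 hφ2 hφ4 e.t3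
  have z4 := zpow_le_of_comparable hφp' hQ hC1 hφ2 hφ4 e.t4
  have hr1 : |rEps r ε ζ| ≤ nonisotropic r ε ζ z := by
    unfold nonisotropic
    linarith [abs_nonneg (rEps r ε z), norm_nonneg (inner ℂ (cgrad r z) (ζ - z) : ℂ),
      sq_nonneg ‖ζ - z‖]
  have hr2 : |rEps r ε z| ≤ nonisotropic r ε ζ z := by
    unfold nonisotropic
    linarith [abs_nonneg (rEps r ε ζ), norm_nonneg (inner ℂ (cgrad r z) (ζ - z) : ℂ),
      sq_nonneg ‖ζ - z‖]
  have hA : ‖wedge (a ε ζ z) (swapForm (b ε z ζ))‖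
      ≤ V * |Ca| * |Cb| * (|ξ ζ| * |ξ' z|) * ‖ζ - z‖ ^ e.j := by
    have i1 := hCa ε hε' ζ hζ z hz
    have i2 := hCb ε hε' z hz ζ hζ
    have i3 : ‖a ε ζ z‖ ≤ |Ca| * |ξ ζ| * ‖ζ - z‖ ^ e.j :=
      i1.trans (by gcongr; exact le_abs_self _)
    have i4 : ‖swapForm (b ε z ζ)‖ ≤ |Cb| * |ξ' z| := by
      refine (norm_swapForm_le _).trans (i2.trans ?_)
      rw [norm_sub_rev]
      calc Cb * |ξ' z| * ‖ζ - z‖ ^ e.k ≤ |Cb| * |ξ' z| * 1 := by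
            gcongr
            · exact le_abs_self _
            · exact pow_le_one₀ hd0.le hd1
        _ = _ := mul_one _
    refine (norm_wedge_le _ _).trans ?_
    rw [← hV]
    calc V * (‖a ε ζ z‖ * ‖swapForm (b ε z ζ)‖)
        ≤ V * ((|Ca| * |ξ ζ| * ‖ζ - z‖ ^ e.j) * (|Cb| * |ξ' z|)) := by gcongr
      _ = _ := by ring
  obtain ⟨Q, hQd⟩ : ∃ Q, Q = nonisotropic r ε ζ z := ⟨_, rfl⟩
  rw [← hQd] at z1 z2 z3 z4 hr1 hr2 hQ ⊢
  rw [norm_kernelTerm, abs_of_nonneg hp]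
  obtain ⟨p, hpd⟩ : ∃ p, p = invP r g ρ ε ζ z := ⟨_, rfl⟩
  rw [← hpd] at hp ⊢
  have hexp : Q ^ e.t1 * Q ^ e.t2 * Q ^ e.t3 * Q ^ e.t4 * Q ^ e.l * Q ^ e.m
      = Q ^ ((e.l : ℤ) + e.m - e.t) := by
    rw [← zpow_natCast, ← zpow_natCast, ← zpow_add₀ hQ.ne', ← zpow_add₀ hQ.ne',
      ← zpow_add₀ hQ.ne', ← zpow_add₀ hQ.ne', ← zpow_add₀ hQ.ne']
    congr 1
    unfold Exponents.t
    ring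
  calc _ ≤ ‖R ζ‖ * ‖R' z‖ * p ^ e.t0
        * (C ^ e.t1.natAbs * Q ^ e.t1) * (C ^ e.t2.natAbs * Q ^ e.t2)
        * (C ^ e.t3.natAbs * Q ^ e.t3) * (C ^ e.t4.natAbs * Q ^ e.t4)
        * Q ^ e.l * Q ^ e.m
        * (V * |Ca| * |Cb| * (|ξ ζ| * |ξ' z|) * ‖ζ - z‖ ^ e.j) := by gcongr
    _ = V * |Ca| * |Cb| * T * ((‖R ζ‖ * |ξ ζ|) * (‖R' z‖ * |ξ' z|)) * p ^ e.t0 * ‖ζ - z‖ ^ e.j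
        * (Q ^ e.t1 * Q ^ e.t2 * Q ^ e.t3 * Q ^ e.t4 * Q ^ e.l * Q ^ e.m) := by
        rw [hT]; ring
    _ ≤ V * |Ca| * |Cb| * T * ((B₁ * weight r ε ζ ^ ((e.N : ℤ) + e.α).toNat)
          * (B₂ * weight r ε z ^ ((e.M : ℤ) + e.β).toNat)) * p ^ e.t0 * ‖ζ - z‖ ^ e.j
        * (Q ^ e.t1 * Q ^ e.t2 * Q ^ e.t3 * Q ^ e.t4 * Q ^ e.l * Q ^ e.m) := by
        gcongr _ * (?_ * ?_) * _ * _ * _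
        · exact h1 ε hε ζ hζ.2
        · exact h2 ε hε z hz.2
    _ = _ := by rw [hexp]; ring

end

/-- Separates the length of ∂r, which may vanish and goes into the weight, from its direction, which
gives the coordinate x. Where ∂r = 0 any unit vector will do. -/
theorem exists_unit_direction {n : ℕ} (hn : 1 ≤ n) (w : Cn n) :
    ∃ u : Cn n, ‖u‖ = 1 ∧ ∀ v : Cn n, ‖(inner ℂ w v : ℂ)‖ = ‖w‖ * ‖(inner ℂ u v : ℂ)‖ := by
  by_cases hw : w = 0
  · exact ⟨EuclideanSpace.single ⟨0, hn⟩ 1, by simp, fun v => by simp [hw]⟩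
  · have h : ‖w‖ ≠ 0 := norm_ne_zero_iff.2 hw
    refine ⟨((‖w‖⁻¹ : ℝ) : ℂ) • w, ?_, fun v => ?_⟩
    · rw [norm_smul, Complex.norm_real, norm_inv, norm_norm, inv_mul_cancel₀ h]
    · rw [inner_smul_left, norm_mul, RCLike.norm_conj, Complex.norm_real, norm_inv, norm_norm,
        mul_inv_cancel_left₀ h]

/-- Exponents of the majorant `x^{-β} d^{-c}`, in the case where `φ` appears with total exponent
`≥ 0`. -/
theorem Exponents.subcritical_of_nonneg {n : ℕ} {e : Exponents} {τ : ℤ} (hτ : τ ≤ e.type n)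
    {lam : ℝ} (hlam : 1 ≤ lam) (h : lam * (2 * (n : ℝ) + 2 - τ) < 2 * n + 2) (hn : 1 ≤ n) {k : ℕ}
    (hk : (e.l : ℤ) + e.m - e.t = k) :
    lam * ((2 * e.t0 - k : ℕ) - e.j : ℝ) < 2 * n := by
  have hn0 : (1 : ℝ) ≤ n := by exact_mod_cast hn
  rcases le_total (2 * e.t0) k with hle | hle
  · rw [Nat.sub_eq_zero_of_le hle]
    have : 0 ≤ lam * (e.j : ℝ) := by positivity
    push_cast
    linarith
  · have h1 : (τ : ℤ) ≤ 2 * n + e.j + k - 2 * e.t0 := by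
      unfold Exponents.type Exponents.smoothType at hτ
      -- Since t - l - m = -k ≤ 0, the minimum in the smooth type is -k, and s = 2n + j + k - 2t₀.
      rw [min_eq_right (by omega)] at hτ
      have := le_max_left (0 : ℤ) (2 - e.N - e.M - e.α - e.β)
      omega
    have h2 : (τ : ℝ) ≤ 2 * n + e.j + k - 2 * e.t0 := by exact_mod_cast h1
    rw [Nat.cast_sub hle]
    push_cast
    have h3 : lam * (2 * e.t0 - k - e.j : ℝ) ≤ lam * (2 * n - τ) :=
      mul_le_mul_of_nonneg_left (by linarith) (by linarith)
    linarith

/-- Exponents of the majorant `x^{-β} d^{-c}`, in the case where `φ` appears with total exponent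
`< 0`. -/
theorem Exponents.exists_subcritical_of_neg {n : ℕ} {e : Exponents} (he : e.Valid) {τ : ℤ}
    (hτ : τ ≤ e.type n) {lam : ℝ} (hlam : 1 ≤ lam)
    (h : lam * (2 * (n : ℝ) + 2 - τ) < 2 * n + 2) {t : ℕ} (ht : 1 ≤ t)
    (hk : e.t - e.l - e.m = t) :
    ∃ β : ℝ, 0 ≤ β ∧ β < 2 ∧ β ≤ 2 * lam ∧ β ≤ lam * t ∧
      β + (lam * ((2 - (((e.N : ℤ) + e.α).toNat + ((e.M : ℤ) + e.β).toNat) : ℕ)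
        + 2 * e.t0 + 2 * t - e.j : ℝ) - 2 * β) < 2 * n := by
  obtain ⟨-, h1, h2⟩ := he
  have h3 : ((2 - (((e.N : ℤ) + e.α).toNat + ((e.M : ℤ) + e.β).toNat) : ℕ) : ℤ)
      + 2 * e.t0 + 2 * t - e.j = 2 * n + min 2 (t : ℤ) - e.type n := by
    unfold Exponents.type Exponents.smoothType
    rw [hk]
    omega
  have h4 : ((2 - (((e.N : ℤ) + e.α).toNat + ((e.M : ℤ) + e.β).toNat) : ℕ) : ℝ)
      + 2 * e.t0 + 2 * t - e.j = 2 * n + min 2 (t : ℝ) - (e.type n : ℤ) := by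
    have := congrArg (fun x : ℤ => (x : ℝ)) h3
    push_cast at this
    exact_mod_cast this
  rw [h4]
  have hτ' : (τ : ℝ) ≤ (e.type n : ℤ) := by exact_mod_cast hτ
  have h5 : ∀ q : ℝ, lam * (2 * n + q - (e.type n : ℤ)) ≤ lam * (2 * n + 2 - τ) + lam * (q - 2) := by
    intro q
    rw [← mul_add]
    gcongr
    linarith
  rcases ht.eq_or_lt with h1 | h1
  · subst h1
    -- For t = 1, λ ≥ 1 makes β = 1 admissible: lowering 2n + 2 - τ by one gains λ ≥ 1.
    refine ⟨1, zero_le_one, one_lt_two, by linarith, by simpa using hlam, ?_⟩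
    have := h5 1
    rw [Nat.cast_one, min_eq_right one_le_two]
    linarith
  · have ht2 : (2 : ℝ) ≤ t := by exact_mod_cast h1
    have hlt : 2 * lam ≤ lam * t := by nlinarith
    rw [min_eq_left ht2]
    have := h5 2
    have hmid := le_max_right (1 : ℝ) ((lam * (2 * (n : ℝ) + 2 - τ) - 2 * n + 2) / 2)
    have hmid1 := le_max_left (1 : ℝ) ((lam * (2 * (n : ℝ) + 2 - τ) - 2 * n + 2) / 2)
    have hmid2 : max (1 : ℝ) ((lam * (2 * (n : ℝ) + 2 - τ) - 2 * n + 2) / 2) < 2 :=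
      max_lt one_lt_two (by linarith)
    -- For t ≥ 2 one needs λ(2n + 2 - τ) - 2n < β < 2. The hypothesis on λ makes this interval
    -- non-empty; its midpoint is taken, replaced by 1 if smaller so that β ≥ 0.
    refine ⟨max 1 ((lam * (2 * (n : ℝ) + 2 - τ) - 2 * n + 2) / 2), ?_, hmid2, ?_, ?_, ?_⟩
    all_goals linarith

section

variable {n : ℕ} {D : Set (Cn n)} {r : Cn n → ℝ} {g : Cn n → Matrix (Fin n) (Fin n) ℂ}
  {ρ χ : Cn n → Cn n → ℝ} {ε₁ η C : ℝ}

/-- The quantities entering the estimates at a pair of points, with the constants in the form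
in which the real inequalities use them. The base point of the direction is `z`. -/
theorem GeometricBounds.pair_bounds (hG : GeometricBounds D r g ρ χ ε₁ η C) {ε : ℝ}
    (hε : ε ∈ Ioo 0 ε₁) {ζ z : Cn n} (hζ : ζ ∈ closure (DEps D r ε))
    (hz : z ∈ closure (DEps D r ε)) (hd : ‖ζ - z‖ < η) {u : Cn n} (hu : ‖u‖ = 1)
    (hu' : ∀ v : Cn n, ‖(inner ℂ (cgrad r z) v : ℂ)‖ = ‖cgrad r z‖ * ‖(inner ℂ u v : ℂ)‖) :
    weight r ε ζ ≤ 2 * C * (weight r ε z + ‖ζ - z‖) ∧ weight r ε z ≤ 2 * C ∧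
      weight r ε ζ ≤ 2 * C ∧
      |rEps r ε ζ| + |rEps r ε z| ≤ 2 * C ∧
      nonisotropic r ε ζ z ≤ (1 + C) * (|rEps r ε ζ| + |rEps r ε z| + ‖ζ - z‖) ∧
      nonisotropic r ε z ζ ≤ (1 + C) * (|rEps r ε ζ| + |rEps r ε z| + ‖ζ - z‖) ∧
      (weight r ε z + ‖ζ - z‖) * ‖(inner ℂ u (ζ - z) : ℂ)‖ + ‖ζ - z‖ ^ 2
        ≤ 2 * nonisotropic r ε ζ z ∧
      nonisotropic r ε ζ z ≤ C * C * nonisotropic r ε z ζ := by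
  obtain ⟨-, -, hη1, hC1⟩ := hG.pos
  have hC0 : 0 < C := zero_lt_one.trans_le hC1
  have hζD := mem_closure_of_mem_closure_DEps hζ
  have hzD := mem_closure_of_mem_closure_DEps hz
  have hd1 : ‖ζ - z‖ ≤ 1 := hd.le.trans hη1
  have hd0 := norm_nonneg (ζ - z)
  have hdd : ‖ζ - z‖ ^ 2 ≤ ‖ζ - z‖ := by nlinarith
  have g1 := hG.norm_cgrad_le ζ hζD
  have g2 := hG.norm_cgrad_le z hzD
  have r1 := hG.abs_rEps_le ε hε ζ hζ
  have r2 := hG.abs_rEps_le ε hε z hz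
  have r10 := abs_nonneg (rEps r ε ζ)
  have r20 := abs_nonneg (rEps r ε z)
  have hx : ‖(inner ℂ u (ζ - z) : ℂ)‖ ≤ ‖ζ - z‖ := by
    have := norm_inner_le_norm (𝕜 := ℂ) u (ζ - z)
    rwa [hu, one_mul] at this
  have hx0 := norm_nonneg (inner ℂ u (ζ - z) : ℂ)
  have hin : ∀ w ∈ closure D, ∀ v : Cn n, ‖(inner ℂ (cgrad r w) v : ℂ)‖ ≤ C * ‖v‖ := fun w hw v =>
    (norm_inner_le_norm _ _).trans (by gcongr; exact hG.norm_cgrad_le w hw)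
  refine ⟨?_, ?_, ?_, by linarith, ?_, ?_, ?_, ?_⟩
  · have h1 : |rEps r ε ζ| ≤ |rEps r ε z| + C * ‖ζ - z‖ := by
      have h2 := hG.sub_le ζ hζD z hzD
      have h3 : rEps r ε ζ - rEps r ε z = r ζ - r z := by unfold rEps; ring
      rw [← h3] at h2
      linarith [abs_sub_abs_le_abs_sub (rEps r ε ζ) (rEps r ε z)]
    have h4 : ‖cgrad r ζ‖ ≤ ‖cgrad r z‖ + C * ‖ζ - z‖ := by
      have h2 := hG.cgrad_sub_le ζ hζD z hzD
      linarith [norm_sub_norm_le (cgrad r ζ) (cgrad r z)]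
    have h5 : weight r ε z ≤ 2 * C * weight r ε z :=
      le_mul_of_one_le_left (weight_nonneg _ _ _) (by linarith)
    rw [mul_add]
    unfold weight at *
    linarith
  · unfold weight; linarith
  · unfold weight; linarith
  · have := hin z hzD (ζ - z)
    unfold nonisotropic
    nlinarith
  · have := hin ζ hζD (z - ζ)
    unfold nonisotropic
    rw [norm_sub_rev z ζ] at *
    nlinarith
  · have h1 := hu' (ζ - z)
    have h2 : |rEps r ε z| * ‖(inner ℂ u (ζ - z) : ℂ)‖ ≤ |rEps r ε z| :=
      mul_le_of_le_one_right r20 (hx.trans hd1)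
    have h3 : ‖ζ - z‖ * ‖(inner ℂ u (ζ - z) : ℂ)‖ ≤ ‖ζ - z‖ ^ 2 := by
      rw [pow_two]; gcongr
    have h4 := norm_nonneg (inner ℂ (cgrad r z) (ζ - z) : ℂ)
    unfold weight nonisotropic
    rw [add_mul, add_mul, ← h1]
    linarith
  · have hd' : ‖z - ζ‖ < η := by rwa [norm_sub_rev]
    have h1 := (hG.le_phi ε hε ζ hζ z hz hd).1
    have h2 := (hG.phi_le ε hε z hz ζ hζ hd').2
    -- Q(ζ, z) and Q(z, ζ) are both comparable with |φ_ε(ζ, z)|, hence with each other.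
    calc _ ≤ C * ‖phi r ρ χ ε ζ z‖ := h1
      _ ≤ C * (C * nonisotropic r ε z ζ) := by gcongr
      _ = _ := by ring

/-- A kernel satisfying the size estimate of an admissible kernel is, in either variable,
dominated by a product of powers of a linear coordinate and of the distance. -/
theorem exists_rpow_kernel_le (hn : 1 ≤ n) (hG : GeometricBounds D r g ρ χ ε₁ η C) {ε₀ : ℝ}
    (hε₀ : ε₀ ≤ ε₁) {U : Set (Cn n)} {e : Exponents} (he : e.Valid) {τ : ℤ} (hτ : τ ≤ e.type n)
    {lam : ℝ} (hlam : 1 ≤ lam) (h : lam * (2 * (n : ℝ) + 2 - τ) < 2 * n + 2)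
    {𝓐 : ℝ → Cn n → Cn n → DoubleForm n} {B : ℝ} (hB : 0 ≤ B)
    (hA : ∀ ε ∈ Ioo 0 ε₀, ∀ ζ ∈ U ∩ closure (DEps D r ε), ∀ z ∈ U ∩ closure (DEps D r ε),
      ζ ≠ z → ‖ζ - z‖ < η → ‖𝓐 ε ζ z‖
        ≤ B * (weight r ε ζ ^ ((e.N : ℤ) + e.α).toNat * weight r ε z ^ ((e.M : ℤ) + e.β).toNat)
          * invP r g ρ ε ζ z ^ e.t0 * ‖ζ - z‖ ^ e.j
          * nonisotropic r ε ζ z ^ ((e.l : ℤ) + e.m - e.t)) :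
    ∃ B' β c : ℝ, 0 ≤ B' ∧ β < 2 ∧ β + c < 2 * n ∧
      ∀ ε ∈ Ioo 0 ε₀, ∀ ζ ∈ U ∩ closure (DEps D r ε), ∀ z ∈ U ∩ closure (DEps D r ε),
        ‖ζ - z‖ < η → ∀ u : Cn n, ‖u‖ = 1 →
        (∀ v : Cn n, ‖(inner ℂ (cgrad r z) v : ℂ)‖ = ‖cgrad r z‖ * ‖(inner ℂ u v : ℂ)‖) →
        (inner ℂ u (ζ - z) : ℂ) ≠ 0 →
        ‖𝓐 ε ζ z‖ ^ lam ≤ B' * (‖(inner ℂ u (ζ - z) : ℂ)‖ ^ (-β) * ‖ζ - z‖ ^ (-c)) ∧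
        ‖𝓐 ε z ζ‖ ^ lam ≤ B' * (‖(inner ℂ u (ζ - z) : ℂ)‖ ^ (-β) * ‖ζ - z‖ ^ (-c)) := by
  obtain ⟨B₃, hB₃, h3⟩ := hG.invP_bounds
  obtain ⟨-, -, hη1, hC1⟩ := hG.pos
  have hC0 : 0 < C := zero_lt_one.trans_le hC1
  obtain ⟨C', hC'⟩ : ∃ C', C' = B + B₃ + 3 * C + 2 * (C * C) + 1 := ⟨_, rfl⟩
  have hCC : 1 ≤ C * C := one_le_mul_of_one_le_of_one_le hC1 hC1
  have hC'1 : 1 ≤ C' := by linarith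
  have hC'0 : 0 ≤ C' := by linarith
  have aux : ∀ ε ζ z, 0 ≤ weight r ε ζ ^ ((e.N : ℤ) + e.α).toNat
      * weight r ε z ^ ((e.M : ℤ) + e.β).toNat := fun ε ζ z =>
    mul_nonneg (pow_nonneg (weight_nonneg _ _ _) _) (pow_nonneg (weight_nonneg _ _ _) _)
  have hA' : ∀ ε ∈ Ioo 0 ε₀, ∀ ζ ∈ U ∩ closure (DEps D r ε), ∀ z ∈ U ∩ closure (DEps D r ε),
      ζ ≠ z → ‖ζ - z‖ < η → ‖𝓐 ε ζ z‖
        ≤ C' * (weight r ε ζ ^ ((e.N : ℤ) + e.α).toNat * weight r ε z ^ ((e.M : ℤ) + e.β).toNat)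
          * invP r g ρ ε ζ z ^ e.t0 * ‖ζ - z‖ ^ e.j
          * nonisotropic r ε ζ z ^ ((e.l : ℤ) + e.m - e.t) := by
    intro ε hε ζ hζ z hz hne hd
    have hp := (h3 ε ⟨hε.1, hε.2.trans_le hε₀⟩ ζ hζ.2 z hz.2 hd).1
    have hQ := nonisotropic_pos r ε hne
    refine (hA ε hε ζ hζ z hz hne hd).trans ?_
    have := aux ε ζ z
    gcongr
    linarith
  have hne_of : ∀ {u ζ z : Cn n}, (inner ℂ u (ζ - z) : ℂ) ≠ 0 → ζ ≠ z := by
    rintro u ζ z h0 rfl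
    simp at h0
  -- For a non-negative total power of Q the direction u plays no role and β = 0.
  rcases le_or_gt 0 ((e.l : ℤ) + e.m - e.t) with hE | hE
  · obtain ⟨k, hk⟩ := Int.eq_ofNat_of_zero_le hE
    obtain ⟨B', hB', hreal⟩ := rpow_bound_of_nonneg_exponent (a := ((e.N : ℤ) + e.α).toNat)
      (b := ((e.M : ℤ) + e.β).toNat) (j := e.j) (t₀ := e.t0) (k := k) hlam hC'1
    refine ⟨B', 0, lam * ((2 * e.t0 - k : ℕ) - e.j : ℝ), hB', two_pos, ?_, ?_⟩
    · rw [zero_add]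
      exact e.subcritical_of_nonneg hτ hlam h hn hk
    intro ε hε ζ hζ z hz hd u hu hu' hx
    have hne := hne_of hx
    have hε1 : ε ∈ Ioo 0 ε₁ := ⟨hε.1, hε.2.trans_le hε₀⟩
    have hd' : ‖z - ζ‖ < η := by rwa [norm_sub_rev]
    have hd0 : 0 < ‖ζ - z‖ := norm_pos_iff.2 (sub_ne_zero.2 hne)
    obtain ⟨b1, b2, b3, b4, b5, b6, -, -⟩ := hG.pair_bounds hε1 hζ.2 hz.2 hd hu hu'
    obtain ⟨hp0, hp⟩ := h3 ε hε1 ζ hζ.2 z hz.2 hd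
    obtain ⟨hp0', hp'⟩ := h3 ε hε1 z hz.2 ζ hζ.2 hd'
    rw [norm_sub_rev, add_comm |rEps r ε z|] at hp'
    have hK := hA' ε hε ζ hζ z hz hne hd
    have hK' := hA' ε hε z hz ζ hζ hne.symm hd'
    rw [hk] at hK hK'
    rw [norm_sub_rev] at hK'
    have hS0 : 0 ≤ |rEps r ε ζ| + |rEps r ε z| := by positivity
    simp only [zpow_natCast] at hK hK'
    rw [neg_zero, Real.rpow_zero, one_mul]
    constructor
    · refine hreal _ _ _ _ _ (|rEps r ε ζ| + |rEps r ε z| + ‖ζ - z‖) _ (norm_nonneg _)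
        (weight_nonneg r ε ζ) (weight_nonneg r ε z) hp0 (nonisotropic_nonneg _ _ _ _) hd0
        (by linarith) (by linarith) (by linarith) (by linarith) (by linarith)
        (b5.trans (mul_le_mul_of_nonneg_right (by linarith) (by linarith))) hK
    · refine hreal _ _ _ _ _ (|rEps r ε ζ| + |rEps r ε z| + ‖ζ - z‖) _ (norm_nonneg _)
        (weight_nonneg r ε z) (weight_nonneg r ε ζ) hp0' (nonisotropic_nonneg _ _ _ _) hd0
        (by linarith) (by linarith) (by linarith) (by linarith) (by linarith)
        (b6.trans (mul_le_mul_of_nonneg_right (by linarith) (by linarith))) hK'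
  · obtain ⟨t, ht⟩ := Int.eq_ofNat_of_zero_le (by omega : 0 ≤ e.t - e.l - e.m)
    have ht1 : 1 ≤ t := by
      have : e.t - e.l - e.m = (t : ℤ) := ht
      omega
    obtain ⟨β, hβ0, hβ2, hβl, hβt, hβc⟩ := e.exists_subcritical_of_neg he hτ hlam h ht1 ht
    obtain ⟨B', hB', hreal⟩ := rpow_bound_of_neg_exponent (a := ((e.N : ℤ) + e.α).toNat)
      (b := ((e.M : ℤ) + e.β).toNat) (j := e.j) (t₀ := e.t0) (t := t) hlam hC'1 hβ0 hβl hβt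
    refine ⟨B', β, _, hB', hβ2, hβc, ?_⟩
    intro ε hε ζ hζ z hz hd u hu hu' hx
    have hne := hne_of hx
    have hε1 : ε ∈ Ioo 0 ε₁ := ⟨hε.1, hε.2.trans_le hε₀⟩
    have hd' : ‖z - ζ‖ < η := by rwa [norm_sub_rev]
    have hd0 : 0 < ‖ζ - z‖ := norm_pos_iff.2 (sub_ne_zero.2 hne)
    have hd1 : ‖ζ - z‖ ≤ 1 := hd.le.trans hη1
    have hx0 : 0 < ‖(inner ℂ u (ζ - z) : ℂ)‖ := norm_pos_iff.2 hx
    obtain ⟨b1, b2, b3, b4, b5, b6, b7, b8⟩ := hG.pair_bounds hε1 hζ.2 hz.2 hd hu hu'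
    obtain ⟨hp0, hp⟩ := h3 ε hε1 ζ hζ.2 z hz.2 hd
    obtain ⟨hp0', hp'⟩ := h3 ε hε1 z hz.2 ζ hζ.2 hd'
    have hS0 : ‖ζ - z‖ ≤ |rEps r ε ζ| + |rEps r ε z| + ‖ζ - z‖ :=
      le_add_of_nonneg_left (by positivity)
    have hpd : invP r g ρ ε ζ z * ‖ζ - z‖ ^ 2 ≤ C' := by
      refine le_trans ?_ (hp.trans (by linarith))
      gcongr
    have hpd' : invP r g ρ ε z ζ * ‖ζ - z‖ ^ 2 ≤ C' := by
      rw [norm_sub_rev, add_comm |rEps r ε z|] at hp'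
      refine le_trans ?_ (hp'.trans (by linarith))
      gcongr
    have hK := hA' ε hε ζ hζ z hz hne hd
    have hK' := hA' ε hε z hz ζ hζ hne.symm hd'
    have hexp : (e.l : ℤ) + e.m - e.t = -(t : ℤ) := by
      have : e.t - e.l - e.m = (t : ℤ) := ht
      omega
    rw [hexp, zpow_neg, zpow_natCast] at hK hK'
    rw [norm_sub_rev] at hK'
    have hw0 := weight_nonneg r ε z
    have hH : 2 * C * (weight r ε z + ‖ζ - z‖) ≤ C' * (weight r ε z + ‖ζ - z‖) :=
      mul_le_mul_of_nonneg_right (by linarith) (by linarith)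
    have hH1 : weight r ε z ≤ C' * (weight r ε z + ‖ζ - z‖) :=
      (le_add_of_nonneg_right hd0.le).trans (le_mul_of_one_le_left (by linarith) hC'1)
    have hq0 := nonisotropic_nonneg r ε ζ z
    have hq0' := nonisotropic_nonneg r ε z ζ
    constructor
    · refine hreal _ _ _ _ _ (weight r ε z + ‖ζ - z‖) _ _ (norm_nonneg _)
        (weight_nonneg r ε ζ) hw0 hp0 (nonisotropic_pos r ε hne) hx0 hd0
        (by linarith) (by linarith) (b1.trans hH) hH1 hpd
        (b7.trans (mul_le_mul_of_nonneg_right (by linarith) hq0)) hK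
    · refine hreal _ _ _ _ _ (weight r ε z + ‖ζ - z‖) _ _ (norm_nonneg _)
        hw0 (weight_nonneg r ε ζ) hp0' (nonisotropic_pos r ε hne.symm) hx0 hd0
        (by linarith) (by linarith) hH1 (b1.trans hH) hpd'
        (b7.trans ?_) hK'
      -- In the transposed kernel the direction is still that of ∂r at the fixed point z, so its Q
      -- must first be exchanged for the one based at z.
      calc 2 * nonisotropic r ε ζ z ≤ 2 * (C * C * nonisotropic r ε z ζ) := by gcongr
        _ = 2 * (C * C) * nonisotropic r ε z ζ := by ring
        _ ≤ _ := mul_le_mul_of_nonneg_right (by linarith) hq0'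

end

/-! ### Integration -/

theorem isOpen_DEps {n : ℕ} {D : Set (Cn n)} {r : Cn n → ℝ} (hD : IsMorseDomain D r) (ε : ℝ) :
    IsOpen (DEps D r ε) := by
  have hc : ContinuousOn (rEps r ε) D := fun ζ hζ =>
    ((hD.differentiableAt (subset_closure hζ)).continuousAt.add
      continuousAt_const).continuousWithinAt
  exact hc.isOpen_inter_preimage hD.isOpen isOpen_Iio

theorem ae_inner_sub_ne_zero {n : ℕ} {u : Cn n} (hu : ‖u‖ = 1) (z : Cn n) :
    ∀ᵐ ζ : Cn n, (inner ℂ u (ζ - z) : ℂ) ≠ 0 := by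
  let p : Submodule ℝ (Cn n) :=
    LinearMap.ker ((innerSL ℂ u).restrictScalars ℝ).toLinearMap
  have hp : p ≠ ⊤ := by
    intro h
    have h1 : u ∈ p := h ▸ Submodule.mem_top
    simp only [p, LinearMap.mem_ker, ContinuousLinearMap.coe_coe,
      ContinuousLinearMap.coe_restrictScalars', innerSL_apply_apply, inner_self_eq_zero] at h1
    rw [h1, norm_zero] at hu
    exact zero_ne_one hu
  have h0 : ∀ᵐ ζ : Cn n, (inner ℂ u ζ : ℂ) ≠ 0 := by
    refine measure_mono_null ?_ (Measure.addHaar_submodule (volume : Measure (Cn n)) p hp)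
    intro w hw
    simpa [p] using hw
  exact (measurePreserving_sub_right volume z).quasiMeasurePreserving.ae h0

/-- Split at |ζ - z| = δ. Only the majorant has to be measurable, and the hyperplane where the
coordinate vanishes is a null set. -/
theorem lintegral_enorm_rpow_le {n : ℕ} {G : Type*} [NormedAddCommGroup G] {A : Cn n → G}
    {S : Set (Cn n)} (hS : MeasurableSet S) {z u : Cn n} (hu : ‖u‖ = 1) {δ lam B Co β c : ℝ}
    (hδ : δ ≤ 1) (hlam : 0 ≤ lam) {I : NNReal}
    (hI : ∫⁻ ζ in ball z 1, ENNReal.ofReal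
      (‖(inner ℂ u (ζ - z) : ℂ)‖ ^ (-β) * ‖ζ - z‖ ^ (-c)) ≤ I)
    (hfar : ∀ ζ ∈ S, δ ≤ ‖ζ - z‖ → ‖A ζ‖ ≤ Co) (hB : 0 ≤ B)
    (hnear : ∀ ζ ∈ S, ‖ζ - z‖ < δ → (inner ℂ u (ζ - z) : ℂ) ≠ 0 →
      ‖A ζ‖ ^ lam ≤ B * (‖(inner ℂ u (ζ - z) : ℂ)‖ ^ (-β) * ‖ζ - z‖ ^ (-c))) :
    ∫⁻ ζ in S, ‖A ζ‖ₑ ^ lam ≤ ENNReal.ofReal B * I + ENNReal.ofReal (|Co| ^ lam) * volume S := by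
  have hmeas : Measurable fun ζ : Cn n => ENNReal.ofReal
      (‖(inner ℂ u (ζ - z) : ℂ)‖ ^ (-β) * ‖ζ - z‖ ^ (-c)) := by
    have h1 : Continuous fun ζ : Cn n => ‖(inner ℂ u (ζ - z) : ℂ)‖ := by fun_prop
    have h2 : Continuous fun ζ : Cn n => ‖ζ - z‖ := by fun_prop
    exact ((h1.measurable.pow_const _).mul (h2.measurable.pow_const _)).ennreal_ofReal
  have henorm : ∀ ζ, ‖A ζ‖ₑ ^ lam = ENNReal.ofReal (‖A ζ‖ ^ lam) := fun ζ => by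
    rw [← ofReal_norm, ENNReal.ofReal_rpow_of_nonneg (norm_nonneg _) hlam]
  calc ∫⁻ ζ in S, ‖A ζ‖ₑ ^ lam
      ≤ ∫⁻ ζ in S, ((ball z 1).indicator (fun ζ => ENNReal.ofReal B * ENNReal.ofReal
          (‖(inner ℂ u (ζ - z) : ℂ)‖ ^ (-β) * ‖ζ - z‖ ^ (-c))) ζ
            + ENNReal.ofReal (|Co| ^ lam)) := by
        refine lintegral_mono_ae ?_
        filter_upwards [ae_restrict_mem hS, ae_restrict_of_ae (ae_inner_sub_ne_zero hu z)]
          with ζ hζ hne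
        rw [henorm]
        rcases lt_or_ge ‖ζ - z‖ δ with h | h
        · refine le_add_right ?_
          rw [Set.indicator_of_mem (mem_ball_iff_norm.2 (h.trans_le hδ)), ← ENNReal.ofReal_mul hB]
          exact ENNReal.ofReal_le_ofReal (hnear ζ hζ h hne)
        · refine le_add_left (ENNReal.ofReal_le_ofReal ?_)
          exact Real.rpow_le_rpow (norm_nonneg _) ((hfar ζ hζ h).trans (le_abs_self _)) hlam
    _ = (∫⁻ ζ in S, (ball z 1).indicator (fun ζ => ENNReal.ofReal B * ENNReal.ofReal
          (‖(inner ℂ u (ζ - z) : ℂ)‖ ^ (-β) * ‖ζ - z‖ ^ (-c))) ζ)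
            + ENNReal.ofReal (|Co| ^ lam) * volume S := by
        rw [lintegral_add_right _ measurable_const, setLIntegral_const]
    _ ≤ _ := by
        gcongr
        refine (setLIntegral_le_lintegral _ _).trans ?_
        rw [lintegral_indicator measurableSet_ball, lintegral_const_mul _ hmeas]
        gcongr

/-- The fixed variable stays near ζ₀ while the other runs over all of D_ε: close to z the local
representation applies, elsewhere the off-diagonal bound. The direction u depends on z, the
constants do not. -/
theorem IsAdmissibleFamily.exists_local_bound {n : ℕ} (hn : 1 ≤ n) {D : Set (Cn n)}
    {r : Cn n → ℝ} (hD : IsMorseDomain D r) {g : Cn n → Matrix (Fin n) (Fin n) ℂ}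
    {ρ χ : Cn n → Cn n → ℝ} {ε₁ η C : ℝ} (hG : GeometricBounds D r g ρ χ ε₁ η C) {ε₀ : ℝ}
    (hε₀ : ε₀ ≤ ε₁) {τ : ℤ} {𝓐 : ℝ → Cn n → Cn n → DoubleForm n}
    (hA : IsAdmissibleFamily D r g ρ χ ε₀ τ 𝓐) {lam : ℝ} (hlam : 1 ≤ lam)
    (h : lam * (2 * (n : ℝ) + 2 - τ) < 2 * n + 2) {ζ₀ : Cn n} (hζ₀ : ζ₀ ∈ closure D) :
    ∃ V ∈ nhds ζ₀, ∃ L : NNReal, ∀ ε ∈ Ioo 0 ε₀, ∀ z ∈ V ∩ closure (DEps D r ε),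
      ∫⁻ ζ in DEps D r ε, ‖𝓐 ε ζ z‖ₑ ^ lam ≤ L ∧ ∫⁻ ζ in DEps D r ε, ‖𝓐 ε z ζ‖ₑ ^ lam ≤ L := by
  obtain ⟨U, hU, hζU, e, he, hτ, R, R', hR, hR', a, b, ha, hb, hrep⟩ := hA.representation ζ₀ hζ₀
  obtain ⟨B, hB, hker⟩ := exists_kernelTerm_le hD hG hε₀ he hR hR' ha hb
  have hker' : ∀ ε ∈ Ioo 0 ε₀, ∀ ζ ∈ U ∩ closure (DEps D r ε), ∀ z ∈ U ∩ closure (DEps D r ε),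
      ζ ≠ z → ‖ζ - z‖ < η → ‖𝓐 ε ζ z‖
        ≤ B * (weight r ε ζ ^ ((e.N : ℤ) + e.α).toNat * weight r ε z ^ ((e.M : ℤ) + e.β).toNat)
          * invP r g ρ ε ζ z ^ e.t0 * ‖ζ - z‖ ^ e.j
          * nonisotropic r ε ζ z ^ ((e.l : ℤ) + e.m - e.t) := by
    intro ε hε ζ hζ z hz hne hd
    refine le_trans ?_ (hker ε hε ζ hζ z hz hne hd)
    rcases hrep ε hε with h1 | h1
    · rw [h1 ζ hζ z hz hne]
    · rw [← h1 ζ hζ z hz hne]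
      exact norm_le_norm_conjForm _
  obtain ⟨B', β, c, hB', hβ2, hβc, hpt⟩ := exists_rpow_kernel_le hn hG hε₀ he hτ hlam h hB hker'
  obtain ⟨I, hI⟩ := exists_lintegral_inner_rpow_le hn hβ2 hβc
  obtain ⟨-, hη0, hη1, -⟩ := hG.pos
  obtain ⟨δ₀, hδ₀, hball⟩ := Metric.isOpen_iff.1 hU ζ₀ hζU
  -- With δ ≤ δ₀/2, a point within δ of some z in the ball of radius δ about ζ₀ still lies in U;
  -- with δ ≤ η the geometric estimates hold.
  obtain ⟨δ, hδ0, hδ⟩ : ∃ δ : ℝ, 0 < δ ∧ δ ≤ min (δ₀ / 2) η :=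
    ⟨_, lt_min (by positivity) hη0, le_rfl⟩
  have hδ1 : δ ≤ δ₀ / 2 := hδ.trans (min_le_left _ _)
  have hδ2 : δ ≤ η := hδ.trans (min_le_right _ _)
  obtain ⟨Co, hCo⟩ := hA.offDiagonal δ hδ0
  have hvol : volume D < ⊤ := hD.isBounded.measure_lt_top
  obtain ⟨L, hL⟩ : ∃ L : NNReal, (L : ENNReal)
      = ENNReal.ofReal B' * I + ENNReal.ofReal (|Co| ^ lam) * volume D :=
    ⟨_, ENNReal.coe_toNNReal (ENNReal.add_lt_top.2
      ⟨ENNReal.mul_lt_top ENNReal.ofReal_lt_top ENNReal.coe_lt_top,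
        ENNReal.mul_lt_top ENNReal.ofReal_lt_top hvol⟩).ne⟩
  refine ⟨ball ζ₀ δ, ball_mem_nhds _ hδ0, L, fun ε hε z hz => ?_⟩
  obtain ⟨u, hu, hu'⟩ := exists_unit_direction hn (cgrad r z)
  have hS := (isOpen_DEps hD ε).measurableSet
  have hzU : z ∈ U ∩ closure (DEps D r ε) :=
    ⟨hball (ball_subset_ball (by linarith) hz.1), hz.2⟩
  have hζU : ∀ ζ ∈ DEps D r ε, ‖ζ - z‖ < δ → ζ ∈ U ∩ closure (DEps D r ε) := fun ζ hζ hd => by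
    refine ⟨hball ?_, subset_closure hζ⟩
    have h1 : dist ζ z < δ := by rwa [dist_eq_norm]
    have h2 : dist z ζ₀ < δ := hz.1
    exact mem_ball.2 ((dist_triangle ζ z ζ₀).trans_lt (by linarith))
  have hle : ENNReal.ofReal B' * I + ENNReal.ofReal (|Co| ^ lam) * volume (DEps D r ε) ≤ L := by
    rw [hL]
    gcongr
    exact fun x hx => hx.1
  constructor
  · refine (lintegral_enorm_rpow_le hS hu (hδ2.trans hη1) (by linarith) (hI u hu z)
      (fun ζ hζ hd => hCo ε hε ζ (subset_closure hζ) z hz.2 hd) hB' ?_).trans hle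
    intro ζ hζ hd hne
    exact (hpt ε hε ζ (hζU ζ hζ hd) z hzU (hd.trans_le hδ2) u hu hu' hne).1
  · refine (lintegral_enorm_rpow_le hS hu (hδ2.trans hη1) (by linarith) (hI u hu z)
      (fun ζ hζ hd => hCo ε hε z hz.2 ζ (subset_closure hζ) (by rwa [norm_sub_rev])) hB' ?_).trans
      hle
    intro ζ hζ hd hne
    exact (hpt ε hε ζ (hζU ζ hζ hd) z hzU (hd.trans_le hδ2) u hu hu' hne).2

end HenkinLeiterer

end

/-! ### Passage from local to uniform bounds by compactness. -/

theorem mainTheorem6 (n : ℕ) (hn : 1 ≤ n)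
    (D : Set (HenkinLeiterer.Cn n)) (r : HenkinLeiterer.Cn n → ℝ)
    (hD : HenkinLeiterer.IsMorseDomain D r)
    (g : HenkinLeiterer.Cn n → Matrix (Fin n) (Fin n) ℂ)
    (hg : HenkinLeiterer.IsLeviMetric D r g)
    (ρ : HenkinLeiterer.Cn n → HenkinLeiterer.Cn n → ℝ)
    (hρ : HenkinLeiterer.IsDistanceFunction g ρ)
    (κ : ℝ) (hκ : 0 < κ) (χ : HenkinLeiterer.Cn n → HenkinLeiterer.Cn n → ℝ)
    (hχ : HenkinLeiterer.IsPatching ρ κ χ) :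
    ∃ ε₁ : ℝ, 0 < ε₁ ∧ ∀ ε₀ : ℝ, 0 < ε₀ → ε₀ ≤ ε₁ →
      ∀ (j : ℤ) (𝓐 : ℝ → HenkinLeiterer.Cn n → HenkinLeiterer.Cn n → HenkinLeiterer.DoubleForm n),
      HenkinLeiterer.IsAdmissibleFamily D r g ρ χ ε₀ j 𝓐 →
      ∀ lam : ℝ, 1 ≤ lam → lam * (2 * (n : ℝ) + 2 - (j : ℝ)) < 2 * (n : ℝ) + 2 →
      ∃ C : NNReal, ∀ ε ∈ Set.Ioo 0 ε₀,
        (∀ z ∈ closure (HenkinLeiterer.DEps D r ε),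
          ∫⁻ ζ in HenkinLeiterer.DEps D r ε, ‖𝓐 ε ζ z‖ₑ ^ lam < (C : ENNReal)) ∧
        (∀ ζ ∈ closure (HenkinLeiterer.DEps D r ε),
          ∫⁻ z in HenkinLeiterer.DEps D r ε, ‖𝓐 ε ζ z‖ₑ ^ lam < (C : ENNReal)) := by
  obtain ⟨ε₁, η, C, hG⟩ := HenkinLeiterer.exists_geometricBounds hD hg hρ hκ hχ
  refine ⟨ε₁, hG.pos.1, fun ε₀ _ hε₀ j 𝓐 hA lam hlam h => ?_⟩
  obtain ⟨L, hL⟩ : ∃ L : NNReal, ∀ ε ∈ Set.Ioo 0 ε₀,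
      ∀ z ∈ closure D ∩ closure (HenkinLeiterer.DEps D r ε),
        ∫⁻ ζ in HenkinLeiterer.DEps D r ε, ‖𝓐 ε ζ z‖ₑ ^ lam ≤ L ∧
        ∫⁻ ζ in HenkinLeiterer.DEps D r ε, ‖𝓐 ε z ζ‖ₑ ^ lam ≤ L := by
    -- Sets on which a common constant exists are closed under subsets and finite unions, and every
    -- point of D̄ has such a neighbourhood.
    refine hD.isCompact_closure.induction_on (p := fun s => ∃ L : NNReal, ∀ ε ∈ Set.Ioo 0 ε₀,
      ∀ z ∈ s ∩ closure (HenkinLeiterer.DEps D r ε),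
        ∫⁻ ζ in HenkinLeiterer.DEps D r ε, ‖𝓐 ε ζ z‖ₑ ^ lam ≤ L ∧
        ∫⁻ ζ in HenkinLeiterer.DEps D r ε, ‖𝓐 ε z ζ‖ₑ ^ lam ≤ L) ?_ ?_ ?_ ?_
    · exact ⟨0, fun ε _ z hz => hz.1.elim⟩
    · rintro s t hst ⟨L, hL⟩
      exact ⟨L, fun ε hε z hz => hL ε hε z ⟨hst hz.1, hz.2⟩⟩
    · rintro s t ⟨L, hL⟩ ⟨L', hL'⟩
      refine ⟨L + L', fun ε hε z hz => ?_⟩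
      have h1 : (L : ENNReal) ≤ (L + L' : NNReal) := by exact_mod_cast le_self_add
      have h2 : (L' : ENNReal) ≤ (L + L' : NNReal) := by exact_mod_cast le_add_self
      rcases hz.1 with hs | ht
      · exact (hL ε hε z ⟨hs, hz.2⟩).imp (·.trans h1) (·.trans h1)
      · exact (hL' ε hε z ⟨ht, hz.2⟩).imp (·.trans h2) (·.trans h2)
    · intro ζ₀ hζ₀
      obtain ⟨V, hV, L, hL⟩ := hA.exists_local_bound hn hD hG hε₀ hlam h hζ₀
      exact ⟨V, mem_nhdsWithin_of_mem_nhds hV, L, hL⟩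
  -- Adding 1 turns the bound into a strict one.
  have hlt : (L : ENNReal) < (L + 1 : NNReal) := by exact_mod_cast lt_add_one L
  refine ⟨L + 1, fun ε hε => ⟨fun z hz => ?_, fun ζ hζ => ?_⟩⟩
  · exact (hL ε hε z ⟨HenkinLeiterer.mem_closure_of_mem_closure_DEps hz, hz⟩).1.trans_lt hlt
  · exact (hL ε hε ζ ⟨HenkinLeiterer.mem_closure_of_mem_closure_DEps hζ, hζ⟩).2.trans_lt hlt
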